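/- Work over an algebraically closed field $k$ of characteristic $0$. Let $a \ge b$ be integers and $\mathcal E=\mathcal O_{\mathbf P^1}(-a)\oplus\mathcal O_{\mathbf P^1}(-b)$. Let $\widetilde Y$ be a $3$-rope on $\mathbf P^1$ with conormal bundle $\mathcal E$, that is, a $k$-scheme $\widetilde Y$ with a closed immersion $\mathbf P^1\hookrightarrow\widetilde Y$ over $k$ identifying $\mathbf P^1$ with $\widetilde Y_{\mathrm{red}}$, whose ideal sheaf $\mathcal I$ satisfies $\mathcal I^2=0$ and $\mathcal I\simeq\mathcal E$ as $\mathcal O_{\mathbf P^1}$-modules. Let $N$ be an integer with $N\ge\max\{4,a-1\}$, let $M=N+h^0(\mathcal E\otimes\mathcal O_{\mathbf P^1}(N))$, let $i:\mathbf P^1\hookrightarrow\mathbf P^N$ be an embedding of $\mathbf P^1$ as a rational normal curve (of degree $N$), and let $\mathbf P^N\subset\mathbf P^M$ be the inclusion of a linear subspace. Then there is an embedding (closed immersion over $k$) $\widetilde j:\widetilde Y\hookrightarrow\mathbf P^M$ extending $i$, that is, whose restriction to $\mathbf P^1$ is the composite $\mathbf P^1\overset{i}{\hookrightarrow}\mathbf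 P^N\subset\mathbf P^M$, such that $\widetilde j$ embeds $\widetilde Y$ as a linearly normal subscheme of $\mathbf P^M$, that is, the restriction map $H^0(\mathbf P^M,\mathcal O_{\mathbf P^M}(1))\to H^0(\widetilde Y,\widetilde j^*\mathcal O_{\mathbf P^M}(1))$ is surjective. -/

import Mathlib

open CategoryTheory AlgebraicGeometry TopologicalSpace
open Limits (biprod)

universe u

noncomputable section

namespace ThreeRope

attribute [local instance] MvPolynomial.gradedAlgebra

/-! ### Projective space over a field -/

/-- Projective `n`-space over `k`, as `Proj k[x₀, …, xₙ]`. -/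
def PSpace (k : Type u) [Field k] (n : ℕ) : Scheme.{u} :=
  Proj (MvPolynomial.homogeneousSubmodule (Fin (n + 1)) k)

section

variable (k : Type u) [Field k] (n : ℕ)

/-- The structure morphism `ℙⁿ ⟶ Spec k`. -/
instance PSpace.over : (PSpace k n).Over (Spec (.of k)) where
  hom := Proj.toSpecZero (MvPolynomial.homogeneousSubmodule (Fin (n + 1)) k) ≫
    Spec.map (CommRingCat.ofHom
      (algebraMap k (MvPolynomial.homogeneousSubmodule (Fin (n + 1)) k 0)))

variable {n}

/-- The standard chart `D₊(xᵢ)` of `ℙⁿ`. -/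
def chart (i : Fin (n + 1)) : (PSpace k n).Opens :=
  Proj.basicOpen (MvPolynomial.homogeneousSubmodule (Fin (n + 1)) k) (MvPolynomial.X i)

/-- The regular function `xₗ / xᵢ` on the chart `D₊(xᵢ)`. -/
def coordRatio (i l : Fin (n + 1)) : Γ(PSpace k n, chart k i) :=
  (Proj.awayToSection (MvPolynomial.homogeneousSubmodule (Fin (n + 1)) k)
    (MvPolynomial.X i)).hom
    (HomogeneousLocalization.Away.mk (MvPolynomial.homogeneousSubmodule (Fin (n + 1)) k)
      (MvPolynomial.isHomogeneous_X k i) 1 (MvPolynomial.X l)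
      (by simpa using MvPolynomial.isHomogeneous_X k l))

end

/-! ### Sheaves of modules -/

/-- The structure sheaf `𝒪_X` as an `𝒪_X`-module. -/
def structureModule (X : Scheme.{u}) : X.Modules := SheafOfModules.unit X.ringCatSheaf

/-- Restriction of sections of a sheaf of modules. -/
def res {X : Scheme.{u}} (E : X.Modules) {V U : X.Opens} (h : V ≤ U) : Γ(E, U) →+ Γ(E, V) :=
  (E.presheaf.map (homOfLE h).op).hom

/-- Restriction of regular functions. -/
def resFun {X : Scheme.{u}} {V U : X.Opens} (h : V ≤ U) : Γ(X, U) →+* Γ(X, V) :=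
  (X.presheaf.map (homOfLE h).op).hom

section res

variable {X : Scheme.{u}} (E : X.Modules) {W V U : X.Opens}

theorem res_res (h : V ≤ U) (h' : W ≤ V) (s : Γ(E, U)) :
    res E h' (res E h s) = res E (h'.trans h) s := by
  simp only [res]
  erw [← ConcreteCategory.comp_apply, ← Functor.map_comp]
  rfl

theorem res_self (h : U ≤ U) (s : Γ(E, U)) : res E h s = s := by
  simp only [res]
  have : (homOfLE h).op = 𝟙 (Opposite.op U) := rfl
  rw [this, E.presheaf.map_id]
  rfl

theorem resFun_resFun (h : V ≤ U) (h' : W ≤ V) (r : Γ(X, U)) :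
    resFun h' (resFun h r) = resFun (h'.trans h) r := by
  simp only [resFun]
  erw [← ConcreteCategory.comp_apply, ← Functor.map_comp]
  rfl

theorem resFun_self (h : U ≤ U) (r : Γ(X, U)) : resFun h r = r := by
  simp only [resFun]
  have : (homOfLE h).op = 𝟙 (Opposite.op U) := rfl
  rw [this, X.presheaf.map_id]
  rfl

theorem res_smul (h : V ≤ U) (r : Γ(X, U)) (s : Γ(E, U)) :
    res E h (r • s) = resFun h r • res E h s :=
  E.map_smul (homOfLE h) r s

theorem res_eq_of_cover {ι : Type*} (U : ι → X.Opens) (V : X.Opens) (hU : ∀ a, U a ≤ V)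
    (hV : V ≤ iSup U) (s t : Γ(E, V)) (h : ∀ a, res E (hU a) s = res E (hU a) t) : s = t :=
  TopCat.Sheaf.eq_of_locally_eq' ⟨E.presheaf, E.isSheaf⟩ U V (fun a => homOfLE (hU a)) hV s t h

theorem res_glue {ι : Type*} (U : ι → X.Opens) (V : X.Opens) (hU : ∀ a, U a ≤ V)
    (hV : V ≤ iSup U) (s : ∀ a, Γ(E, U a))
    (h : ∀ a b, res E (inf_le_left : U a ⊓ U b ≤ U a) (s a)
      = res E (inf_le_right : U a ⊓ U b ≤ U b) (s b)) :
    ∃ t : Γ(E, V), ∀ a, res E (hU a) t = s a :=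
  (TopCat.Sheaf.existsUnique_gluing' ⟨E.presheaf, E.isSheaf⟩ U V (fun a => homOfLE (hU a)) hV s
    h).exists

end res

/-! ### Serre twists

For a morphism `f : X ⟶ ℙⁿ`, an `𝒪_X`-module `E` and `d : ℤ` we construct `E ⊗ f^*𝒪(d)`. The
invertible sheaf `𝒪(d)` is free on the generator `xᵢ ^ d` over `D₊(xᵢ)`, so that a section over `U`
is a family of sections `sᵢ` of `E` over `U ∩ f⁻¹ D₊(xᵢ)` with `sᵢ xᵢ ^ d = sₗ xₗ ^ d` for all `i`
and `l`, that is, `sᵢ = (xₗ / xᵢ) ^ d sₗ` on `U ∩ f⁻¹ D₊(xᵢ) ∩ f⁻¹ D₊(xₗ)`. -/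

section twist

variable {k : Type u} [Field k] {n : ℕ} {X : Scheme.{u}} (f : X ⟶ PSpace k n)

/-- The open set `f⁻¹ D₊(xᵢ)`. -/
def pchart (i : Fin (n + 1)) : X.Opens := f ⁻¹ᵁ chart k i

/-- The pullback of `xₗ / xᵢ` along `f`, a regular function on `f⁻¹ D₊(xᵢ)`. -/
def ratio (i l : Fin (n + 1)) : Γ(X, pchart f i) := (f.app (chart k i)).hom (coordRatio k i l)

theorem overlap_le_left (U : X.Opens) (i l : Fin (n + 1)) :
    U ⊓ (pchart f i ⊓ pchart f l) ≤ U ⊓ pchart f i := inf_le_inf le_rfl inf_le_left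

theorem overlap_le_right (U : X.Opens) (i l : Fin (n + 1)) :
    U ⊓ (pchart f i ⊓ pchart f l) ≤ U ⊓ pchart f l := inf_le_inf le_rfl inf_le_right

theorem overlap_le_chart (U : X.Opens) (i l : Fin (n + 1)) :
    U ⊓ (pchart f i ⊓ pchart f l) ≤ pchart f i := inf_le_right.trans inf_le_left

variable (E : X.Modules) (d : ℤ)

/-- The sections of `E ⊗ f^*𝒪(d)` over `U`. The relation `sᵢ = (xₗ / xᵢ) ^ d sₗ` is written
without inverses, with `d.toNat` and `(-d).toNat` the positive and the negative part of `d`. -/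
def twistSections (U : X.Opens) : AddSubgroup (∀ i, Γ(E, U ⊓ pchart f i)) where
  carrier := { s | ∀ i l,
    resFun (overlap_le_chart f U i l) (ratio f i l) ^ (-d).toNat •
        res E (overlap_le_left f U i l) (s i) =
      resFun (overlap_le_chart f U i l) (ratio f i l) ^ d.toNat •
        res E (overlap_le_right f U i l) (s l) }
  add_mem' := by
    intro s t hs ht i l
    simp only [Pi.add_apply, map_add, smul_add, hs i l, ht i l]
  zero_mem' := by
    intro i l
    simp only [Pi.zero_apply, map_zero, smul_zero]
  neg_mem' := by
    intro s hs i l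
    simp only [Pi.neg_apply, map_neg, smul_neg, hs i l]

/-- Restriction of regular functions from `U` to `U ∩ f⁻¹ D₊(xᵢ)`. -/
def toChart (U : X.Opens) (i : Fin (n + 1)) : Γ(X, U) →+* Γ(X, U ⊓ pchart f i) :=
  resFun inf_le_left

/-- The componentwise action of `𝒪_X(U)` on the sections of `E ⊗ f^*𝒪(d)` over `U`. -/
instance twistModule (U : X.Opens) : Module Γ(X, U) (twistSections f E d U) where
  smul r s := ⟨fun i => toChart f U i r • s.1 i, by
    intro i l
    have h := s.2 i l
    simp only [res_smul, resFun_resFun, toChart]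
    rw [smul_comm, h, smul_comm]⟩
  one_smul s := Subtype.ext <| funext fun i => by
    change toChart f U i 1 • s.1 i = s.1 i
    rw [map_one, one_smul]
  mul_smul r r' s := Subtype.ext <| funext fun i => by
    change toChart f U i (r * r') • s.1 i = toChart f U i r • toChart f U i r' • s.1 i
    rw [map_mul, mul_smul]
  smul_zero r := Subtype.ext <| funext fun i => by
    change toChart f U i r • (0 : Γ(E, U ⊓ pchart f i)) = 0
    rw [smul_zero]
  smul_add r s t := Subtype.ext <| funext fun i => by
    change toChart f U i r • (s.1 i + t.1 i) = toChart f U i r • s.1 i + toChart f U i r • t.1 i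
    rw [smul_add]
  add_smul r r' s := Subtype.ext <| funext fun i => by
    change toChart f U i (r + r') • s.1 i = toChart f U i r • s.1 i + toChart f U i r' • s.1 i
    rw [map_add, add_smul]
  zero_smul s := Subtype.ext <| funext fun i => by
    change toChart f U i 0 • s.1 i = 0
    rw [map_zero, zero_smul]

/-- Restriction of sections of `E ⊗ f^*𝒪(d)`, componentwise. -/
def twistRes {V U : X.Opens} (h : V ≤ U) : twistSections f E d U →+ twistSections f E d V where
  toFun s := ⟨fun i => res E (inf_le_inf h le_rfl) (s.1 i), by
    intro i l
    have := congrArg (res E (inf_le_inf h le_rfl :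
      V ⊓ (pchart f i ⊓ pchart f l) ≤ U ⊓ (pchart f i ⊓ pchart f l))) (s.2 i l)
    simpa only [res_smul, res_res, resFun_resFun, map_pow] using this⟩
  map_zero' := Subtype.ext <| funext fun i => map_zero _
  map_add' s t := Subtype.ext <| funext fun i => map_add _ _ _

theorem twistRes_smul {V U : X.Opens} (h : V ≤ U) (r : Γ(X, U)) (s : twistSections f E d U) :
    twistRes f E d h (r • s) = resFun h r • twistRes f E d h s := by
  refine Subtype.ext <| funext fun i => ?_
  change res E (inf_le_inf h le_rfl) (toChart f U i r • s.1 i) =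
    toChart f V i (resFun h r) • res E (inf_le_inf h le_rfl) (s.1 i)
  rw [res_smul, toChart, toChart, resFun_resFun, resFun_resFun]

/-- The presheaf of abelian groups `U ↦ twistSections f E d U`. -/
def twistAb : TopCat.Presheaf Ab.{u} X where
  obj U := AddCommGrpCat.of (twistSections f E d U.unop)
  map g := AddCommGrpCat.ofHom (twistRes f E d g.unop.le)
  map_id U := AddCommGrpCat.hom_ext <| AddMonoidHom.ext
    fun (s : twistSections f E d U.unop) => Subtype.ext <| funext fun i => res_self E _ (s.1 i)
  map_comp {U _ _} g g' := AddCommGrpCat.hom_ext <| AddMonoidHom.ext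
    fun (s : twistSections f E d U.unop) => Subtype.ext <| funext fun i =>
      (res_res E (inf_le_inf g.unop.le le_rfl) (inf_le_inf g'.unop.le le_rfl) (s.1 i)).symm

/-- `twistAb` as a presheaf of `𝒪_X`-modules. -/
def twistPresheaf : X.PresheafOfModules :=
  letI (U : X.Opensᵒᵖ) : Module (X.ringCatSheaf.obj.obj U) ((twistAb f E d).obj U) :=
    inferInstanceAs (Module Γ(X, U.unop) (twistSections f E d U.unop))
  PresheafOfModules.ofPresheaf (twistAb f E d)
    (fun _ _ g r s => twistRes_smul f E d g.unop.le r s)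

theorem twistAb_isSheaf : TopCat.Presheaf.IsSheaf (twistAb f E d) := by
  rw [TopCat.Presheaf.isSheaf_iff_isSheafUniqueGluing]
  intro ι U sf hsf
  have hsf' : ∀ a b i, res E (inf_le_inf inf_le_left le_rfl) ((show twistSections f E d (U a) from sf a).1 i) =
      res E (inf_le_inf inf_le_right le_rfl : (U a ⊓ U b) ⊓ pchart f i ≤ _) ((show twistSections f E d (U b) from sf b).1 i) := by
    intro a b i
    exact congrFun (congrArg Subtype.val (hsf a b)) i
  have hle : ∀ a i, U a ⊓ pchart f i ≤ iSup U ⊓ pchart f i :=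
    fun a i => inf_le_inf (le_iSup U a) le_rfl
  have hcov : ∀ W : X.Opens, iSup U ⊓ W ≤ ⨆ a, U a ⊓ W := fun W => (iSup_inf_eq U W).le
  have key : ∀ i, ∃ t : Γ(E, iSup U ⊓ pchart f i),
      ∀ a, res E (hle a i) t = (show twistSections f E d (U a) from sf a).1 i := by
    intro i
    refine res_glue E (fun a => U a ⊓ pchart f i) _ (fun a => hle a i) (hcov _) _ ?_
    intro a b
    have := congrArg (res E (le_inf (le_inf (inf_le_left.trans inf_le_left)
      (inf_le_right.trans inf_le_left)) (inf_le_left.trans inf_le_right) :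
      (U a ⊓ pchart f i) ⊓ (U b ⊓ pchart f i) ≤ (U a ⊓ U b) ⊓ pchart f i)) (hsf' a b i)
    simpa only [res_res] using this
  choose t ht using key
  refine ⟨⟨t, ?_⟩, ?_, ?_⟩
  · intro i l
    refine res_eq_of_cover E (fun a => U a ⊓ (pchart f i ⊓ pchart f l)) _
      (fun a => inf_le_inf (le_iSup U a) le_rfl) (hcov _) _ _ ?_
    intro a
    have h1 := (show twistSections f E d (U a) from sf a).2 i l
    rw [← ht i a, ← ht l a] at h1
    simpa only [res_smul, res_res, resFun_resFun, map_pow] using h1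
  · intro a
    exact Subtype.ext <| funext fun i => ht i a
  · intro s hs
    refine Subtype.ext <| funext fun i => ?_
    refine res_eq_of_cover E (fun a => U a ⊓ pchart f i) _ (fun a => hle a i) (hcov _) _ _ ?_
    intro a
    rw [ht i a]
    exact congrFun (congrArg Subtype.val (hs a)) i

/-- The `𝒪_X`-module `E(d) = E ⊗ f^*𝒪(d)` for a morphism `f : X ⟶ ℙⁿ`. -/
def twist : X.Modules where
  val := twistPresheaf f E d
  isSheaf := twistAb_isSheaf f E d

/-- The components `sᵢ` of a section of `E ⊗ f^*𝒪(d)` in the charts. -/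
def comp {U : X.Opens} (s : Γ(twist f E d, U)) : ∀ i, Γ(E, U ⊓ pchart f i) :=
  (show twistSections f E d U from s).1

/-- The invertible sheaf `𝒪(d)` on `ℙⁿ`. -/
def lineBundle (k : Type u) [Field k] (n : ℕ) (d : ℤ) : (PSpace k n).Modules :=
  twist (𝟙 (PSpace k n)) (structureModule (PSpace k n)) d

/-- The invertible sheaf `f^*𝒪(d)` on `X` for a morphism `f : X ⟶ ℙⁿ`. -/
def pullbackBundle : X.Modules := twist f (structureModule X) d

/-- The pullback of regular functions along `f`. -/
def pullFun {X Y : Scheme.{u}} (f : X ⟶ Y) {U : Y.Opens} {V : X.Opens} (h : V ≤ f ⁻¹ᵁ U) :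
    Γ(Y, U) →+* Γ(X, V) := (f.appLE U V h).hom

theorem pullFun_resFun {X Y : Scheme.{u}} (f : X ⟶ Y) {U' U : Y.Opens} {V' V : X.Opens}
    (hU : U' ≤ U) (e' : V' ≤ f ⁻¹ᵁ U') (e : V ≤ f ⁻¹ᵁ U) (hV : V' ≤ V) (r : Γ(Y, U)) :
    pullFun f e' (resFun hU r) = resFun hV (pullFun f e r) := by
  simp only [pullFun, resFun, ← CommRingCat.comp_apply]
  rw [Scheme.Hom.map_appLE, Scheme.Hom.appLE_map]

theorem pchart_le (i : Fin (n + 1)) : pchart f i ≤ f ⁻¹ᵁ pchart (𝟙 (PSpace k n)) i :=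
  fun _ h => h

theorem inf_pchart_le (U : (PSpace k n).Opens) (i : Fin (n + 1)) :
    f ⁻¹ᵁ U ⊓ pchart f i ≤ f ⁻¹ᵁ (U ⊓ pchart (𝟙 (PSpace k n)) i) := fun _ h => h

theorem inf_inf_pchart_le (U : (PSpace k n).Opens) (i l : Fin (n + 1)) :
    f ⁻¹ᵁ U ⊓ (pchart f i ⊓ pchart f l) ≤
      f ⁻¹ᵁ (U ⊓ (pchart (𝟙 (PSpace k n)) i ⊓ pchart (𝟙 (PSpace k n)) l)) := fun _ h => h

theorem pullFun_ratio (i l : Fin (n + 1)) :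
    pullFun f (pchart_le f i) (ratio (𝟙 (PSpace k n)) i l) = ratio f i l := by
  have h : (𝟙 (PSpace k n) : PSpace k n ⟶ PSpace k n).app (chart k i) ≫
      f.appLE (pchart (𝟙 (PSpace k n)) i) (pchart f i) (pchart_le f i) = f.app (chart k i) := by
    have := Scheme.Hom.comp_appLE f (𝟙 (PSpace k n)) (chart k i) (pchart f i) (fun _ h => h)
    refine this.symm.trans ?_
    simp only [Category.comp_id]
    exact Scheme.Hom.appLE_eq_app f
  exact congrArg (fun g => g.hom (coordRatio k i l)) h

theorem pull_rel {U : (PSpace k n).Opens} (i l : Fin (n + 1)) (p q : ℕ)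
    (s : Γ(PSpace k n, U ⊓ pchart (𝟙 (PSpace k n)) i))
    (t : Γ(PSpace k n, U ⊓ pchart (𝟙 (PSpace k n)) l))
    (h : resFun (overlap_le_chart _ U i l) (ratio (𝟙 (PSpace k n)) i l) ^ p *
        resFun (overlap_le_left _ U i l) s =
      resFun (overlap_le_chart _ U i l) (ratio (𝟙 (PSpace k n)) i l) ^ q *
        resFun (overlap_le_right _ U i l) t) :
    resFun (overlap_le_chart f (f ⁻¹ᵁ U) i l) (ratio f i l) ^ p *
        resFun (overlap_le_left f (f ⁻¹ᵁ U) i l) (pullFun f (inf_pchart_le f U i) s) =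
      resFun (overlap_le_chart f (f ⁻¹ᵁ U) i l) (ratio f i l) ^ q *
        resFun (overlap_le_right f (f ⁻¹ᵁ U) i l) (pullFun f (inf_pchart_le f U l) t) := by
  have h := congrArg (pullFun f (inf_inf_pchart_le f U i l)) h
  rwa [map_mul, map_mul, map_pow, map_pow,
    pullFun_resFun f _ _ (pchart_le f i) (overlap_le_chart f _ i l),
    pullFun_resFun f _ _ (inf_pchart_le f U i) (overlap_le_left f _ i l),
    pullFun_resFun f _ _ (inf_pchart_le f U l) (overlap_le_right f _ i l), pullFun_ratio] at h

theorem twistSections_pull {U : (PSpace k n).Opens}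
    (s : twistSections (𝟙 (PSpace k n)) (structureModule (PSpace k n)) d U) :
    (fun i => pullFun f (inf_pchart_le f U i) (s.1 i)) ∈
      twistSections f (structureModule X) d (f ⁻¹ᵁ U) :=
  fun i l => pull_rel f i l _ _ (s.1 i) (s.1 l) (s.2 i l)

/-- The pullback map `𝒪(d)(U) → (f^*𝒪(d))(f⁻¹ U)` on sections, componentwise the pullback of
functions along `f`. -/
def pullSections (U : (PSpace k n).Opens) :
    Γ(lineBundle k n d, U) →+ Γ(pullbackBundle f d, f ⁻¹ᵁ U) where
  toFun s := show twistSections f (structureModule X) d (f ⁻¹ᵁ U) from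
    ⟨fun i => pullFun f (inf_pchart_le f U i) (comp _ _ d s i), twistSections_pull f d s⟩
  map_zero' := Subtype.ext <| funext fun i => map_zero (pullFun f (inf_pchart_le f U i))
  map_add' _ _ := Subtype.ext <| funext fun i => map_add (pullFun f (inf_pchart_le f U i)) _ _

end twist

/-! ### Embeddings -/

section embeddings

variable {k : Type u} [Field k] {m n : ℕ} {X : Scheme.{u}}

/-- A morphism `j : X ⟶ ℙⁿ` is nondegenerate if its image lies in no hyperplane, that is, if
`H⁰(ℙⁿ, 𝒪(1)) → H⁰(X, j^*𝒪(1))` is injective. -/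
def IsNondegenerate (j : X ⟶ PSpace k n) : Prop :=
  Function.Injective (pullSections j 1 ⊤)

/-- An embedding `j : X ⟶ ℙⁿ` is linearly normal if `H⁰(ℙⁿ, 𝒪(1)) → H⁰(X, j^*𝒪(1))` is
surjective. -/
def IsLinearlyNormal (j : X ⟶ PSpace k n) : Prop :=
  Function.Surjective (pullSections j 1 ⊤)

/-- A `k`-morphism `f : ℙᵐ ⟶ ℙⁿ` is an embedding of degree `d`: a closed immersion with
`f^*𝒪(1) ≅ 𝒪(d)`. -/
structure IsEmbeddingOfDegree (f : PSpace k m ⟶ PSpace k n) (d : ℤ) : Prop where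
  isOver : f.IsOver (Spec (.of k))
  isClosedImmersion : IsClosedImmersion f
  degree : Nonempty (pullbackBundle f 1 ≅ lineBundle k m d)

/-- `i : ℙ¹ ⟶ ℙᴺ` embeds `ℙ¹` as a rational normal curve: a nondegenerate curve of degree `N`. -/
structure IsRationalNormalCurve {N : ℕ} (i : PSpace k 1 ⟶ PSpace k N) : Prop where
  isEmbedding : IsEmbeddingOfDegree i N
  isNondegenerate : IsNondegenerate i

/-- `ℓ : ℙᴺ ⟶ ℙᴹ` is the inclusion of a linear subspace. -/
abbrev IsLinearEmbedding (ℓ : PSpace k m ⟶ PSpace k n) : Prop := IsEmbeddingOfDegree ℓ 1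

end embeddings

/-! ### Ropes -/

/-- `ι : Y ⟶ Y'` exhibits `Y'` as a rope on the reduced scheme `Y` with conormal bundle `E` (a rope
of multiplicity `m` if `E` is locally free of rank `m - 1`): `ι` identifies `Y` with the reduced
subscheme of `Y'`, the ideal sheaf `I` of `Y` in `Y'` satisfies `I ^ 2 = 0`, and `I ≅ E`. As `I`
is a sheaf on `Y'`, the last condition is stated as an isomorphism from the `𝒪_{Y'}`-module `ι_* E`
onto the submodule `I = ker (𝒪_{Y'} → ι_* 𝒪_Y)` of `𝒪_{Y'}`. -/
structure IsRope {Y Y' : Scheme.{u}} (ι : Y ⟶ Y') (E : Y.Modules) : Prop where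
  isReduced : IsReduced Y
  isClosedImmersion : IsClosedImmersion ι
  surjective : Function.Surjective ι
  sq_eq_zero : ∀ (V : Y'.Opens) (s t : Γ(Y', V)),
    (ι.app V).hom s = 0 → (ι.app V).hom t = 0 → s * t = 0
  conormal : ∃ α : (Scheme.Modules.pushforward ι).obj E ⟶ structureModule Y', ∀ V : Y'.Opens,
    Function.Injective (α.app V) ∧
      ∀ s : Γ(Y', V), (ι.app V).hom s = 0 ↔
        ∃ e : Γ((Scheme.Modules.pushforward ι).obj E, V), α.app V e = s

/-- The ring homomorphism `k → Γ(X, 𝒪_X)` of a `k`-scheme `X`. -/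
def scalars (k : Type u) [Field k] (X : Scheme.{u}) [X.Over (Spec (.of k))] : k →+* Γ(X, ⊤) :=
  ((Scheme.ΓSpecIso (.of k)).inv ≫ (X ↘ Spec (.of k)).appTop).hom

/-- `h⁰(E) = dim_k H⁰(X, E)`. -/
def h0 (k : Type u) [Field k] {X : Scheme.{u}} [X.Over (Spec (.of k))] (E : X.Modules) : ℕ :=
  letI : Module k Γ(E, ⊤) := Module.compHom Γ(E, ⊤) (scalars k X)
  Module.finrank k Γ(E, ⊤)

/-- The vector bundle `𝒪(-a) ⊕ 𝒪(-b)` on `ℙ¹`. -/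
def splitBundle (k : Type u) [Field k] (a b : ℤ) : (PSpace k 1).Modules :=
  biprod (lineBundle k 1 (-a)) (lineBundle k 1 (-b))

/-- The bundle `E(d) = E ⊗ 𝒪(d)` for a sheaf of modules `E` on `ℙⁿ`. -/
def serreTwist {k : Type u} [Field k] {n : ℕ} (E : (PSpace k n).Modules) (d : ℤ) :
    (PSpace k n).Modules := twist (𝟙 (PSpace k n)) E d

end ThreeRope

end

noncomputable section

namespace ThreeRope

attribute [local instance] MvPolynomial.gradedAlgebra

/-! An embedding of the rope extending the given curve is a line bundle `L` on the rope that
restricts to `𝒪(N)`, together with sections of `L` that lift the given homogeneous coordinates and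
separate the infinitesimal directions. Everything is computed on the two standard charts of `ℙ¹`.
Over them and over their intersection the functions on the rope form square-zero extensions of
`k[X]`, `k[X]` and `k[T;T⁻¹]` by free modules of rank two, and the kernels are glued by `T ^ (-w c)`
with `w = (a, b)` (`GluingData`). That functions on a chart lift to the rope is the vanishing of
Čech `H¹` on an affine scheme (`red_surjective`).

Lift the two coordinates to `τ` and `σ`, so that `τ σ = 1 + η` with `η` in the kernel. Each `ε` in
the kernel over the intersection gives a bundle `L` of degree `N` with transition function `τ ^ N (1
+ ε)`. The monomial `T ^ m` lifts to the section `(τ ^ m + u, σ ^ (N - m) + v)` once `T ^ m (ε + (N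
- m) η)` is a difference of a part from the first chart and a part from the second. This is always
possible, because `a ≤ N + 1` gives `H¹(E(N)) = 0`. Hence `H⁰(L) → H⁰(𝒪(N))` is surjective with
kernel `H⁰(E(N))`, and `h⁰(L) = M + 1`.

The real point is to choose `ε` so that ratios of sections generate the conormal sheaf. A summand
with `w c ≤ N` is generated by sections of `E(N)`. A summand with `w c = N + 1` becomes `𝒪(-1)`,
which has no sections, and there nonlinear expressions are needed. If `s m` denotes the lift of `T ^
m`, then the second difference `s (n+2) - 2 X s (n+1) + X ^ 2 s n`, formed with ratios, lies in the
kernel. Since the obstruction is affine in `m`, the second differences on the two charts glue to a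
section of `𝒪(1)`, that is, to a linear polynomial whose two coefficients are coefficients of the
obstructions (`second_difference`). The cases `n = 0, 1, 2` use `m ≤ 4 ≤ N`. Prescribing four
coefficients of `ε`, with one parameter avoiding finitely many values, makes the three vectors of
linear forms generate at every point (`exists_general_twistData`, `eq_top_of_left`,
`eq_top_of_right`, assembled in `exists_twist`).

Finally, the `M + 1` coordinates of the composite `ℙ¹ → ℙᴺ ⊂ ℙᴹ` span the polynomials of degree at
most `N`. As `h⁰(L) = M + 1`, linear algebra lifts them to a basis of `H⁰(L)`
(`exists_spanning_lift`). This basis defines a morphism extending the given one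
(`exists_extension`). It is a closed immersion, because it is one on `ℙ¹` and reaches the conormal
sheaf on stalks (`isClosedImmersion_of_ropeChart`). It is linearly normal, because the linear system
is complete. -/

variable {k : Type u} [Field k] {n : ℕ}

/-! ### Projective space: charts, ratios of coordinates, scalars -/

/-- The scalars `k → Γ(X, U)`. -/
def scalarsOn (k : Type u) [Field k] (X : Scheme.{u}) [X.Over (Spec (.of k))] (U : X.Opens) :
    k →+* Γ(X, U) := (resFun le_top).comp (scalars k X)

/-- The grading of `k[x₀, …, xₙ]`. -/
abbrev grading (k : Type u) [Field k] (n : ℕ) := MvPolynomial.homogeneousSubmodule (Fin (n + 1)) k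

theorem X_mem_grading (i : Fin (n + 1)) : MvPolynomial.X i ∈ grading k n 1 :=
  MvPolynomial.isHomogeneous_X k i

/-- The coordinate ring `k[x₀ / xᵢ, …, xₙ / xᵢ]` of the chart `D₊(xᵢ)`. -/
abbrev ChartRing (k : Type u) [Field k] {n : ℕ} (i : Fin (n + 1)) : Type u :=
  HomogeneousLocalization.Away (grading k n) (MvPolynomial.X i)

/-- The map from the coordinate ring of the chart `D₊(xᵢ)` to its regular functions. -/
def chartSection (i : Fin (n + 1)) : ChartRing k i →+* Γ(PSpace k n, chart k i) :=
  (Proj.awayToSection (grading k n) (MvPolynomial.X i)).hom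

theorem chartSection_bijective (i : Fin (n + 1)) :
    Function.Bijective (chartSection (k := k) i) :=
  ConcreteCategory.bijective_of_isIso
    (Proj.basicOpenIsoAway (grading k n) _ (X_mem_grading i) one_pos).hom

/-- The element `xₗ / xᵢ` of the coordinate ring of `D₊(xᵢ)`. -/
def awayRatio (k : Type u) [Field k] {n : ℕ} (i l : Fin (n + 1)) : ChartRing k i :=
  HomogeneousLocalization.Away.mk (grading k n) (X_mem_grading i) 1 (MvPolynomial.X l)
    (by simpa using X_mem_grading l)

theorem awayRatio_val (i l : Fin (n + 1)) : (awayRatio k i l).val =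
    Localization.mk (MvPolynomial.X l)
      (⟨MvPolynomial.X i ^ 1, 1, rfl⟩ : Submonoid.powers (MvPolynomial.X (R := k) i)) := rfl

theorem chartSection_awayRatio (i l : Fin (n + 1)) :
    chartSection i (awayRatio k i l) = coordRatio k i l := rfl

theorem coordRatio_self (i : Fin (n + 1)) : coordRatio k i i = 1 := by
  have : awayRatio k i i = 1 := by
    apply HomogeneousLocalization.val_injective
    rw [awayRatio_val, HomogeneousLocalization.val_one, ← Localization.mk_one,
      Localization.mk_eq_mk_iff, Localization.r_iff_exists]
    exact ⟨1, by simp⟩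
  rw [← chartSection_awayRatio, this, map_one]

/-- The intersection of two charts. -/
def chartInter (k : Type u) [Field k] {n : ℕ} (i l : Fin (n + 1)) : (PSpace k n).Opens :=
  Proj.basicOpen (grading k n) (MvPolynomial.X i * MvPolynomial.X l)

theorem chartInter_eq (i l : Fin (n + 1)) : chartInter k i l = chart k i ⊓ chart k l :=
  Proj.basicOpen_mul _ _ _

/-- On the intersection both charts map to the degree-zero localization at `xᵢ xₗ`, where the
cocycle relation is an identity of fractions. -/
theorem coordRatio_mul (i l m : Fin (n + 1)) :
    resFun (inf_le_left : chart k i ⊓ chart k l ≤ chart k i) (coordRatio k i l) *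
      resFun (inf_le_right : chart k i ⊓ chart k l ≤ chart k l) (coordRatio k l m) =
    resFun (inf_le_left : chart k i ⊓ chart k l ≤ chart k i) (coordRatio k i m) := by
  have e := chartInter_eq (k := k) i l
  have h1 : chartInter k i l ≤ chart k i := e.le.trans inf_le_left
  have h2 : chartInter k i l ≤ chart k l := e.le.trans inf_le_right
  have r1 (s) : resFun h1 (chartSection i s) =
      (Proj.awayToSection (grading k n) _).hom
        (HomogeneousLocalization.awayMap (grading k n) (X_mem_grading l) rfl s) :=
    (congrArg (fun φ => φ.hom s)
      (Proj.awayMap_awayToSection (grading k n) (X_mem_grading l) rfl)).symm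
  have r2 (s) : resFun h2 (chartSection l s) =
      (Proj.awayToSection (grading k n) _).hom
        (HomogeneousLocalization.awayMap (grading k n) (X_mem_grading i) (mul_comm _ _) s) :=
    (congrArg (fun φ => φ.hom s)
      (Proj.awayMap_awayToSection (grading k n) (X_mem_grading i) (mul_comm _ _))).symm
  have key : resFun h1 (coordRatio k i l) * resFun h2 (coordRatio k l m) =
      resFun h1 (coordRatio k i m) := by
    rw [← chartSection_awayRatio, ← chartSection_awayRatio, ← chartSection_awayRatio, r1, r2, r1]
    refine (map_mul (Proj.awayToSection (grading k n) _).hom _ _).symm.trans ?_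
    congr 1
    apply HomogeneousLocalization.val_injective
    rw [HomogeneousLocalization.val_mul, awayRatio, awayRatio, awayRatio,
      HomogeneousLocalization.awayMap_mk, HomogeneousLocalization.awayMap_mk,
      HomogeneousLocalization.awayMap_mk]
    simp only [HomogeneousLocalization.Away.val_mk]
    rw [Localization.mk_mul, Localization.mk_eq_mk_iff, Localization.r_iff_exists]
    exact ⟨1, by simp; ring⟩
  have := congrArg (resFun e.ge) key
  simpa only [map_mul, resFun_resFun] using this

theorem iSup_chart : (⨆ i, chart k (n := n) i) = ⊤ := by
  refine Proj.iSup_basicOpen_eq_top' (grading k n) (fun i => MvPolynomial.X i)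
    (fun i => Exists.intro 1 (X_mem_grading i)) ?_
  rw [eq_top_iff]
  rintro p -
  induction p using MvPolynomial.induction_on with
  | C a =>
    exact Subalgebra.algebraMap_mem _
      (⟨MvPolynomial.C a, MvPolynomial.isHomogeneous_C _ _⟩ : grading k n 0)
  | add p q hp hq => exact add_mem hp hq
  | mul_X p i hp =>
    exact mul_mem hp (Algebra.subset_adjoin (Set.mem_range_self i))

/-- The open immersion `Spec k[x₀ / xᵢ, …, xₙ / xᵢ] ⟶ ℙⁿ` onto the chart `D₊(xᵢ)`. -/
def chartMap (k : Type u) [Field k] {n : ℕ} (i : Fin (n + 1)) :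
    Spec (.of (ChartRing k i)) ⟶ PSpace k n :=
  Proj.awayι (grading k n) _ (X_mem_grading i) one_pos

instance chartMap_isOpenImmersion (i : Fin (n + 1)) : IsOpenImmersion (chartMap k i) :=
  inferInstanceAs (IsOpenImmersion (Proj.awayι (grading k n) _ (X_mem_grading i) one_pos))

theorem opensRange_chartMap (i : Fin (n + 1)) : (chartMap k i).opensRange = chart k i :=
  Proj.opensRange_awayι (grading k n) _ (X_mem_grading i) one_pos

theorem isAffineOpen_chart (i : Fin (n + 1)) : IsAffineOpen (chart k i) :=
  Proj.isAffineOpen_basicOpen (grading k n) _ (X_mem_grading i) one_pos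

theorem top_le_chartMap_preimage (i : Fin (n + 1)) : ⊤ ≤ chartMap k i ⁻¹ᵁ chart k i := by
  intro x _
  change chartMap k i x ∈ chart k i
  rw [← opensRange_chartMap]
  exact ⟨x, rfl⟩

theorem pullFun_comp {X Y Z : Scheme.{u}} (f : X ⟶ Y) (g : Y ⟶ Z) {W : Z.Opens} {V : Y.Opens}
    {U : X.Opens} (e₁ : V ≤ g ⁻¹ᵁ W) (e₂ : U ≤ f ⁻¹ᵁ V) (e₃ : U ≤ (f ≫ g) ⁻¹ᵁ W) (r : Γ(Z, W)) :
    pullFun f e₂ (pullFun g e₁ r) = pullFun (f ≫ g) e₃ r :=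
  congrArg (fun φ => φ.hom r) (Scheme.Hom.appLE_comp_appLE f g W V U e₁ e₂)

theorem pullFun_congr {X Y : Scheme.{u}} {f g : X ⟶ Y} (h : f = g) {V : Y.Opens}
    {U : X.Opens} (e₁ : U ≤ f ⁻¹ᵁ V) (e₂ : U ≤ g ⁻¹ᵁ V) (r : Γ(Y, V)) :
    pullFun f e₁ r = pullFun g e₂ r := by
  subst h
  rfl

theorem pullFun_ι {X : Scheme.{u}} {U : X.Opens} (e : ⊤ ≤ U.ι ⁻¹ᵁ U) (r : Γ(X, U)) :
    pullFun U.ι e r = U.topIso.inv r := by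
  unfold pullFun
  rw [Scheme.Opens.ι_appLE]
  simp
  rfl

/-- Two identifications of the functions on a chart with its coordinate ring are in play, through
`Proj.awayToSection` and through global sections of `Spec`. Their agreement allows computations on
the chart to be made in `ChartRing`. -/
theorem pullFun_chartMap (i : Fin (n + 1)) (s : ChartRing k i) :
    pullFun (chartMap k i) (top_le_chartMap_preimage i) (chartSection i s) =
    (Scheme.ΓSpecIso (.of (ChartRing k i))).inv s := by
  let e := Proj.basicOpenIsoSpec (grading k n) (MvPolynomial.X i) (X_mem_grading i) one_pos
  have h : e.hom.app ⊤ = (Scheme.ΓSpecIso _).hom ≫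
      Proj.awayToSection (grading k n) (MvPolynomial.X i) ≫ (Scheme.Opens.topIso _).inv := by
    rw [← Proj.basicOpenToSpec_app_top,
      ← Proj.basicOpenIsoSpec_hom (grading k n) _ (X_mem_grading i) one_pos]
  have hinj : Function.Injective (e.hom.app ⊤).hom :=
    (ConcreteCategory.bijective_of_isIso (e.hom.app ⊤)).1
  apply hinj
  have h1 : (e.hom.app ⊤).hom ((Scheme.ΓSpecIso (.of (ChartRing k i))).inv s) =
      (Scheme.Opens.topIso (chart k i)).inv (chartSection i s) := by
    rw [h]
    change (Scheme.Opens.topIso (chart k i)).inv.hom (chartSection i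
      ((Scheme.ΓSpecIso (.of (ChartRing k i))).hom.hom
        ((Scheme.ΓSpecIso (.of (ChartRing k i))).inv.hom s))) = _
    congr 2
    exact congrArg (fun φ => φ.hom s) (Scheme.ΓSpecIso (.of (ChartRing k i))).inv_hom_id
  rw [h1]
  have h2 : e.hom ≫ chartMap k i = (chart k i).ι := e.hom_inv_id_assoc _
  have h3 (x : Γ(Spec (.of (ChartRing k i)), ⊤)) : (e.hom.app ⊤).hom x = pullFun e.hom (le_refl _) x := by
    unfold pullFun
    rw [Scheme.Hom.app_eq_appLE]
  rw [h3]
  have h4 : ⊤ ≤ (e.hom ≫ chartMap k i) ⁻¹ᵁ chart k i := by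
    rw [h2]
    exact fun x _ => x.2
  refine (pullFun_comp e.hom (chartMap k i) (top_le_chartMap_preimage i) le_rfl h4 _).trans ?_
  exact (pullFun_congr h2 _ (show ⊤ ≤ (chart k i).ι ⁻¹ᵁ chart k i from fun x _ => x.2) _).trans (pullFun_ι _ _)

theorem chartMap_over (i : Fin (n + 1)) : chartMap k i ≫ (PSpace k n ↘ Spec (.of k)) =
   Spec.map (CommRingCat.ofHom
     ((algebraMap (grading k n 0) (ChartRing k i)).comp (algebraMap k (grading k n 0)))) := by
  have := Proj.awayι_toSpecZero (grading k n) _ (X_mem_grading i) one_pos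
  change Proj.awayι (grading k n) _ (X_mem_grading i) one_pos ≫ Proj.toSpecZero _ ≫ _ = _
  rw [← Category.assoc, this, ← Spec.map_comp]
  rfl

theorem pullFun_scalarsOn {X Y : Scheme.{u}} [X.Over (Spec (.of k))] [Y.Over (Spec (.of k))]
    (f : X ⟶ Y) (h : f.IsOver (Spec (.of k))) {U : Y.Opens} {V : X.Opens} (e : V ≤ f ⁻¹ᵁ U) (c : k) :
    pullFun f e (scalarsOn k Y U c) = scalarsOn k X V c := by
  have h1 (Z : Scheme.{u}) [Z.Over (Spec (.of k))] (W : Z.Opens) : scalarsOn k Z W c =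
      pullFun (Z ↘ Spec (.of k)) (U := ⊤) (V := W) (show W ≤ (Z ↘ Spec (.of k)) ⁻¹ᵁ ⊤ from fun _ _ => trivial) ((Scheme.ΓSpecIso (.of k)).inv.hom c) := by
    rfl
  rw [h1, h1, pullFun_comp f (Y ↘ Spec (.of k)) _ _
    (show V ≤ (f ≫ (Y ↘ Spec (.of k))) ⁻¹ᵁ ⊤ from fun _ _ => trivial)]
  exact pullFun_congr ((Scheme.Hom.isOver_iff _).1 h) _ _ _

theorem resFun_scalarsOn {X : Scheme.{u}} [X.Over (Spec (.of k))]
    {U V : X.Opens} (e : V ≤ U) (c : k) :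
    resFun e (scalarsOn k X U c) = scalarsOn k X V c := resFun_resFun _ _ _

theorem scalarsOn_Spec {R : Type u} [CommRing R] (φ : k →+* R) (c : k) :
    pullFun (Spec.map (CommRingCat.ofHom φ)) (U := ⊤) (V := ⊤) (fun _ _ => trivial)
      ((Scheme.ΓSpecIso (.of k)).inv.hom c) = (Scheme.ΓSpecIso (.of R)).inv.hom (φ c) := by
  have := congrArg (fun ψ => ψ.hom c) (Scheme.ΓSpecIso_inv_naturality (CommRingCat.ofHom φ))
  refine Eq.trans ?_ this.symm
  unfold pullFun
  rw [Scheme.Hom.appTop, Scheme.Hom.app_eq_appLE]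
  rfl

theorem pullFun_bijective {X Y : Scheme.{u}} (f : X ⟶ Y) [IsOpenImmersion f] {U : Y.Opens}
    {V : X.Opens} (e : V ≤ f ⁻¹ᵁ U) (e' : f ⁻¹ᵁ U ≤ V) (hU : U ≤ f.opensRange) :
    Function.Bijective (pullFun f e) := by
  obtain rfl : V = f ⁻¹ᵁ U := le_antisymm e e'
  unfold pullFun
  rw [Scheme.Hom.appLE_eq_app]
  have := f.isIso_app U hU
  exact ConcreteCategory.bijective_of_isIso (f.app U)

theorem scalarsOn_chart (i : Fin (n + 1)) (c : k) :
    scalarsOn k (PSpace k n) (chart k i) c =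
      chartSection i (algebraMap _ _ (algebraMap k (grading k n 0) c)) := by
  apply (pullFun_bijective (chartMap k i) (top_le_chartMap_preimage i) le_top
    (opensRange_chartMap i).ge).1
  rw [pullFun_chartMap]
  let := (⟨Spec.map (CommRingCat.ofHom ((algebraMap (grading k n 0) (ChartRing k i)).comp
    (algebraMap k (grading k n 0))))⟩ : (Spec (.of (ChartRing k i))).Over (Spec (.of k)))
  rw [pullFun_scalarsOn (chartMap k i) ((Scheme.Hom.isOver_iff _).2 (chartMap_over i))]
  exact Eq.trans (by rfl) (scalarsOn_Spec ((algebraMap (grading k n 0) (ChartRing k i)).comp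
    (algebraMap k (grading k n 0))) c)

/-- The ratio `xₗ / xᵢ` is the localization element of `D₊(xᵢ)` that cuts out `D₊(xᵢ) ∩ D₊(xₗ)`, so
the claim can be checked on the spectrum of the chart ring. -/
theorem basicOpen_coordRatio (i l : Fin (n + 1)) :
    (PSpace k n).basicOpen (coordRatio k i l) ≤ chart k l := by
  intro x hx
  have hxi : x ∈ chart k i := Scheme.basicOpen_le _ _ hx
  rw [← opensRange_chartMap] at hxi
  obtain ⟨y, rfl⟩ := hxi
  have h1 : y ∈ (Spec (.of (ChartRing k i))).basicOpen (pullFun (chartMap k i)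
      (top_le_chartMap_preimage i) (coordRatio k i l)) := by
    unfold pullFun
    erw [Scheme.basicOpen_appLE]
    exact ⟨trivial, hx⟩
  rw [← chartSection_awayRatio, pullFun_chartMap] at h1
  have h2 := Proj.awayι_preimage_basicOpen (grading k n) (X_mem_grading i) one_pos (X_mem_grading l)
    one_pos
  change y ∈ chartMap k i ⁻¹ᵁ chart k l
  refine h2.ge ?_
  have h3 : HomogeneousLocalization.Away.isLocalizationElem (X_mem_grading (k := k) i)
      (X_mem_grading l) = awayRatio k i l := by
    apply HomogeneousLocalization.val_injective
    rw [awayRatio_val]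
    simp
  rw [h3]
  exact (basicOpen_eq_of_affine (R := .of (ChartRing k i)) (awayRatio k i l)).le h1

/-! ### Chart rings: generators and homomorphisms out of them -/

variable {k : Type u} [Field k] {n : ℕ}

theorem eval₂_mul_of_isHomogeneous {σ R S : Type*} [CommSemiring R] [CommSemiring S] (φ : R →+* S)
    (r : S) (y : σ → S) {p : MvPolynomial σ R} {d : ℕ} (hp : p.IsHomogeneous d) :
    p.eval₂ φ (fun l => r * y l) = r ^ d * p.eval₂ φ y := by
  rw [MvPolynomial.eval₂_eq, MvPolynomial.eval₂_eq, Finset.mul_sum]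
  refine Finset.sum_congr rfl fun m hm => ?_
  have h : m.sum (fun _ e => e) = d := by
    have := hp (MvPolynomial.mem_support_iff.1 hm)
    rwa [Finsupp.weight_apply, Finsupp.sum_congr (g2 := fun _ e => e) (by simp)] at this
  rw [← h, Finsupp.sum, ← Finset.prod_pow_eq_pow_sum]
  simp only [mul_pow, Finset.prod_mul_distrib]
  ring

/-- The ring homomorphism from `k[x₀ / xᵢ, …, xₙ / xᵢ]` given by a point with homogeneous
coordinates `G`, where `Gᵢ` is invertible. -/
def awayLift {R : Type*} [CommRing R] (φ : k →+* R) (G : Fin (n + 1) → R) (i : Fin (n + 1))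
    (hG : IsUnit (G i)) : ChartRing k i →+* R :=
  (IsLocalization.Away.lift (S := Localization.Away (MvPolynomial.X (R := k) i))
    (MvPolynomial.X (R := k) i)
    (g := MvPolynomial.eval₂Hom φ G) (by simpa using hG)).comp
    (algebraMap (ChartRing k i) (Localization.Away (MvPolynomial.X (R := k) i)))

section

variable {R : Type*} [CommRing R] (φ : k →+* R) (G : Fin (n + 1) → R) (i : Fin (n + 1))
    (hG : IsUnit (G i))

theorem awayLift_awayRatio (l : Fin (n + 1)) :
    awayLift φ G i hG (awayRatio k i l) * G i = G l := by
  let L := IsLocalization.Away.lift (S := Localization.Away (MvPolynomial.X (R := k) i))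
    (MvPolynomial.X (R := k) i)
    (g := MvPolynomial.eval₂Hom φ G) (by simpa using hG)
  have hL (p) : L (algebraMap _ _ p) = MvPolynomial.eval₂ φ G p :=
    IsLocalization.Away.lift_eq (MvPolynomial.X (R := k) i) (by simpa using hG) p
  have h : (awayRatio k i l).val *
      algebraMap (MvPolynomial (Fin (n + 1)) k) (Localization.Away (MvPolynomial.X (R := k) i))
        (MvPolynomial.X i) =
      algebraMap (MvPolynomial (Fin (n + 1)) k) (Localization.Away (MvPolynomial.X (R := k) i)) (MvPolynomial.X l) := by
    rw [awayRatio_val, ← Localization.mk_one_eq_algebraMap, ← Localization.mk_one_eq_algebraMap,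
      Localization.mk_mul, Localization.mk_eq_mk_iff, Localization.r_iff_exists]
    exact ⟨1, by simp [mul_comm]⟩
  have := congrArg L h
  rw [map_mul, hL, hL, MvPolynomial.eval₂_X, MvPolynomial.eval₂_X] at this
  exact this

theorem awayLift_algebraMap (c : k) :
    awayLift φ G i hG (algebraMap _ _ (algebraMap k (grading k n 0) c)) = φ c := by
  have := IsLocalization.Away.lift_eq (S := Localization.Away (MvPolynomial.X (R := k) i))
    (MvPolynomial.X (R := k) i)
    (g := MvPolynomial.eval₂Hom φ G) (by simpa using hG) (MvPolynomial.C c)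
  simp only [MvPolynomial.coe_eval₂Hom, MvPolynomial.eval₂_C] at this
  rw [← this]
  rfl

end

/-- An element is a fraction `p / xᵢ ^ d` with `p` homogeneous of degree `d`. By homogeneity it
equals `p` evaluated at the ratios `xₗ / xᵢ`. -/
theorem exists_awayRatio (i : Fin (n + 1)) (s : ChartRing k i) : ∃ p : MvPolynomial (Fin (n + 1)) k,
    s = p.eval₂ ((algebraMap (grading k n 0) (ChartRing k i)).comp (algebraMap k (grading k n 0)))
      (awayRatio k i) := by
  obtain ⟨d, p, hp, rfl⟩ := HomogeneousLocalization.Away.mk_surjective (grading k n)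
    (X_mem_grading i) s
  refine ⟨p, HomogeneousLocalization.val_injective _ ?_⟩
  have hp' : p.IsHomogeneous d := by simpa using hp
  let v : ChartRing k i →+* Localization.Away (MvPolynomial.X (R := k) i) := algebraMap _ _
  let A : MvPolynomial (Fin (n + 1)) k →+* Localization.Away (MvPolynomial.X (R := k) i) :=
    algebraMap _ _
  change _ = v _
  rw [MvPolynomial.hom_eval₂, HomogeneousLocalization.Away.val_mk]
  have hX : IsUnit (A (MvPolynomial.X i)) :=
    IsLocalization.Away.algebraMap_isUnit (MvPolynomial.X (R := k) i)
  refine (hX.pow d).mul_left_cancel ?_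
  rw [← eval₂_mul_of_isHomogeneous _ _ _ hp']
  have h1 : A (MvPolynomial.X i) ^ d * Localization.mk p
      (⟨MvPolynomial.X i ^ d, d, rfl⟩ : Submonoid.powers (MvPolynomial.X (R := k) i)) = A p := by
    rw [← map_pow]
    simp only [A, ← Localization.mk_one_eq_algebraMap]
    rw [Localization.mk_mul, Localization.mk_eq_mk_iff, Localization.r_iff_exists]
    exact ⟨1, by simp⟩
  have h2 (l) : A (MvPolynomial.X i) * v (awayRatio k i l) = A (MvPolynomial.X l) := by
    change _ * (awayRatio k i l).val = _
    rw [awayRatio_val]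
    simp only [A, ← Localization.mk_one_eq_algebraMap]
    rw [Localization.mk_mul, Localization.mk_eq_mk_iff, Localization.r_iff_exists]
    exact ⟨1, by simp⟩
  refine h1.trans ?_
  conv_lhs => rw [← MvPolynomial.eval₂_eta p]
  rw [MvPolynomial.hom_eval₂]
  simp only [h2]
  rfl

theorem exists_coordRatio (i : Fin (n + 1)) (s : Γ(PSpace k n, chart k i)) :
    ∃ p : MvPolynomial (Fin (n + 1)) k,
      s = p.eval₂ (scalarsOn k (PSpace k n) (chart k i)) (coordRatio k i) := by
  obtain ⟨s, rfl⟩ := (chartSection_bijective i).2 s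
  obtain ⟨p, rfl⟩ := exists_awayRatio i s
  refine ⟨p, ?_⟩
  rw [MvPolynomial.hom_eval₂]
  congr 1
  ext c
  exact (scalarsOn_chart i c).symm

theorem chart_hom_ext {R : Type*} [CommRing R] (i : Fin (n + 1)) {f g : Γ(PSpace k n, chart k i) →+* R}
    (h : ∀ c, f (scalarsOn k _ _ c) = g (scalarsOn k _ _ c))
    (h' : ∀ l, f (coordRatio k i l) = g (coordRatio k i l)) : f = g := by
  ext s
  obtain ⟨p, rfl⟩ := exists_coordRatio i s
  rw [MvPolynomial.hom_eval₂, MvPolynomial.hom_eval₂]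
  congr 1
  · exact RingHom.ext h
  · exact funext h'

/-- The coordinate ring of the chart `D₊(xᵢ)` is its ring of regular functions. -/
def chartEquiv (k : Type u) [Field k] {n : ℕ} (i : Fin (n + 1)) :
    ChartRing k i ≃+* Γ(PSpace k n, chart k i) :=
  RingEquiv.ofBijective (chartSection i) (chartSection_bijective i)

theorem chartEquiv_apply (i : Fin (n + 1)) (s : ChartRing k i) :
    chartEquiv k i s = chartSection i s := rfl

/-- The ring homomorphism from the regular functions on `D₊(xᵢ)` given by a point with homogeneous
coordinates `G`, where `Gᵢ` is invertible. -/
def chartLift {R : Type*} [CommRing R] (φ : k →+* R) (G : Fin (n + 1) → R) (i : Fin (n + 1))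
    (hG : IsUnit (G i)) : Γ(PSpace k n, chart k i) →+* R :=
  (awayLift φ G i hG).comp (chartEquiv k i).symm.toRingHom

section

variable {R : Type*} [CommRing R] (φ : k →+* R) (G : Fin (n + 1) → R) (i : Fin (n + 1))
    (hG : IsUnit (G i))

theorem chartLift_chartSection (s : ChartRing k i) :
    chartLift φ G i hG (chartSection i s) = awayLift φ G i hG s := by
  rw [chartLift, RingHom.comp_apply, ← chartEquiv_apply, RingEquiv.toRingHom_eq_coe,
    RingHom.coe_coe, RingEquiv.symm_apply_apply]

theorem chartLift_coordRatio (l : Fin (n + 1)) :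
    chartLift φ G i hG (coordRatio k i l) * G i = G l := by
  rw [← chartSection_awayRatio, chartLift_chartSection, awayLift_awayRatio]

theorem chartLift_scalarsOn (c : k) :
    chartLift φ G i hG (scalarsOn k _ _ c) = φ c := by
  rw [scalarsOn_chart, chartLift_chartSection, awayLift_algebraMap]

end

/-! ### Charts of the projective line as polynomial rings -/

theorem rev_ne (i : Fin 2) : i.rev ≠ i := by
  revert i; decide

theorem eq_or_eq_rev (i l : Fin 2) : l = i ∨ l = i.rev := by
  revert i l; decide

/-- The coordinate `x_{1-i} / xᵢ` on the chart `D₊(xᵢ)` of `ℙ¹`. -/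
abbrev coord (k : Type u) [Field k] (i : Fin 2) : Γ(PSpace k 1, chart k i) := coordRatio k i i.rev

open Polynomial in
/-- The map from polynomials to the regular functions on a chart of `ℙ¹`. -/
def polyChart (k : Type u) [Field k] (i : Fin 2) : k[X] →+* Γ(PSpace k 1, chart k i) :=
  eval₂RingHom (scalarsOn k _ _) (coord k i)

theorem polyChart_X (i : Fin 2) : polyChart k i Polynomial.X = coord k i := by
  simp [polyChart]

theorem polyChart_C (i : Fin 2) (c : k) : polyChart k i (Polynomial.C c) = scalarsOn k _ _ c := by
  simp [polyChart]

/-- The point with homogeneous coordinates `1` and `X` over `k[X]` gives a left inverse.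
Surjectivity holds because the chart ring is generated by its ratios, and the only one other than
`1` is the coordinate. -/
theorem polyChart_bijective (i : Fin 2) : Function.Bijective (polyChart k i) := by
  constructor
  · let G : Fin (1 + 1) → Polynomial k := fun l => if l = i then 1 else Polynomial.X
    have hG : IsUnit (G i) := by simp [G]
    have h : (chartLift Polynomial.C G i hG).comp (polyChart k i) = RingHom.id _ := by
      refine Polynomial.ringHom_ext (fun c => ?_) ?_
      · simp [polyChart_C, chartLift_scalarsOn]
      · have := chartLift_coordRatio Polynomial.C G i hG i.rev
        simpa [G, polyChart_X, rev_ne] using this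
    exact Function.LeftInverse.injective (g := chartLift Polynomial.C G i hG)
      fun p => RingHom.congr_fun h p
  · intro s
    obtain ⟨p, rfl⟩ := exists_coordRatio i s
    refine ⟨p.eval₂ Polynomial.C (fun l => if l = i then 1 else Polynomial.X), ?_⟩
    rw [MvPolynomial.hom_eval₂]
    congr 1
    · ext c
      exact polyChart_C i c
    · funext l
      obtain rfl | rfl := eq_or_eq_rev i l
      · simp [coordRatio_self]
      ·         simp [rev_ne, polyChart_X]

/-! ### Gluing functions; units -/

section sheaf

variable {X : Scheme.{u}}

theorem resFun_eq_of_cover {ι : Type*} (U : ι → X.Opens) (V : X.Opens) (hU : ∀ a, U a ≤ V)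
    (hV : V ≤ iSup U) (s t : Γ(X, V)) (h : ∀ a, resFun (hU a) s = resFun (hU a) t) : s = t :=
  TopCat.Sheaf.eq_of_locally_eq' X.sheaf U V (fun a => homOfLE (hU a)) hV s t h

theorem resFun_glue {ι : Type*} (U : ι → X.Opens) (V : X.Opens) (hU : ∀ a, U a ≤ V)
    (hV : V ≤ iSup U) (s : ∀ a, Γ(X, U a))
    (h : ∀ a b, resFun (inf_le_left : U a ⊓ U b ≤ U a) (s a)
      = resFun (inf_le_right : U a ⊓ U b ≤ U b) (s b)) :
    ∃ t : Γ(X, V), ∀ a, resFun (hU a) t = s a :=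
  (TopCat.Sheaf.existsUnique_gluing' X.sheaf U V (fun a => homOfLE (hU a)) hV s h).exists

theorem isUnit_resFun_basicOpen {U : X.Opens} (s : Γ(X, U)) {V : X.Opens} (h : V ≤ U)
    (hV : V ≤ X.basicOpen s) : IsUnit (resFun h s) := by
  have h1 := RingedSpace.isUnit_res_basicOpen X.toRingedSpace s
  have h2 := h1.map (resFun hV)
  exact (resFun_resFun (X.basicOpen_le s) hV s) ▸ h2

theorem basicOpen_of_isUnit {U : X.Opens} {s : Γ(X, U)} {V : X.Opens} {h : V ≤ U}
    (hs : IsUnit (resFun h s)) : V ≤ X.basicOpen s := by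
  have := X.basicOpen_of_isUnit hs
  unfold resFun at this
  rw [X.basicOpen_res] at this
  exact inf_eq_left.1 this

theorem isUnit_of_cover {ι : Type*} (U : ι → X.Opens) (V : X.Opens) (hU : ∀ a, U a ≤ V)
    (hV : V ≤ iSup U) (s : Γ(X, V)) (h : ∀ a, IsUnit (resFun (hU a) s)) : IsUnit s := by
  rw [← resFun_self le_rfl s]
  exact isUnit_resFun_basicOpen s _ (hV.trans (iSup_le fun a => basicOpen_of_isUnit (h a)))

end sheaf

/-! ### Homogeneous coordinates of a morphism to projective space -/

section coords

variable {k : Type u} [Field k] {n : ℕ} {X : Scheme.{u}} (f : X ⟶ PSpace k n)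

theorem ratio_self (i : Fin (n + 1)) : ratio f i i = 1 := by
  rw [ratio, coordRatio_self, map_one]
  rfl

theorem ratio_eq_pullFun {i l : Fin (n + 1)} {V : X.Opens} (h : V ≤ pchart f i) :
    resFun h (ratio f i l) = pullFun f h (coordRatio k i l) := by
  unfold ratio
  rw [Scheme.Hom.app_eq_appLE]
  exact congrArg (fun φ => φ.hom (coordRatio k i l))
    (Scheme.Hom.appLE_map f (le_refl (f ⁻¹ᵁ chart k i)) (homOfLE h).op)

theorem ratio_mul {i l m : Fin (n + 1)} {V : X.Opens} (hi : V ≤ pchart f i) (hl : V ≤ pchart f l) :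
    resFun hi (ratio f i l) * resFun hl (ratio f l m) = resFun hi (ratio f i m) := by
  have e : V ≤ f ⁻¹ᵁ (chart k i ⊓ chart k l) := le_inf hi hl
  have := congrArg (pullFun f e) (coordRatio_mul (k := k) i l m)
  rw [map_mul, pullFun_resFun f _ e hi le_rfl, pullFun_resFun f _ e hl le_rfl,
    pullFun_resFun f _ e hi le_rfl, resFun_self, resFun_self, resFun_self] at this
  rw [ratio_eq_pullFun, ratio_eq_pullFun, ratio_eq_pullFun, this]

theorem isUnit_ratio {i l : Fin (n + 1)} {V : X.Opens} (hi : V ≤ pchart f i)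
    (hl : V ≤ pchart f l) : IsUnit (resFun hi (ratio f i l)) :=
  IsUnit.of_mul_eq_one (resFun hl (ratio f l i)) (by rw [ratio_mul f hi hl, ratio_self, map_one])

theorem basicOpen_ratio (i l : Fin (n + 1)) : X.basicOpen (ratio f i l) ≤ pchart f l := by
  unfold ratio
  erw [← Scheme.preimage_basicOpen]
  exact fun x hx => basicOpen_coordRatio i l hx

theorem iSup_pchart : (⨆ i, pchart f i) = ⊤ := by
  rw [eq_top_iff]
  intro x _
  have : f x ∈ ⨆ i, chart k (n := n) i := by rw [iSup_chart]; trivial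
  obtain ⟨i, hi⟩ := Opens.mem_iSup.1 this
  exact Opens.mem_iSup.2 ⟨i, hi⟩

theorem le_iSup_inf_pchart (U : X.Opens) : U ≤ ⨆ i, U ⊓ pchart f i := by
  rw [← inf_iSup_eq, iSup_pchart, inf_top_eq]

/-- The morphism `f` has the homogeneous coordinates `F` over the open set `U`. -/
def HasCoords (U : X.Opens) (F : Fin (n + 1) → Γ(X, U)) : Prop :=
  ∀ (l : Fin (n + 1)) (V : X.Opens) (hU : V ≤ U) (hl : V ≤ pchart f l),
    IsUnit (resFun hU (F l)) ∧
      ∀ m, resFun hl (ratio f l m) * resFun hU (F l) = resFun hU (F m)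

variable {f}

/-- The definition quantifies over all indices and all small open sets. By the cocycle relation for
the ratios it is enough to know it on a cover, for one index on each member. -/
theorem hasCoords_of_cover {ι : Type*} {U : X.Opens} {F : Fin (n + 1) → Γ(X, U)}
    (W : ι → X.Opens) (hW : ∀ a, W a ≤ U) (hU : U ≤ iSup W) (l : ι → Fin (n + 1))
    (hl : ∀ a, W a ≤ pchart f (l a)) (h : ∀ a, IsUnit (resFun (hW a) (F (l a))))
    (h' : ∀ a m, resFun (hl a) (ratio f (l a) m) * resFun (hW a) (F (l a)) =
      resFun (hW a) (F m)) : HasCoords f U F := by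
  intro r V hV hr
  have hc : V ≤ ⨆ a, V ⊓ W a := by
    rw [← inf_iSup_eq]
    exact le_inf le_rfl (hV.trans hU)
  have h1 (a m) : resFun (inf_le_right.trans (hl a) : V ⊓ W a ≤ _) (ratio f (l a) m) *
      resFun (inf_le_left.trans hV) (F (l a)) = resFun (inf_le_left.trans hV) (F m) := by
    have := congrArg (resFun (inf_le_right : V ⊓ W a ≤ W a)) (h' a m)
    simpa only [map_mul, resFun_resFun] using this
  have h2 (a) : IsUnit (resFun (inf_le_left.trans hV : V ⊓ W a ≤ U) (F (l a))) := by
    have := (h a).map (resFun (inf_le_right : V ⊓ W a ≤ W a))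
    rwa [resFun_resFun] at this
  constructor
  · refine isUnit_of_cover (fun a => V ⊓ W a) V (fun a => inf_le_left) hc _ fun a => ?_
    rw [resFun_resFun, ← h1]
    exact (isUnit_ratio f _ (inf_le_left.trans hr)).mul (h2 a)
  · intro m
    refine resFun_eq_of_cover (fun a => V ⊓ W a) V (fun a => inf_le_left) hc _ _ fun a => ?_
    rw [map_mul, resFun_resFun, resFun_resFun, resFun_resFun, ← h1 a r, ← h1 a m, ← mul_assoc,
      mul_comm (resFun _ (ratio f r m)), ratio_mul f]

theorem HasCoords.smul {U : X.Opens} {F : Fin (n + 1) → Γ(X, U)} (h : HasCoords f U F)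
    {g : Γ(X, U)} (hg : IsUnit g) : HasCoords f U (fun l => g * F l) := by
  intro l W hW hl
  obtain ⟨h1, h2⟩ := h l W hW hl
  simp only [map_mul]
  refine ⟨(hg.map _).mul h1, fun m => ?_⟩
  rw [← h2 m]
  ring

theorem HasCoords.of_cover {ι : Type*} {U : X.Opens} {F : Fin (n + 1) → Γ(X, U)}
    (W : ι → X.Opens) (hW : ∀ a, W a ≤ U) (hU : U ≤ iSup W)
    (h : ∀ a, HasCoords f (W a) (fun l => resFun (hW a) (F l))) : HasCoords f U F := by
  refine hasCoords_of_cover (ι := ι × Fin (n + 1)) (fun a => W a.1 ⊓ pchart f a.2)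
    (fun a => inf_le_left.trans (hW a.1)) ?_ Prod.snd (fun a => inf_le_right) ?_ ?_
  · rw [iSup_prod]
    exact hU.trans (iSup_mono fun a => le_iSup_inf_pchart f _)
  · intro a
    have := (h a.1 a.2 _ inf_le_left inf_le_right).1
    rwa [resFun_resFun] at this
  · intro a m
    have := (h a.1 a.2 _ inf_le_left inf_le_right).2 m
    rwa [resFun_resFun, resFun_resFun] at this

theorem pullFun_ratio_comp {Z : Scheme.{u}} (g : Z ⟶ X) {i l : Fin (n + 1)} {V : X.Opens}
    (h : V ≤ pchart f i) {W : Z.Opens} (e : W ≤ g ⁻¹ᵁ V) (e' : W ≤ pchart (g ≫ f) i) :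
    pullFun g e (resFun h (ratio f i l)) = resFun e' (ratio (g ≫ f) i l) := by
  rw [ratio_eq_pullFun, ratio_eq_pullFun]
  exact pullFun_comp g f h e e' _

theorem HasCoords.comp {Z : Scheme.{u}} (g : Z ⟶ X) {U : X.Opens} {F : Fin (n + 1) → Γ(X, U)}
    (h : HasCoords f U F) {W : Z.Opens} (e : W ≤ g ⁻¹ᵁ U) :
    HasCoords (g ≫ f) W (fun l => pullFun g e (F l)) := by
  refine hasCoords_of_cover (fun l => W ⊓ pchart (g ≫ f) l) (fun l => inf_le_left)
    (le_iSup_inf_pchart _ _) id (fun a => inf_le_right) (fun l => ?_) (fun l m => ?_)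
  all_goals
    have e2 : W ⊓ pchart (g ≫ f) l ≤ g ⁻¹ᵁ (U ⊓ pchart f l) :=
      le_inf (inf_le_left.trans e) inf_le_right
    have h1 := h l (U ⊓ pchart f l) inf_le_left inf_le_right
    have h2 (m) := pullFun_resFun g (inf_le_left : U ⊓ pchart f l ≤ U) e2 e inf_le_left (F m)
  · have := h1.1.map (pullFun g e2)
    rwa [h2] at this
  · have := congrArg (pullFun g e2) (h1.2 m)
    rwa [map_mul, h2, h2, pullFun_ratio_comp (f := f) g inf_le_right e2 inf_le_right] at this

end coords

/-! ### Morphisms determined and constructed by homogeneous coordinates -/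

section morphisms

variable {k : Type u} [Field k] {n : ℕ} {X : Scheme.{u}}

theorem pullFun_id_res {X Y : Scheme.{u}} (f : X ⟶ Y) {U : Y.Opens} {V W : X.Opens}
    (e : V ≤ f ⁻¹ᵁ U) (h : W ≤ V) (r : Γ(Y, U)) :
    resFun h (pullFun f e r) = pullFun f (h.trans e) r := by
  rw [← pullFun_resFun f le_rfl (h.trans e) e h, resFun_self]

theorem appTop_eq_pullFun {X Y : Scheme.{u}} (f : X ⟶ Y) (r : Γ(Y, ⊤)) :
    f.appTop r = pullFun f (show ⊤ ≤ f ⁻¹ᵁ ⊤ from fun _ _ => trivial) r := by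
  unfold pullFun
  rw [Scheme.Hom.appTop, Scheme.Hom.app_eq_appLE]
  rfl

theorem exists_lift_chartMap {f : X ⟶ PSpace k n} {l : Fin (n + 1)} (hf : ⊤ ≤ pchart f l) :
    ∃ f' : X ⟶ Spec (.of (ChartRing k l)), f' ≫ chartMap k l = f := by
  have h : Set.range f ⊆ Set.range (chartMap k l) := by
    rintro _ ⟨x, rfl⟩
    exact (opensRange_chartMap l).ge (hf (show x ∈ ⊤ from trivial))
  exact ⟨IsOpenImmersion.lift (chartMap k l) f h, IsOpenImmersion.lift_fac _ _ _⟩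

theorem hom_eq_of_chart {f g : X ⟶ PSpace k n} {l : Fin (n + 1)} (hf : ⊤ ≤ pchart f l)
    (hg : ⊤ ≤ pchart g l)
    (h : ∀ s : Γ(PSpace k n, chart k l), pullFun f hf s = pullFun g hg s) : f = g := by
  obtain ⟨f', rfl⟩ := exists_lift_chartMap hf
  obtain ⟨g', rfl⟩ := exists_lift_chartMap hg
  congr 1
  refine ext_of_isAffine ?_
  ext s
  obtain ⟨s, rfl⟩ : ∃ t, (Scheme.ΓSpecIso (.of (ChartRing k l))).inv t = s :=
    (ConcreteCategory.bijective_of_isIso (Scheme.ΓSpecIso (.of (ChartRing k l))).inv).2 s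
  have h1 := pullFun_comp f' (chartMap k l) (top_le_chartMap_preimage l)
    (show ⊤ ≤ f' ⁻¹ᵁ ⊤ from fun _ _ => trivial) hf (chartSection l s)
  have h2 := pullFun_comp g' (chartMap k l) (top_le_chartMap_preimage l)
    (show ⊤ ≤ g' ⁻¹ᵁ ⊤ from fun _ _ => trivial) hg (chartSection l s)
  have := h1.trans ((h (chartSection l s)).trans h2.symm)
  rw [pullFun_chartMap] at this
  erw [appTop_eq_pullFun, appTop_eq_pullFun]
  exact this

/-- Over `D₊(xₘ)` one has `Fₗ = (xₗ / xₘ) Fₘ`, so an invertible `Fₗ` forces `xₗ / xₘ` to be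
invertible. -/
theorem HasCoords.le_pchart {f : X ⟶ PSpace k n} {U V : X.Opens} {F : Fin (n + 1) → Γ(X, U)}
    (h : HasCoords f U F) (hV : V ≤ U) {l : Fin (n + 1)} (hl : IsUnit (resFun hV (F l))) :
    V ≤ pchart f l := by
  refine (le_iSup_inf_pchart f V).trans (iSup_le fun m => ?_)
  have h1 := (h m (V ⊓ pchart f m) (inf_le_left.trans hV) inf_le_right).2 l
  have h2 := hl.map (resFun (inf_le_left : V ⊓ pchart f m ≤ V))
  rw [resFun_resFun, ← h1] at h2
  exact (basicOpen_of_isUnit (isUnit_of_mul_isUnit_left h2)).trans (basicOpen_ratio f m l)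

theorem pullFun_scalarsOn_eq {f g : X ⟶ PSpace k n}
    (hk : f ≫ (PSpace k n ↘ Spec (.of k)) = g ≫ (PSpace k n ↘ Spec (.of k)))
    {U : (PSpace k n).Opens} {V : X.Opens} (hf : V ≤ f ⁻¹ᵁ U) (hg : V ≤ g ⁻¹ᵁ U) (c : k) :
    pullFun f hf (scalarsOn k _ U c) = pullFun g hg (scalarsOn k _ U c) := by
  let i1 : X.Over (Spec (.of k)) := ⟨f ≫ (PSpace k n ↘ Spec (.of k))⟩
  rw [pullFun_scalarsOn f ((Scheme.Hom.isOver_iff _).2 rfl),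
    pullFun_scalarsOn g ((Scheme.Hom.isOver_iff _).2 hk.symm)]

/-- Where `f` lands in `D₊(xₗ)`, the function `Fₗ` is a unit, so `g` lands there too. Both then pull
`xₘ / xₗ` back to `Fₘ / Fₗ`, and these ratios with the scalars generate the chart. -/
theorem HasCoords.hom_eq {f g : X ⟶ PSpace k n} {ι : Type*} (U : ι → X.Opens) (hU : ⊤ ≤ iSup U)
    (F : ∀ a, Fin (n + 1) → Γ(X, U a)) (hf : ∀ a, HasCoords f (U a) (F a))
    (hg : ∀ a, HasCoords g (U a) (F a))
    (hk : f ≫ (PSpace k n ↘ Spec (.of k)) = g ≫ (PSpace k n ↘ Spec (.of k))) : f = g := by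
  have hcov : (⨆ a : ι × Fin (n + 1), U a.1 ⊓ pchart f a.2) = ⊤ := by
    rw [eq_top_iff, iSup_prod]
    exact hU.trans (iSup_mono fun a => le_iSup_inf_pchart f _)
  let 𝒰 := X.openCoverOfIsOpenCover (fun a : ι × Fin (n + 1) => U a.1 ⊓ pchart f a.2) hcov
  refine 𝒰.hom_ext _ _ fun a => ?_
  obtain ⟨a, l⟩ := a
  change (U a ⊓ pchart f l).ι ≫ f = (U a ⊓ pchart f l).ι ≫ g
  set V := U a ⊓ pchart f l with hV
  have hVU : V ≤ U a := inf_le_left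
  have h1 : V ≤ pchart f l := inf_le_right
  have h2 : V ≤ pchart g l := (hg a).le_pchart hVU ((hf a) l V hVU h1).1
  have hι : ⊤ ≤ V.ι ⁻¹ᵁ V := fun x _ => x.2
  have e1 : ⊤ ≤ pchart (V.ι ≫ f) l := fun x _ => h1 x.2
  have e2 : ⊤ ≤ pchart (V.ι ≫ g) l := fun x _ => h2 x.2
  refine hom_eq_of_chart e1 e2 fun s => ?_
  have key : pullFun f h1 = pullFun (U := chart k l) g h2 := by
    refine chart_hom_ext l (fun c => pullFun_scalarsOn_eq hk _ _ c) fun m => ?_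
    rw [← ratio_eq_pullFun, ← ratio_eq_pullFun]
    refine ((hf a) l V hVU h1).1.mul_right_cancel ?_
    rw [((hf a) l V hVU h1).2, ((hg a) l V hVU h2).2]
  refine (pullFun_comp V.ι f h1 hι e1 s).symm.trans (Eq.trans ?_ (pullFun_comp V.ι g h2 hι e2 s))
  rw [key]

theorem pullFun_SpecMap {R S : Type u} [CommRing R] [CommRing S] (φ : R →+* S) (r : R) :
    pullFun (Spec.map (CommRingCat.ofHom φ)) (U := ⊤) (V := ⊤) (fun _ _ => trivial)
      ((Scheme.ΓSpecIso (.of R)).inv.hom r) = (Scheme.ΓSpecIso (.of S)).inv.hom (φ r) := by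
  have := congrArg (fun ψ => ψ.hom r) (Scheme.ΓSpecIso_inv_naturality (CommRingCat.ofHom φ))
  refine Eq.trans ?_ this.symm
  unfold pullFun
  rw [Scheme.Hom.appTop, Scheme.Hom.app_eq_appLE]
  rfl

theorem pullFun_toSpecΓ {R : Type u} [CommRing R] (φ : R →+* Γ(X, ⊤)) (r : R) :
    pullFun (X.toSpecΓ ≫ Spec.map (CommRingCat.ofHom φ)) (U := ⊤) (V := ⊤) (fun _ _ => trivial)
      ((Scheme.ΓSpecIso (.of R)).inv.hom r) = φ r := by
  have h1 := pullFun_comp X.toSpecΓ (Spec.map (CommRingCat.ofHom φ)) (W := ⊤) (V := ⊤) (U := ⊤)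
    (fun _ _ => trivial) (fun _ _ => trivial) (fun _ _ => trivial)
    ((Scheme.ΓSpecIso (.of R)).inv.hom r)
  refine h1.symm.trans ?_
  refine (congrArg _ (pullFun_SpecMap φ r)).trans ?_
  have h2 := appTop_eq_pullFun X.toSpecΓ ((Scheme.ΓSpecIso (.of Γ(X, ⊤))).inv.hom (φ r))
  refine h2.symm.trans ?_
  rw [Scheme.toSpecΓ_appTop]
  exact congrArg (fun ψ => ψ.hom (φ r)) (Scheme.ΓSpecIso (.of Γ(X, ⊤))).inv_hom_id

theorem toSpecΓ_scalars [X.Over (Spec (.of k))] :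
    X.toSpecΓ ≫ Spec.map (CommRingCat.ofHom (scalars k X)) = (X ↘ Spec (.of k)) := by
  refine ext_of_isAffine ?_
  ext s
  obtain ⟨s, rfl⟩ : ∃ t, (Scheme.ΓSpecIso (.of k)).inv t = s :=
    (ConcreteCategory.bijective_of_isIso (Scheme.ΓSpecIso (.of k)).inv).2 s
  exact (appTop_eq_pullFun _ _).trans (pullFun_toSpecΓ (scalars k X) s)

theorem exists_hom_Spec [X.Over (Spec (.of k))] {R : Type u} [CommRing R] (ψ : k →+* R)
    (φ : R →+* Γ(X, ⊤)) (h : φ.comp ψ = scalars k X) : ∃ f' : X ⟶ Spec (.of R),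
      (∀ s, pullFun f' (show ⊤ ≤ f' ⁻¹ᵁ ⊤ from fun _ _ => trivial)
        ((Scheme.ΓSpecIso (.of R)).inv s) = φ s) ∧
      f' ≫ Spec.map (CommRingCat.ofHom ψ) = (X ↘ Spec (.of k)) := by
  refine ⟨X.toSpecΓ ≫ Spec.map (CommRingCat.ofHom φ), pullFun_toSpecΓ φ, ?_⟩
  rw [Category.assoc, ← Spec.map_comp, ← CommRingCat.ofHom_comp, h, toSpecΓ_scalars]

theorem exists_hom_ChartRing [X.Over (Spec (.of k))] (F : Fin (n + 1) → Γ(X, ⊤))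
    (l : Fin (n + 1)) (hl : IsUnit (F l)) : ∃ f' : X ⟶ Spec (.of (ChartRing k l)),
      (∀ m, pullFun f' (show ⊤ ≤ f' ⁻¹ᵁ ⊤ from fun _ _ => trivial)
        ((Scheme.ΓSpecIso (.of (ChartRing k l))).inv (awayRatio k l m)) * F l = F m) ∧
      f' ≫ Spec.map (CommRingCat.ofHom
        ((algebraMap (grading k n 0) (ChartRing k l)).comp (algebraMap k (grading k n 0)))) =
        (X ↘ Spec (.of k)) := by
  have hψ : (awayLift (scalars k X) F l hl).comp
      ((algebraMap (grading k n 0) (ChartRing k l)).comp (algebraMap k (grading k n 0))) =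
        scalars k X := by
    refine RingHom.ext fun c => ?_
    rw [RingHom.comp_apply, RingHom.comp_apply]
    exact awayLift_algebraMap (scalars k X) F l hl c
  have hφ (m) := awayLift_awayRatio (scalars k X) F l hl m
  generalize awayLift (scalars k X) F l hl = φ at hψ hφ
  generalize (algebraMap (grading k n 0) (ChartRing k l)).comp
    (algebraMap k (grading k n 0)) = ψ at hψ ⊢
  obtain ⟨f', h, h'⟩ := exists_hom_Spec ψ φ hψ
  exact ⟨f', fun m => (congrArg (· * F l) (h _)).trans (hφ m), h'⟩

theorem top_le_preimage_comp {Y Z : Scheme.{u}} (f : X ⟶ Y) (g : Y ⟶ Z) {U : Z.Opens}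
    (h : ⊤ ≤ g ⁻¹ᵁ U) : ⊤ ≤ (f ≫ g) ⁻¹ᵁ U :=
  fun x _ => h (show f x ∈ ⊤ from trivial)

theorem hasCoords_comp_of_top_le {Y : Scheme.{u}} (f' : X ⟶ Y) (g : Y ⟶ PSpace k n)
    {l : Fin (n + 1)} (hg : ⊤ ≤ g ⁻¹ᵁ chart k l) {F : Fin (n + 1) → Γ(X, ⊤)} (hl : IsUnit (F l))
    (hF : ∀ m, pullFun f' (show ⊤ ≤ f' ⁻¹ᵁ ⊤ from fun _ _ => trivial)
      (pullFun g hg (coordRatio k l m)) * F l = F m) : HasCoords (f' ≫ g) ⊤ F := by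
  have hf : ⊤ ≤ pchart (f' ≫ g) l := top_le_preimage_comp f' g hg
  refine hasCoords_of_cover (ι := Unit) (fun _ => ⊤) (fun _ => le_rfl) (by simp) (fun _ => l)
    (fun _ => hf) (fun _ => by rwa [resFun_self]) fun _ m => ?_
  have h1 := pullFun_comp f' g hg (show ⊤ ≤ f' ⁻¹ᵁ ⊤ from fun _ _ => trivial) hf (coordRatio k l m)
  rw [ratio_eq_pullFun, resFun_self, resFun_self, ← h1, hF m]

theorem hasCoords_comp_chartMap {l : Fin (n + 1)} (f' : X ⟶ Spec (.of (ChartRing k l)))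
    {F : Fin (n + 1) → Γ(X, ⊤)} (hl : IsUnit (F l))
    (hf' : ∀ m, pullFun f' (show ⊤ ≤ f' ⁻¹ᵁ ⊤ from fun _ _ => trivial)
      ((Scheme.ΓSpecIso (.of (ChartRing k l))).inv (awayRatio k l m)) * F l = F m) :
    HasCoords (f' ≫ chartMap k l) ⊤ F := by
  refine hasCoords_comp_of_top_le f' _ (top_le_chartMap_preimage l) hl fun m => ?_
  rw [← chartSection_awayRatio, pullFun_chartMap, hf' m]

theorem exists_hom_of_isUnit [X.Over (Spec (.of k))] (F : Fin (n + 1) → Γ(X, ⊤)) (l : Fin (n + 1))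
    (hl : IsUnit (F l)) : ∃ f : X ⟶ PSpace k n,
      f ≫ (PSpace k n ↘ Spec (.of k)) = (X ↘ Spec (.of k)) ∧ HasCoords f ⊤ F := by
  have h := exists_hom_ChartRing (k := k) F l hl
  refine h.elim fun f' h' => ⟨f' ≫ chartMap k l, ?_, hasCoords_comp_chartMap f' hl h'.1⟩
  rw [Category.assoc, chartMap_over]
  exact h'.2

/-- Homogeneous coordinates matter only up to a unit. The form with `p` and `q` is the compatibility
on fibre products needed to glue morphisms along an open cover. -/
theorem HasCoords.hom_eq_of_proportional {P Z₁ Z₂ : Scheme.{u}} (p : P ⟶ Z₁) (q : P ⟶ Z₂)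
    (i₁ : Z₁ ⟶ X) (i₂ : Z₂ ⟶ X) (hpq : p ≫ i₁ = q ≫ i₂) {W₁ W₂ : X.Opens} (h₁ : ⊤ ≤ i₁ ⁻¹ᵁ W₁)
    (h₂ : ⊤ ≤ i₂ ⁻¹ᵁ W₂) {f₁ : Z₁ ⟶ PSpace k n} {f₂ : Z₂ ⟶ PSpace k n} {F₁ : Fin (n + 1) → Γ(X, W₁)}
    {F₂ : Fin (n + 1) → Γ(X, W₂)} (hf₁ : HasCoords f₁ ⊤ (fun m => pullFun i₁ h₁ (F₁ m)))
    (hf₂ : HasCoords f₂ ⊤ (fun m => pullFun i₂ h₂ (F₂ m))) {g : Γ(X, W₁ ⊓ W₂)} (hg : IsUnit g)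
    (hF : ∀ m, resFun inf_le_left (F₁ m) = g * resFun inf_le_right (F₂ m))
    (s : X ⟶ Spec (.of k)) (hs₁ : f₁ ≫ (PSpace k n ↘ Spec (.of k)) = i₁ ≫ s)
    (hs₂ : f₂ ≫ (PSpace k n ↘ Spec (.of k)) = i₂ ≫ s) : p ≫ f₁ = q ≫ f₂ := by
  have ea : ⊤ ≤ (p ≫ i₁) ⁻¹ᵁ W₁ := fun x _ => h₁ (show p x ∈ ⊤ from trivial)
  have eb' : ⊤ ≤ (q ≫ i₂) ⁻¹ᵁ W₂ := fun x _ => h₂ (show q x ∈ ⊤ from trivial)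
  have eb : ⊤ ≤ (p ≫ i₁) ⁻¹ᵁ W₂ := hpq ▸ eb'
  have e : ⊤ ≤ (p ≫ i₁) ⁻¹ᵁ (W₁ ⊓ W₂) := le_inf ea eb
  have e3 (r) : pullFun q (show ⊤ ≤ q ⁻¹ᵁ ⊤ from fun _ _ => trivial)
      (pullFun i₂ h₂ r) = pullFun (p ≫ i₁) eb r :=
    (pullFun_comp q i₂ h₂ _ eb' r).trans (pullFun_congr hpq.symm _ _ r)
  have e4 (r) : pullFun p (show ⊤ ≤ p ⁻¹ᵁ ⊤ from fun _ _ => trivial)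
      (pullFun i₁ h₁ r) = pullFun (p ≫ i₁) ea r :=
    pullFun_comp p i₁ h₁ _ ea r
  refine HasCoords.hom_eq (ι := Unit) (fun _ => ⊤) (by simp)
    (fun _ m => pullFun (p ≫ i₁) ea (F₁ m)) (fun _ => ?_) (fun _ => ?_) ?_
  · have := hf₁.comp p (W := ⊤) (fun _ _ => trivial)
    simpa only [e4] using this
  · have := (hf₂.comp q (W := ⊤) (fun _ _ => trivial)).smul (hg.map (pullFun _ e))
    convert! this using 2 with m
    rw [e3]
    have h5 := congrArg (pullFun (p ≫ i₁) e) (hF m)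
    rw [map_mul, pullFun_resFun _ _ e ea le_rfl, pullFun_resFun _ _ e eb le_rfl, resFun_self,
      resFun_self] at h5
    exact h5
  · rw [Category.assoc, Category.assoc, hs₁, hs₂, ← Category.assoc, hpq, Category.assoc]

theorem pullFun_ι_bijective {U V : X.Opens} (hV : V ≤ U) :
    Function.Bijective (pullFun U.ι (le_refl (U.ι ⁻¹ᵁ V))) :=
  pullFun_bijective U.ι le_rfl le_rfl (by simpa using hV)

theorem HasCoords.of_comp_ι {f : X ⟶ PSpace k n} {U : X.Opens} {F : Fin (n + 1) → Γ(X, U)}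
    (hι : ⊤ ≤ U.ι ⁻¹ᵁ U) (h : HasCoords (U.ι ≫ f) ⊤ (fun m => pullFun U.ι hι (F m))) :
    HasCoords f U F := by
  intro l V hV hl
  have hb := pullFun_ι_bijective hV
  have h1 := h l (U.ι ⁻¹ᵁ V) le_top (fun x hx => hl hx)
  have h2 (m) : resFun (le_top : U.ι ⁻¹ᵁ V ≤ ⊤) (pullFun U.ι hι (F m)) =
      pullFun U.ι (le_refl (U.ι ⁻¹ᵁ V)) (resFun hV (F m)) :=
    (pullFun_resFun U.ι hV le_rfl hι le_top (F m)).symm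
  simp only [h2] at h1
  constructor
  · exact (isUnit_map_iff (RingEquiv.ofBijective _ hb) _).1 h1.1
  · intro m
    apply hb.1
    rw [map_mul, ← h1.2 m, pullFun_ratio_comp]
    exact fun x hx => hl hx

/-- On each member of the cover the invertible entry gives a morphism to one affine chart.
Proportionality makes these morphisms agree on overlaps. -/
theorem exists_hom_of_cover [X.Over (Spec (.of k))] {ι : Type u} (W : ι → X.Opens)
    (hW : ⊤ ≤ iSup W) (F : ∀ a, Fin (n + 1) → Γ(X, W a)) (l : ι → Fin (n + 1))
    (hl : ∀ a, IsUnit (F a (l a)))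
    (hF : ∀ a b, ∃ g : Γ(X, W a ⊓ W b), IsUnit g ∧
      ∀ m, resFun inf_le_left (F a m) = g * resFun inf_le_right (F b m)) :
    ∃ f : X ⟶ PSpace k n, f ≫ (PSpace k n ↘ Spec (.of k)) = (X ↘ Spec (.of k)) ∧
      ∀ a, HasCoords f (W a) (F a) := by
  have hι (a) : ⊤ ≤ (W a).ι ⁻¹ᵁ W a := fun x _ => x.2
  have hex (a) : ∃ f : (W a).toScheme ⟶ PSpace k n,
      f ≫ (PSpace k n ↘ Spec (.of k)) = (W a).ι ≫ (X ↘ Spec (.of k)) ∧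
        HasCoords f ⊤ (fun m => pullFun (W a).ι (hι a) (F a m)) := by
    let i1 : (W a).toScheme.Over (Spec (.of k)) := ⟨(W a).ι ≫ (X ↘ Spec (.of k))⟩
    exact exists_hom_of_isUnit _ (l a) ((hl a).map _)
  choose f hf hfc using hex
  let 𝒰 := X.openCoverOfIsOpenCover W (eq_top_iff.2 hW)
  have hglue : ∀ a b : ι, Limits.pullback.fst (W a).ι (W b).ι ≫ f a =
      Limits.pullback.snd (W a).ι (W b).ι ≫ f b := by
    intro a b
    obtain ⟨g, hg, hgF⟩ := hF a b
    exact HasCoords.hom_eq_of_proportional _ _ (W a).ι (W b).ι Limits.pullback.condition (hι a) (hι b)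
      (hfc a) (hfc b) hg hgF _ (hf a) (hf b)
  have hfac (a : ι) : (W a).ι ≫ 𝒰.glueMorphisms f hglue = f a := 𝒰.ι_glueMorphisms f hglue a
  refine ⟨𝒰.glueMorphisms f hglue, ?_, ?_⟩
  · refine 𝒰.hom_ext _ _ fun a => ?_
    rw [← Category.assoc, 𝒰.ι_glueMorphisms f hglue]
    exact hf a
  · intro a
    refine HasCoords.of_comp_ι (hι a) ?_
    rw [hfac]
    exact hfc a

end morphisms

/-! ### Trivializations of twists and of the split bundle -/

section triv

variable {k : Type u} [Field k] {n : ℕ} {X : Scheme.{u}} (f : X ⟶ PSpace k n) (E : X.Modules)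
  (d : ℤ)

theorem comp_rel {U : X.Opens} (s : Γ(twist f E d, U)) (i l : Fin (n + 1)) :
    resFun (overlap_le_chart f U i l) (ratio f i l) ^ (-d).toNat •
        res E (overlap_le_left f U i l) (comp f E d s i) =
      resFun (overlap_le_chart f U i l) (ratio f i l) ^ d.toNat •
        res E (overlap_le_right f U i l) (comp f E d s l) :=
  (show twistSections f E d U from s).2 i l

theorem comp_ext {U : X.Opens} {s t : Γ(twist f E d, U)}
    (h : ∀ i, comp f E d s i = comp f E d t i) : s = t :=
  Subtype.ext (funext h)

theorem exists_comp {U : X.Opens} (s : ∀ i, Γ(E, U ⊓ pchart f i))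
    (h : ∀ i l, resFun (overlap_le_chart f U i l) (ratio f i l) ^ (-d).toNat •
        res E (overlap_le_left f U i l) (s i) =
      resFun (overlap_le_chart f U i l) (ratio f i l) ^ d.toNat •
        res E (overlap_le_right f U i l) (s l)) :
    ∃ t : Γ(twist f E d, U), ∀ i, comp f E d t i = s i :=
  ⟨show twistSections f E d U from ⟨s, h⟩, fun _ => rfl⟩

theorem comp_res {U V : X.Opens} (h : V ≤ U) (s : Γ(twist f E d, U)) (i : Fin (n + 1)) :
    comp f E d (res _ h s) i = res E (inf_le_inf h le_rfl) (comp f E d s i) := rfl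

theorem comp_smul {U : X.Opens} (r : Γ(X, U)) (s : Γ(twist f E d, U)) (i : Fin (n + 1)) :
    comp f E d (r • s) i = resFun (inf_le_left : U ⊓ pchart f i ≤ U) r • comp f E d s i := rfl

/-- The trivialization of `E(d)` on the chart `f⁻¹ D₊(xᵢ)`. -/
def triv (i : Fin (n + 1)) {Q : X.Opens} (hQ : Q ≤ pchart f i) : Γ(twist f E d, Q) →+ Γ(E, Q) where
  toFun s := res E (le_inf le_rfl hQ) (comp f E d s i)
  map_zero' := map_zero (res E _)
  map_add' s t := map_add (res E _) (comp f E d s i) (comp f E d t i)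

variable {f} {i l : Fin (n + 1)} {Q : X.Opens} (hQ : Q ≤ pchart f i)

theorem triv_apply (s : Γ(twist f E d, Q)) :
    triv f E d i hQ s = res E (le_inf le_rfl hQ) (comp f E d s i) := rfl

theorem triv_res {R : X.Opens} (h : R ≤ Q) (s : Γ(twist f E d, Q)) :
    triv f E d i (h.trans hQ) (res _ h s) = res E h (triv f E d i hQ s) := by
  rw [triv_apply, triv_apply, comp_res, res_res, res_res]

theorem triv_smul (r : Γ(X, Q)) (s : Γ(twist f E d, Q)) :
    triv f E d i hQ (r • s) = r • triv f E d i hQ s := by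
  rw [triv_apply, triv_apply, comp_smul, res_smul, resFun_resFun, resFun_self]

theorem triv_rel (hl : Q ≤ pchart f l) (s : Γ(twist f E d, Q)) :
    resFun hQ (ratio f i l) ^ (-d).toNat • triv f E d i hQ s =
      resFun hQ (ratio f i l) ^ d.toNat • triv f E d l hl s := by
  have := congrArg (res E (le_inf le_rfl (le_inf hQ hl))) (comp_rel f E d s i l)
  simpa only [res_smul, res_res, resFun_resFun, map_pow, triv_apply] using this

/-- Inside `f⁻¹ D₊(xᵢ)` the component with index `i` determines all others, because the ratios `xₗ /
xᵢ` are invertible on the overlaps. -/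
theorem triv_bijective : Function.Bijective (triv f E d i hQ) := by
  constructor
  · rw [injective_iff_map_eq_zero]
    intro s hs
    refine comp_ext f E d fun l => ?_
    have h1 := comp_rel f E d s i l
    have h2 : res E (overlap_le_left f Q i l) (comp f E d s i) = 0 := by
      have := congrArg (res E (inf_le_left : Q ⊓ (pchart f i ⊓ pchart f l) ≤ Q)) hs
      rwa [triv_apply, res_res, map_zero] at this
    rw [h2, smul_zero, eq_comm] at h1
    have h3 := ((isUnit_ratio f (overlap_le_chart f Q i l)
      (inf_le_right.trans inf_le_right)).pow d.toNat).smul_eq_zero.1 h1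
    have h4 := congrArg (res E (le_inf inf_le_left (le_inf (inf_le_left.trans hQ) inf_le_right) :
      Q ⊓ pchart f l ≤ Q ⊓ (pchart f i ⊓ pchart f l))) h3
    rw [res_res, res_self, map_zero] at h4
    exact h4
  · intro e
    -- The coefficient is `(xᵢ / xₗ) ^ d` written without inverses: `xᵢ / xₗ` carries the positive
    -- part of `d`, and `xₗ / xᵢ` the negative part.
    let s (l : Fin (n + 1)) : Γ(E, Q ⊓ pchart f l) :=
      (resFun inf_le_right (ratio f l i) ^ d.toNat *
        resFun (inf_le_left.trans hQ) (ratio f i l) ^ (-d).toNat) • res E inf_le_left e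
    obtain ⟨t, ht⟩ := exists_comp f E d s fun l m => by
      simp only [s, res_smul, res_res, map_mul, map_pow, resFun_resFun, smul_smul]
      congr 1
      have hi : Q ⊓ (pchart f l ⊓ pchart f m) ≤ pchart f i := inf_le_left.trans hQ
      have hl : Q ⊓ (pchart f l ⊓ pchart f m) ≤ pchart f l := inf_le_right.trans inf_le_left
      have hm : Q ⊓ (pchart f l ⊓ pchart f m) ≤ pchart f m := inf_le_right.trans inf_le_right
      rw [← ratio_mul f (m := i) hl hm, ← ratio_mul f (m := m) hi hl]
      ring
    refine ⟨t, ?_⟩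
    rw [triv_apply, ht]
    simp only [s, res_res, ratio_self, map_one, one_pow,
      mul_one, one_smul, res_self]

end triv

section modules

variable {X : Scheme.{u}} {E F : X.Modules}

theorem hom_app_res (φ : E ⟶ F) {U V : X.Opens} (h : V ≤ U) (s : Γ(E, U)) :
    φ.app V (res E h s) = res F h (φ.app U s) :=
  congrArg (fun g => g.hom s) (φ.mapPresheaf.naturality (homOfLE h).op)

theorem hom_app_add (φ : E ⟶ F) {U : X.Opens} (s t : Γ(E, U)) :
    φ.app U (s + t) = φ.app U s + φ.app U t := map_add (φ.app U).hom s t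

theorem iso_app_bijective (φ : E ≅ F) (U : X.Opens) : Function.Bijective (φ.hom.app U) :=
  ConcreteCategory.bijective_of_isIso (φ.hom.app U)

theorem comp_app_apply {G : X.Modules} (φ : E ⟶ F) (ψ : F ⟶ G) {U : X.Opens} (s : Γ(E, U)) :
    ψ.app U (φ.app U s) = (φ ≫ ψ).app U s := rfl

/-- The components of a section of a direct sum. -/
def biprodSections (E F : X.Modules) (U : X.Opens) : Γ(biprod E F, U) →+ Γ(E, U) × Γ(F, U) :=
  AddMonoidHom.prod ((Limits.biprod.fst : biprod E F ⟶ E).app U).hom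
    ((Limits.biprod.snd : biprod E F ⟶ F).app U).hom

theorem biprodSections_bijective (E F : X.Modules) (U : X.Opens) :
    Function.Bijective (biprodSections E F U) := by
  constructor
  · rw [injective_iff_map_eq_zero]
    intro s hs
    obtain ⟨h1, h2⟩ := Prod.ext_iff.1 hs
    have h3 : (Limits.biprod.inl : E ⟶ biprod E F).app U
        ((Limits.biprod.fst : biprod E F ⟶ E).app U s) + (Limits.biprod.inr : F ⟶ biprod E F).app U
        ((Limits.biprod.snd : biprod E F ⟶ F).app U s) = s :=
      congrArg (fun φ => φ.app U s) (Limits.biprod.total (X := E) (Y := F))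
    change (Limits.biprod.fst : biprod E F ⟶ E).app U s = 0 at h1
    change (Limits.biprod.snd : biprod E F ⟶ F).app U s = 0 at h2
    rw [← h3, h1, h2, map_zero, map_zero, add_zero]
  · rintro ⟨x, y⟩
    refine ⟨(Limits.biprod.inl : E ⟶ biprod E F).app U x +
      (Limits.biprod.inr : F ⟶ biprod E F).app U y, ?_⟩
    refine Prod.ext ?_ ?_
    · change (Limits.biprod.fst : biprod E F ⟶ E).app U (_ + _) = x
      rw [hom_app_add, comp_app_apply, comp_app_apply, Limits.biprod.inl_fst,
        Limits.biprod.inr_fst]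
      exact add_zero x
    · change (Limits.biprod.snd : biprod E F ⟶ F).app U (_ + _) = y
      rw [hom_app_add, comp_app_apply, comp_app_apply, Limits.biprod.inl_snd,
        Limits.biprod.inr_snd]
      exact zero_add y

end modules

section split

variable {k : Type u} [Field k]

theorem ratio_id (i l : Fin 2) : ratio (𝟙 (PSpace k 1)) i l = coordRatio k i l := rfl

/-- The trivialization of `𝒪(d)` over an open subset of the chart `D₊(xᵢ)`. -/
def lineTriv (d : ℤ) (i : Fin 2) {Q : (PSpace k 1).Opens} (hQ : Q ≤ chart k i) :
    Γ(lineBundle k 1 d, Q) →+ Γ(PSpace k 1, Q) :=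
  triv (𝟙 _) (structureModule _) d i hQ

section

variable (d : ℤ) {i : Fin 2} {Q : (PSpace k 1).Opens} (hQ : Q ≤ chart k i)

theorem lineTriv_bijective : Function.Bijective (lineTriv d i hQ) :=
  triv_bijective (structureModule (PSpace k 1)) d (f := 𝟙 _) (i := i) hQ

theorem lineTriv_res {R : (PSpace k 1).Opens} (h : R ≤ Q) (s : Γ(lineBundle k 1 d, Q)) :
    lineTriv d i (h.trans hQ) (res _ h s) = resFun h (lineTriv d i hQ s) :=
  triv_res (structureModule (PSpace k 1)) d (f := 𝟙 _) hQ h s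

theorem lineTriv_smul (r : Γ(PSpace k 1, Q)) (s : Γ(lineBundle k 1 d, Q)) :
    lineTriv d i hQ (r • s) = r * lineTriv d i hQ s :=
  triv_smul (structureModule (PSpace k 1)) d (f := 𝟙 _) hQ r s

theorem lineTriv_rel {l : Fin 2} (hl : Q ≤ chart k l) (s : Γ(lineBundle k 1 d, Q)) :
    resFun hQ (coordRatio k i l) ^ (-d).toNat * lineTriv d i hQ s =
      resFun hQ (coordRatio k i l) ^ d.toNat * lineTriv d l hl s :=
  triv_rel (structureModule (PSpace k 1)) d (f := 𝟙 _) hQ hl s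

end

/-- The trivialization of `𝒪(-a) ⊕ 𝒪(-b)` over an open subset of the chart `D₊(xᵢ)`. -/
def splitTriv (a b : ℤ) (i : Fin 2) {Q : (PSpace k 1).Opens} (hQ : Q ≤ chart k i)
    (s : Γ(splitBundle k a b, Q)) : Fin 2 → Γ(PSpace k 1, Q) :=
  ![lineTriv (-a) i hQ (biprodSections _ _ Q s).1, lineTriv (-b) i hQ (biprodSections _ _ Q s).2]

variable (a b : ℤ) {i : Fin 2} {Q : (PSpace k 1).Opens} (hQ : Q ≤ chart k i)

theorem splitTriv_add (s t : Γ(splitBundle k a b, Q)) :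
    splitTriv a b i hQ (s + t) = splitTriv a b i hQ s + splitTriv a b i hQ t := by
  have h := map_add (biprodSections (lineBundle k 1 (-a)) (lineBundle k 1 (-b)) Q) s t
  refine funext (Fin.forall_fin_two.2 ⟨?_, ?_⟩)
  · exact (congrArg (fun z => lineTriv (-a) i hQ z.1) h).trans (map_add (lineTriv (-a) i hQ) _ _)
  · exact (congrArg (fun z => lineTriv (-b) i hQ z.2) h).trans (map_add (lineTriv (-b) i hQ) _ _)

theorem splitTriv_bijective : Function.Bijective (splitTriv a b i hQ) := by
  have h := biprodSections_bijective (lineBundle k 1 (-a)) (lineBundle k 1 (-b)) Q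
  constructor
  · intro s t hst
    exact h.1 (Prod.ext ((lineTriv_bijective (-a) hQ).1 (congrFun hst 0))
      ((lineTriv_bijective (-b) hQ).1 (congrFun hst 1)))
  · intro u
    obtain ⟨x, hx⟩ := (lineTriv_bijective (-a) hQ).2 (u 0)
    obtain ⟨y, hy⟩ := (lineTriv_bijective (-b) hQ).2 (u 1)
    obtain ⟨s, hs⟩ := h.2 (x, y)
    refine ⟨s, funext (Fin.forall_fin_two.2 ⟨?_, ?_⟩)⟩
    · exact (congrArg (fun z => lineTriv (-a) i hQ z.1) hs).trans hx
    · exact (congrArg (fun z => lineTriv (-b) i hQ z.2) hs).trans hy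

theorem splitTriv_res {R : (PSpace k 1).Opens} (h : R ≤ Q) (s : Γ(splitBundle k a b, Q)) (c : Fin 2) :
    splitTriv a b i (h.trans hQ) (res _ h s) c = resFun h (splitTriv a b i hQ s c) := by
  revert c
  refine Fin.forall_fin_two.2 ⟨?_, ?_⟩
  · exact (congrArg (lineTriv (-a) i (h.trans hQ))
      (hom_app_res (Limits.biprod.fst : splitBundle k a b ⟶ lineBundle k 1 (-a)) h s)).trans
      (lineTriv_res (-a) hQ h _)
  · exact (congrArg (lineTriv (-b) i (h.trans hQ))
      (hom_app_res (Limits.biprod.snd : splitBundle k a b ⟶ lineBundle k 1 (-b)) h s)).trans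
      (lineTriv_res (-b) hQ h _)

theorem splitTriv_smul (r : Γ(PSpace k 1, Q)) (s : Γ(splitBundle k a b, Q)) (c : Fin 2) :
    splitTriv a b i hQ (r • s) c = r * splitTriv a b i hQ s c := by
  revert c
  refine Fin.forall_fin_two.2 ⟨?_, ?_⟩
  · exact (congrArg (lineTriv (-a) i hQ)
      ((Limits.biprod.fst : splitBundle k a b ⟶ lineBundle k 1 (-a)).app_smul r s)).trans
      (lineTriv_smul (-a) hQ r _)
  · exact (congrArg (lineTriv (-b) i hQ)
      ((Limits.biprod.snd : splitBundle k a b ⟶ lineBundle k 1 (-b)).app_smul r s)).trans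
      (lineTriv_smul (-b) hQ r _)

theorem splitTriv_rel {l : Fin 2} (hl : Q ≤ chart k l) (s : Γ(splitBundle k a b, Q)) (c : Fin 2) :
    resFun hQ (coordRatio k i l) ^ (![a, b] c).toNat * splitTriv a b i hQ s c =
      resFun hQ (coordRatio k i l) ^ (-![a, b] c).toNat * splitTriv a b l hl s c := by
  revert c
  refine Fin.forall_fin_two.2 ⟨?_, ?_⟩
  · have := lineTriv_rel (-a) hQ hl (biprodSections _ _ Q s).1
    rw [neg_neg] at this
    exact this
  · have := lineTriv_rel (-b) hQ hl (biprodSections _ _ Q s).2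
    rw [neg_neg] at this
    exact this

end split

/-! ### The intersection of the two charts: Laurent polynomials -/

section overlap

variable {k : Type u} [Field k]

/-- The intersection of the two charts of `ℙ¹`. -/
abbrev chartOverlap (k : Type u) [Field k] : (PSpace k 1).Opens := chart k 0 ⊓ chart k 1

theorem coord_mul_coord : resFun (inf_le_left : chartOverlap k ≤ _) (coord k 0) *
    resFun (inf_le_right : chartOverlap k ≤ _) (coord k 1) = 1 := by
  have := coordRatio_mul (k := k) (n := 1) 0 1 0
  rw [coordRatio_self, map_one] at this
  exact this

theorem basicOpen_coord : (PSpace k 1).basicOpen (coord k 0) = chartOverlap k := by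
  refine le_antisymm (le_inf (Scheme.basicOpen_le _ _) (basicOpen_coordRatio 0 1)) ?_
  exact basicOpen_of_isUnit (h := inf_le_left) (IsUnit.of_mul_eq_one _ coord_mul_coord)

/-- The intersection is the basic open set of the coordinate in the affine chart `0`. Both rings are
therefore localizations of the polynomial ring at the variable. -/
theorem exists_overlapEquiv : ∃ e : LaurentPolynomial k ≃+* Γ(PSpace k 1, chartOverlap k),
    ∀ p : Polynomial k, e p.toLaurent = resFun inf_le_left (polyChart k 0 p) := by
  let : Algebra Γ(PSpace k 1, chart k 0) Γ(PSpace k 1, chartOverlap k) :=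
    (resFun inf_le_left).toAlgebra
  have h1 : IsLocalization.Away (coord k 0) Γ(PSpace k 1, chartOverlap k) :=
    (isAffineOpen_chart 0).isLocalization_of_eq_basicOpen (coord k 0) (homOfLE inf_le_left)
      basicOpen_coord.symm
  have h2 : IsLocalization.Away (Polynomial.X : Polynomial k) (LaurentPolynomial k) := inferInstance
  let e0 := RingEquiv.ofBijective _ (polyChart_bijective (k := k) 0)
  have he : Submonoid.map e0.toMonoidHom (Submonoid.powers Polynomial.X) =
      Submonoid.powers (coord k 0) := by
    rw [Submonoid.map_powers]
    congr 1
    exact polyChart_X 0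
  refine ⟨IsLocalization.ringEquivOfRingEquiv _ _ e0 he, fun p => ?_⟩
  exact IsLocalization.ringEquivOfRingEquiv_eq he p

/-- Regular functions on the intersection of the charts of `ℙ¹` are Laurent polynomials. -/
def overlapEquiv (k : Type u) [Field k] : LaurentPolynomial k ≃+* Γ(PSpace k 1, chartOverlap k) :=
  exists_overlapEquiv.choose

theorem overlapEquiv_toLaurent (p : Polynomial k) :
    overlapEquiv k p.toLaurent = resFun inf_le_left (polyChart k 0 p) :=
  exists_overlapEquiv.choose_spec p

theorem overlapEquiv_T_one : overlapEquiv k (LaurentPolynomial.T 1) =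
    resFun inf_le_left (coord k 0) := by
  rw [← Polynomial.toLaurent_X, overlapEquiv_toLaurent, polyChart_X]

theorem overlapEquiv_C (c : k) : overlapEquiv k (LaurentPolynomial.C c) =
    scalarsOn k _ _ c := by
  rw [← Polynomial.toLaurent_C, overlapEquiv_toLaurent, polyChart_C, resFun_scalarsOn]

theorem overlapEquiv_T_neg_one : overlapEquiv k (LaurentPolynomial.T (-1)) =
    resFun inf_le_right (coord k 1) := by
  have h : overlapEquiv k (LaurentPolynomial.T 1) * overlapEquiv k (LaurentPolynomial.T (-1)) = 1 := by
    rw [← map_mul, ← LaurentPolynomial.T_add]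
    simp
  rw [overlapEquiv_T_one] at h
  exact (IsUnit.of_mul_eq_one _ h).mul_left_cancel (h.trans coord_mul_coord.symm)

theorem overlapEquiv_invert (p : Polynomial k) :
    overlapEquiv k (LaurentPolynomial.invert p.toLaurent) =
      resFun inf_le_right (polyChart k 1 p) := by
  have : ((overlapEquiv k).toRingHom.comp ((LaurentPolynomial.invert (R := k)).toRingEquiv.toRingHom.comp
      Polynomial.toLaurent)) = (resFun inf_le_right).comp (polyChart k 1) := by
    refine Polynomial.ringHom_ext (fun c => ?_) ?_
    · simp [polyChart_C, resFun_scalarsOn, overlapEquiv_C]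
    · simp [polyChart_X, overlapEquiv_T_neg_one]
  exact congrArg (fun φ => φ p) this

end overlap

/-! ### Čech splitting on an affine open set -/

section decomposition

variable {X : Scheme.{u}} {D : X.Opens}

/-- This is the vanishing of Čech `H¹` for the cover of `D(F + G)` by `D(F)` and `D(G)`. Write `z =
y / (F G) ^ n` and `(F + G) ^ (2 n) = a F ^ n + b G ^ n`. Then `z` is the sum of `y b / F ^ n` and
`y a / G ^ n`, each divided by `(F + G) ^ (2 n)`. -/
theorem exists_eq_add_of_basicOpen (hD : IsAffineOpen D) (F G : Γ(X, D))
    (hF : X.basicOpen F ≤ X.basicOpen (F + G)) (hG : X.basicOpen G ≤ X.basicOpen (F + G))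
    {O : X.Opens} (hO : O = X.basicOpen F ⊓ X.basicOpen G) (hOF : O ≤ X.basicOpen F)
    (hOG : O ≤ X.basicOpen G) (z : Γ(X, O)) :
    ∃ (z₁ : Γ(X, X.basicOpen F)) (z₂ : Γ(X, X.basicOpen G)),
      z = resFun hOF z₁ + resFun hOG z₂ := by
  have hFD := X.basicOpen_le F
  have hGD := X.basicOpen_le G
  have hOD : O ≤ D := hOF.trans hFD
  let : Algebra Γ(X, D) Γ(X, O) := (resFun hOD).toAlgebra
  have hloc : IsLocalization.Away (F * G) Γ(X, O) :=
    hD.isLocalization_of_eq_basicOpen (F * G) (homOfLE hOD)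
      (hO.trans (X.basicOpen_mul F G).symm)
  obtain ⟨n, y, hy⟩ := IsLocalization.Away.surj (F * G) z
  change z * resFun hOD (F * G) ^ n = resFun hOD y at hy
  have h3 : (F + G) ^ (2 * n) ∈ Ideal.span {F ^ n, G ^ n} :=
    Ideal.add_pow_mem_of_pow_mem_of_le _ (m := n) (n := n) (Ideal.subset_span (by simp))
      (Ideal.subset_span (by simp)) (by lia)
  obtain ⟨a, b, hab⟩ := Ideal.mem_span_pair.1 h3
  obtain ⟨F', hF'⟩ := (isUnit_resFun_basicOpen F hFD le_rfl).exists_right_inv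
  obtain ⟨G', hG'⟩ := (isUnit_resFun_basicOpen G hGD le_rfl).exists_right_inv
  obtain ⟨v₁, hv₁⟩ := (isUnit_resFun_basicOpen (F + G) hFD hF).exists_right_inv
  obtain ⟨v₂, hv₂⟩ := (isUnit_resFun_basicOpen (F + G) hGD hG).exists_right_inv
  refine ⟨resFun hFD (y * b) * v₁ ^ (2 * n) * F' ^ n, resFun hGD (y * a) * v₂ ^ (2 * n) * G' ^ n, ?_⟩
  have hu := (isUnit_resFun_basicOpen (F * G) hOD (hO.le.trans (X.basicOpen_mul F G).ge)).pow n
  have hsum := isUnit_resFun_basicOpen (F + G) hOD (hOF.trans hF)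
  have e1 := congrArg (resFun hOF) hF'
  have e2 := congrArg (resFun hOG) hG'
  have e3 := congrArg (resFun hOF) hv₁
  have e4 := congrArg (resFun hOG) hv₂
  have e5 := congrArg (resFun hOD) hab
  simp only [map_mul, map_add, map_pow, map_one, resFun_resFun] at e1 e2 e3 e4 e5 hy hu hsum ⊢
  refine (hu.mul (hsum.pow (2 * n))).mul_right_cancel ?_
  rw [← mul_assoc, hy]
  generalize resFun hOD F = f at *
  generalize resFun hOD G = g at *
  generalize resFun _ v₁ = w₁ at *
  generalize resFun _ v₂ = w₂ at *
  generalize resFun _ F' = f' at *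
  generalize resFun _ G' = g' at *
  generalize resFun hOD a = a at *
  generalize resFun hOD b = b at *
  generalize resFun hOD y = y at *
  have e6 : f ^ n * f' ^ n = 1 := by rw [← mul_pow, e1, one_pow]
  have e7 : g ^ n * g' ^ n = 1 := by rw [← mul_pow, e2, one_pow]
  have e8 : (f + g) ^ (2 * n) * w₁ ^ (2 * n) = 1 := by rw [← mul_pow, e3, one_pow]
  have e9 : (f + g) ^ (2 * n) * w₂ ^ (2 * n) = 1 := by rw [← mul_pow, e4, one_pow]
  rw [mul_pow]
  generalize (f + g) ^ (2 * n) = q at *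
  linear_combination (-y) * e5 - y * b * g ^ n * f ^ n * f' ^ n * e8 - y * b * g ^ n * e6
    - y * a * f ^ n * g ^ n * g' ^ n * e9 - y * a * f ^ n * e7

end decomposition

/-! ### Lifting functions from the reduced subscheme to the rope -/

section rope

variable {X Y' : Scheme.{u}} {ι : X ⟶ Y'}

theorem IsRope.isHomeomorph {E : X.Modules} (h : IsRope ι E) : IsHomeomorph ι := by
  have := h.isClosedImmersion
  have h1 := ι.isClosedEmbedding
  exact (isHomeomorph_iff_continuous_isClosedMap_bijective).2
    ⟨h1.continuous, h1.isClosedMap, h1.injective, h.surjective⟩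

/-- The image of an open set under a homeomorphic morphism. -/
def img (hι : IsHomeomorph ι) (V : X.Opens) : Y'.Opens := ⟨ι '' V, hι.isOpenMap _ V.2⟩

variable (hι : IsHomeomorph ι)

theorem img_mono {V W : X.Opens} (h : V ≤ W) : img hι V ≤ img hι W := Set.image_mono h

theorem le_preimage_img (V : X.Opens) : V ≤ ι ⁻¹ᵁ img hι V := fun x hx => ⟨x, hx, rfl⟩

theorem preimage_img_le (V : X.Opens) : ι ⁻¹ᵁ img hι V ≤ V := by
  rintro x ⟨y, hy, hxy⟩
  rwa [← hι.injective hxy]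

theorem img_inf (V W : X.Opens) : img hι (V ⊓ W) = img hι V ⊓ img hι W :=
  Opens.ext (Set.image_inter hι.injective)

theorem img_le_iSup {κ : Type*} (V : κ → X.Opens) {W : X.Opens} (h : W ≤ iSup V) :
    img hι W ≤ ⨆ a, img hι (V a) := by
  rintro _ ⟨x, hx, rfl⟩
  obtain ⟨a, ha⟩ := Opens.mem_iSup.1 (h hx)
  exact Opens.mem_iSup.2 ⟨a, x, ha, rfl⟩

/-- Restriction of regular functions to the reduced subscheme. -/
def red (V : X.Opens) : Γ(Y', img hι V) →+* Γ(X, V) := pullFun ι (le_preimage_img hι V)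

theorem red_res {V W : X.Opens} (h : W ≤ V) (s : Γ(Y', img hι V)) :
    red hι W (resFun (img_mono hι h) s) = resFun h (red hι V s) :=
  pullFun_resFun ι (img_mono hι h) _ _ h s

/-- A trivialization of the conormal sheaf of a rope over the open set `D`: compatible
identifications of `𝒪(V) ^ 2` with the kernel of `𝒪_{Y'}(V) → 𝒪(V)` for `V ⊆ D`. -/
structure RopeChart (D : X.Opens) where
  j : ∀ {V : X.Opens}, V ≤ D → (Fin 2 → Γ(X, V)) → Γ(Y', img hι V)
  add : ∀ {V : X.Opens} (h : V ≤ D) (u v : Fin 2 → Γ(X, V)), j h (u + v) = j h u + j h v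
  inj : ∀ {V : X.Opens} (h : V ≤ D), Function.Injective (j h)
  res : ∀ {V W : X.Opens} (h : V ≤ D) (h' : W ≤ V) (u : Fin 2 → Γ(X, V)),
    resFun (img_mono hι h') (j h u) = j (h'.trans h) (fun c => resFun h' (u c))
  smul : ∀ {V : X.Opens} (h : V ≤ D) (s : Γ(Y', img hι V)) (u : Fin 2 → Γ(X, V)),
    s * j h u = j h (fun c => red hι V s * u c)
  ker : ∀ {V : X.Opens} (h : V ≤ D) (s : Γ(Y', img hι V)), red hι V s = 0 ↔ ∃ u, j h u = s

variable {hι} {D : X.Opens} (R : RopeChart hι D)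

/-- A closed immersion is surjective on functions over an affine open set of the target. It suffices
to shrink to a basic open set mapping into such an affine neighbourhood of `ι x`. -/
theorem exists_local_lift [IsClosedImmersion ι] (hD : IsAffineOpen D) (t : Γ(X, D)) (x : X)
    (hx : x ∈ D) : ∃ f : Γ(X, D), x ∈ X.basicOpen f ∧
      ∃ s : Γ(Y', img hι (X.basicOpen f)), red hι _ s = resFun (X.basicOpen_le f) t := by
  obtain ⟨W, hW, hxW, hWD⟩ := exists_isAffineOpen_mem_and_subset (X := Y') (x := ι x)
    (U := img hι D) ⟨x, hx, rfl⟩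
  obtain ⟨f, hf, hxf⟩ := hD.exists_basicOpen_le (V := ι ⁻¹ᵁ W) ⟨x, hxW⟩ hx
  have h1 : ι ⁻¹ᵁ W ≤ D := fun y hy => preimage_img_le hι D (hWD hy)
  obtain ⟨s, hs⟩ := ι.app_surjective W hW (resFun h1 t)
  have h2 : img hι (X.basicOpen f) ≤ W := by
    rintro _ ⟨y, hy, rfl⟩
    exact hf hy
  refine ⟨f, hxf, resFun h2 s, ?_⟩
  have h3 : pullFun ι (le_refl (ι ⁻¹ᵁ W)) s = resFun h1 t := by
    rw [← hs]
    unfold pullFun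
    rw [Scheme.Hom.app_eq_appLE]
  rw [red, pullFun_resFun ι h2 _ (le_refl (ι ⁻¹ᵁ W)) hf, h3, resFun_resFun]

include R in
-- Two lifts of `t` differ on the overlap by an element of the kernel, hence by a pair of functions
-- on the reduced scheme. Splitting these functions between the two open sets corrects the lifts so
-- that they glue.
theorem exists_lift_of_basicOpen (hD : IsAffineOpen D) {V : X.Opens} (t : Γ(X, V))
    (F G : Γ(X, D)) (hF : X.basicOpen F ≤ X.basicOpen (F + G))
    (hG : X.basicOpen G ≤ X.basicOpen (F + G)) (hFV : X.basicOpen F ≤ V) (hGV : X.basicOpen G ≤ V)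
    (hVc : V ≤ X.basicOpen F ⊔ X.basicOpen G)
    (sF : Γ(Y', img hι (X.basicOpen F))) (hsF : red hι _ sF = resFun hFV t)
    (sG : Γ(Y', img hι (X.basicOpen G))) (hsG : red hι _ sG = resFun hGV t) :
    ∃ s : Γ(Y', img hι V), red hι _ s = t := by
  have hFD := X.basicOpen_le F
  have hGD := X.basicOpen_le G
  obtain ⟨O, hO⟩ : ∃ O, O = X.basicOpen F ⊓ X.basicOpen G := ⟨_, rfl⟩
  have hOF : O ≤ X.basicOpen F := hO.le.trans inf_le_left
  have hOG : O ≤ X.basicOpen G := hO.le.trans inf_le_right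
  have h1 : red hι O (resFun (img_mono hι hOF) sF - resFun (img_mono hι hOG) sG) = 0 := by
    rw [map_sub, red_res hι hOF, red_res hι hOG, hsF, hsG, resFun_resFun, resFun_resFun, sub_self]
  obtain ⟨z, hz⟩ := (R.ker (hOF.trans hFD) _).1 h1
  choose z₁ z₂ hz' using fun c => exists_eq_add_of_basicOpen hD F G hF hG hO hOF hOG (z c)
  have hz3 : resFun (img_mono hι hOF) (R.j hFD z₁) + resFun (img_mono hι hOG) (R.j hGD z₂) =
      resFun (img_mono hι hOF) sF - resFun (img_mono hι hOG) sG := by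
    rw [R.res, R.res, ← R.add, ← hz]
    congr 1
    ext c
    exact (hz' c).symm
  let U : Bool → X.Opens := fun b => cond b (X.basicOpen F) (X.basicOpen G)
  have hU (b) : U b ≤ V := by cases b <;> assumption
  have hcov : V ≤ iSup U := by
    rw [iSup_bool_eq]
    exact hVc
  let r (b : Bool) : Γ(Y', img hι (U b)) :=
    match b with
    | true => sF - R.j hFD z₁
    | false => sG + R.j hGD z₂
  have hO' : img hι (X.basicOpen F) ⊓ img hι (X.basicOpen G) ≤ img hι O := by
    rw [← img_inf, hO]
  have key := congrArg (resFun hO') hz3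
  simp only [map_add, map_sub, resFun_resFun] at key
  obtain ⟨s, hs⟩ := resFun_glue (fun b => img hι (U b)) (img hι V) (fun b => img_mono hι (hU b))
    (img_le_iSup hι U hcov) r (by
      intro a b
      cases a <;> cases b
      · rfl
      · change resFun _ (sG + R.j hGD z₂) = resFun _ (sF - R.j hFD z₁)
        have key' := congrArg (resFun (inf_comm (img hι (X.basicOpen G))
          (img hι (X.basicOpen F))).le) key
        simp only [map_add, map_sub, resFun_resFun] at key' ⊢
        linear_combination key'
      · change resFun _ (sF - R.j hFD z₁) = resFun _ (sG + R.j hGD z₂)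
        simp only [map_add, map_sub]
        linear_combination -key
      · rfl)
  refine ⟨s, ?_⟩
  refine resFun_eq_of_cover U V hU hcov _ _ fun b => ?_
  rw [← red_res hι (hU b), hs]
  have e1 : red hι _ (R.j hFD z₁) = 0 := (R.ker hFD _).2 ⟨_, rfl⟩
  have e2 : red hι _ (R.j hGD z₂) = 0 := (R.ker hGD _).2 ⟨_, rfl⟩
  cases b
  · change red hι _ (sG + R.j hGD z₂) = _
    rw [map_add, e2, add_zero]
    exact hsG
  · change red hι _ (sF - R.j hFD z₁) = _
    rw [map_sub, e1, sub_zero]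
    exact hsF

include R in
/-- Regular functions on an affine open subset of the reduced subscheme lift to the rope. -/
theorem red_surjective [IsClosedImmersion ι] (hD : IsAffineOpen D) :
    Function.Surjective (red hι D) := by
  intro t
  -- The functions `f` such that `t` lifts over `D(f)` form an ideal. Local lifts show that it has
  -- no zeros on the affine set `D`, so it contains `1`.
  let I : Ideal Γ(X, D) :=
    { carrier := {f | ∃ s : Γ(Y', img hι (X.basicOpen f)), red hι _ s = resFun (X.basicOpen_le f) t}
      zero_mem' := by
        refine ⟨0, ?_⟩
        -- The basic open set of `0` is empty, and the empty cover shows that any two functions on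
        -- it agree.
        refine resFun_eq_of_cover (ι := Empty) (fun _ => ⊥) _ (fun _ => bot_le) ?_ _ _ nofun
        rw [X.basicOpen_zero]
        exact bot_le
      smul_mem' := by
        rintro c f ⟨s, hs⟩
        have h : X.basicOpen (c * f) ≤ X.basicOpen f := (X.basicOpen_mul c f).le.trans inf_le_right
        refine ⟨resFun (img_mono hι h) s, ?_⟩
        exact (red_res hι h s).trans (by rw [hs, resFun_resFun])
      add_mem' := by
        rintro f g ⟨s, hs⟩ ⟨s', hs'⟩
        -- The gluing lemma needs both basic open sets inside that of the sum. Multiplying `f` and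
        -- `g` by `f + g` achieves this and leaves `D(f + g)` unchanged.
        have e : f * (f + g) + g * (f + g) = (f + g) ^ 2 := by ring
        have hF : X.basicOpen (f * (f + g)) = X.basicOpen f ⊓ X.basicOpen (f + g) :=
          X.basicOpen_mul _ _
        have hG : X.basicOpen (g * (f + g)) = X.basicOpen g ⊓ X.basicOpen (f + g) :=
          X.basicOpen_mul _ _
        have hq : X.basicOpen ((f + g) ^ 2) = X.basicOpen (f + g) := X.basicOpen_pow _ two_pos
        refine exists_lift_of_basicOpen R hD _ (f * (f + g)) (g * (f + g))
          ?_ ?_ (hF.le.trans inf_le_right) (hG.le.trans inf_le_right) ?_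
          (resFun (img_mono hι (hF.le.trans inf_le_left)) s) ?_
          (resFun (img_mono hι (hG.le.trans inf_le_left)) s') ?_
        · rw [e, hq, hF]
          exact inf_le_right
        · rw [e, hq, hG]
          exact inf_le_right
        · rw [hF, hG, ← inf_sup_right]
          exact le_inf (X.basicOpen_add_le f g) le_rfl
        · rw [red_res hι (hF.le.trans inf_le_left), hs, resFun_resFun, resFun_resFun]
        · rw [red_res hι (hG.le.trans inf_le_left), hs', resFun_resFun, resFun_resFun] }
  have hI : I = ⊤ := by
    rw [← Ideal.span_eq I]
    refine (hD.self_le_iSup_basicOpen_iff (s := (I : Set Γ(X, D)))).1 fun x hx => ?_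
    obtain ⟨f, hxf, hf⟩ := exists_local_lift (hι := hι) hD t x hx
    exact Opens.mem_iSup.2 ⟨⟨f, hf⟩, hxf⟩
  obtain ⟨s, hs⟩ : (1 : Γ(X, D)) ∈ I := hI ▸ trivial
  have h1 : D ≤ X.basicOpen (1 : Γ(X, D)) := (X.basicOpen_of_isUnit isUnit_one).ge
  refine ⟨resFun (img_mono hι h1) s, ?_⟩
  rw [red_res hι h1, hs, resFun_resFun, resFun_self]

end rope

/-! ### The conormal sheaf as kernel, and its trivialization on charts -/

section conormal

variable {X Y' : Scheme.{u}} {ι : X ⟶ Y'} (hι : IsHomeomorph ι) {E : X.Modules}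
  (α : (Scheme.Modules.pushforward ι).obj E ⟶ structureModule Y')

/-- The map from sections of the conormal sheaf to regular functions on the rope. -/
def conormalMap (V : X.Opens) (e : Γ(E, V)) : Γ(Y', img hι V) :=
  α.app (img hι V) (show Γ((Scheme.Modules.pushforward ι).obj E, img hι V) from
    res E (preimage_img_le hι V) e)

theorem conormalMap_add {V : X.Opens} (e e' : Γ(E, V)) :
    conormalMap hι α V (e + e') = conormalMap hι α V e + conormalMap hι α V e' :=
  (congrArg (α.app (img hι V)) (map_add (res E (preimage_img_le hι V)) e e')).trans
    (map_add (α.app (img hι V)).hom _ _)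

theorem conormalMap_res {V W : X.Opens} (h : W ≤ V) (e : Γ(E, V)) :
    resFun (img_mono hι h) (conormalMap hι α V e) = conormalMap hι α W (res E h e) := by
  have h1 := hom_app_res α (img_mono hι h)
    (show Γ((Scheme.Modules.pushforward ι).obj E, img hι V) from res E (preimage_img_le hι V) e)
  refine h1.symm.trans (congrArg (α.app (img hι W)) ?_)
  have h2 : ι ⁻¹ᵁ img hι W ≤ ι ⁻¹ᵁ img hι V := fun x hx => img_mono hι h hx
  change res E h2 (res E (preimage_img_le hι V) e) = res E (preimage_img_le hι W) (res E h e)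
  rw [res_res, res_res]

theorem app_eq_resFun_red (V : X.Opens) (s : Γ(Y', img hι V)) :
    (ι.app (img hι V)).hom s = resFun (preimage_img_le hι V) (red hι V s) := by
  rw [red, pullFun_id_res, pullFun, Scheme.Hom.app_eq_appLE]

theorem conormalMap_smul {V : X.Opens} (s : Γ(Y', img hι V)) (e : Γ(E, V)) :
    s * conormalMap hι α V e = conormalMap hι α V (red hι V s • e) := by
  have h1 := α.app_smul s (show Γ((Scheme.Modules.pushforward ι).obj E, img hι V) from
    res E (preimage_img_le hι V) e)
  refine h1.symm.trans (congrArg (α.app (img hι V)) ?_)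
  change (ι.app (img hι V)).hom s • res E (preimage_img_le hι V) e =
    res E (preimage_img_le hι V) (red hι V s • e)
  rw [res_smul, app_eq_resFun_red]

theorem res_injective_of_le {U V : X.Opens} (h : V ≤ U) (h' : U ≤ V) :
    Function.Injective (res E h) := fun e e' hee => by
  have := congrArg (res E h') hee
  rwa [res_res, res_res, res_self, res_self] at this

variable (hα : ∀ V : Y'.Opens, Function.Injective (α.app V) ∧
      ∀ s : Γ(Y', V), (ι.app V).hom s = 0 ↔
        ∃ e : Γ((Scheme.Modules.pushforward ι).obj E, V), α.app V e = s)

include hα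

theorem conormalMap_injective (V : X.Opens) : Function.Injective (conormalMap hι α V) := by
  intro e e' h
  exact res_injective_of_le (preimage_img_le hι V) (le_preimage_img hι V) ((hα (img hι V)).1 h)

theorem red_eq_zero_iff {V : X.Opens} (s : Γ(Y', img hι V)) :
    red hι V s = 0 ↔ ∃ e, conormalMap hι α V e = s := by
  have h1 : red hι V s = 0 ↔ (ι.app (img hι V)).hom s = 0 := by
    rw [app_eq_resFun_red]
    refine ⟨fun h => by rw [h, map_zero], fun h => ?_⟩
    have := congrArg (resFun (le_preimage_img hι V)) h
    rwa [resFun_resFun, resFun_self, map_zero] at this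
  rw [h1, (hα _).2]
  constructor
  · rintro ⟨e, he⟩
    refine ⟨res E (le_preimage_img hι V) e, ?_⟩
    rw [← he]
    refine congrArg (α.app (img hι V)) ?_
    exact (res_res E _ (preimage_img_le hι V) _).trans (res_self E le_rfl _)
  · rintro ⟨e, he⟩
    exact ⟨_, he⟩

end conormal

section splitRope

variable {k : Type u} [Field k] {a b : ℤ} {Y' : Scheme.{u}} {ι : PSpace k 1 ⟶ Y'}
  (hι : IsHomeomorph ι) (α : (Scheme.Modules.pushforward ι).obj (splitBundle k a b) ⟶
    structureModule Y')
  (hα : ∀ V : Y'.Opens, Function.Injective (α.app V) ∧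
      ∀ s : Γ(Y', V), (ι.app V).hom s = 0 ↔
        ∃ e : Γ((Scheme.Modules.pushforward ι).obj (splitBundle k a b), V), α.app V e = s)

/-- The inverse of the trivialization `splitTriv`. -/
def splitInv (a b : ℤ) {i : Fin 2} {Q : (PSpace k 1).Opens} (hQ : Q ≤ chart k i)
    (u : Fin 2 → Γ(PSpace k 1, Q)) : Γ(splitBundle k a b, Q) :=
  ((splitTriv_bijective a b hQ).2 u).choose

section

variable {i : Fin 2} {Q : (PSpace k 1).Opens} (hQ : Q ≤ chart k i)

theorem splitTriv_splitInv (u : Fin 2 → Γ(PSpace k 1, Q)) :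
    splitTriv a b i hQ (splitInv a b hQ u) = u :=
  ((splitTriv_bijective a b hQ).2 u).choose_spec

theorem splitInv_splitTriv (s : Γ(splitBundle k a b, Q)) :
    splitInv a b hQ (splitTriv a b i hQ s) = s :=
  (splitTriv_bijective a b hQ).1 (splitTriv_splitInv hQ _)

end

/-- The trivialization of the conormal sheaf of a rope on `ℙ¹` over a chart. -/
def ropeChart (i : Fin 2) : RopeChart hι (chart k i) where
  j hV u := conormalMap hι α _ (splitInv a b hV u)
  add hV u v := by
    rw [← conormalMap_add]
    congr 1
    apply (splitTriv_bijective a b hV).1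
    rw [splitTriv_add, splitTriv_splitInv, splitTriv_splitInv, splitTriv_splitInv]
  inj hV u v h := by
    have := congrArg (splitTriv a b i hV) (conormalMap_injective hι α hα _ h)
    rwa [splitTriv_splitInv, splitTriv_splitInv] at this
  res hV hW u := by
    rw [conormalMap_res hι α hW]
    congr 1
    apply (splitTriv_bijective a b (hW.trans hV)).1
    ext c
    rw [splitTriv_splitInv, splitTriv_res a b hV hW, splitTriv_splitInv]
  smul hV s u := by
    rw [conormalMap_smul]
    congr 1
    apply (splitTriv_bijective a b hV).1
    ext c
    rw [splitTriv_splitInv, splitTriv_smul, splitTriv_splitInv]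
  ker hV s := by
    rw [red_eq_zero_iff hι α hα]
    constructor
    · rintro ⟨e, he⟩
      exact ⟨splitTriv a b i hV e, by rw [splitInv_splitTriv, he]⟩
    · rintro ⟨u, hu⟩
      exact ⟨_, hu⟩

theorem ropeChart_j_splitTriv {i : Fin 2} {Q : (PSpace k 1).Opens} (hQ : Q ≤ chart k i)
    (e : Γ(splitBundle k a b, Q)) :
    (ropeChart hι α hα i).j hQ (splitTriv a b i hQ e) = conormalMap hι α Q e := by
  change conormalMap hι α _ (splitInv a b hQ _) = _
  rw [splitInv_splitTriv]

/-- The relation `huv` is the transition law of `𝒪(-a) ⊕ 𝒪(-b)`. It says that `u` and `v` are the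
components of one section of the bundle, hence of one function on the rope. -/
theorem ropeChart_j_eq {i l : Fin 2} {Q : (PSpace k 1).Opens} (hi : Q ≤ chart k i)
    (hl : Q ≤ chart k l) (u v : Fin 2 → Γ(PSpace k 1, Q))
    (huv : ∀ c, resFun hi (coordRatio k i l) ^ (![a, b] c).toNat * u c =
      resFun hi (coordRatio k i l) ^ (-![a, b] c).toNat * v c) :
    (ropeChart hι α hα i).j hi u = (ropeChart hι α hα l).j hl v := by
  obtain ⟨e, rfl⟩ := (splitTriv_bijective a b hl).2 v
  have h : u = splitTriv a b i hi e := by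
    ext c
    have h1 := splitTriv_rel a b hi hl e c
    rw [← huv c] at h1
    exact ((isUnit_ratio (𝟙 (PSpace k 1)) hi hl).pow _).mul_left_cancel h1.symm
  rw [h, ropeChart_j_splitTriv, ropeChart_j_splitTriv]

end splitRope

/-! ### Cohomology of line bundles on the projective line by Laurent polynomials -/

section laurent

open Polynomial LaurentPolynomial

variable {k : Type*} [Field k]

theorem coeff_T_mul (z : k[T;T⁻¹]) (m n : ℤ) : (T m * z).coeff n = z.coeff (n - m) := by
  rw [T, AddMonoidAlgebra.coeff_single_mul_apply, one_mul, neg_add_eq_sub]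

theorem coeff_toLaurent_natCast (p : k[X]) (n : ℕ) : (toLaurent p).coeff n = p.coeff n := by
  rw [LaurentPolynomial.coeff_toLaurent]
  exact Finsupp.mapDomain_apply Nat.cast_injective _ _

theorem coeff_toLaurent_zero (p : k[X]) : (toLaurent p).coeff 0 = p.coeff 0 :=
  coeff_toLaurent_natCast p 0

theorem coeff_toLaurent_of_neg (p : k[X]) {n : ℤ} (hn : n < 0) : (toLaurent p).coeff n = 0 := by
  rw [LaurentPolynomial.coeff_toLaurent]
  refine Finsupp.mapDomain_of_notMem_range _ _ ?_
  rintro ⟨m, rfl⟩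
  exact absurd hn (by simp)

/-- Every Laurent polynomial splits into its parts of degree `≥ 0` and `≤ e`, if `e ≥ -1`. -/
theorem exists_toLaurent_sub (e : ℤ) (he : -1 ≤ e) (z : k[T;T⁻¹]) :
    ∃ u v : k[X], toLaurent u - T e * invert (toLaurent v) = z := by
  induction z using LaurentPolynomial.induction_on' with
  | add p q hp hq =>
    obtain ⟨u, v, h⟩ := hp
    obtain ⟨u', v', h'⟩ := hq
    refine ⟨u + u', v + v', ?_⟩
    rw [map_add, map_add, map_add, ← h, ← h']
    ring
  | C_mul_T n a =>
    rcases le_or_gt 0 n with hn | hn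
    · refine ⟨Polynomial.C a * Polynomial.X ^ n.toNat, 0, ?_⟩
      rw [toLaurent_C_mul_X_pow, Int.toNat_of_nonneg hn]
      simp
    -- A monomial of negative degree `n` satisfies `n ≤ -1 ≤ e`, so `T ^ n = T ^ e * T ^ (-(e - n))`
    -- comes from the second chart. This is `H¹(ℙ¹, 𝒪(e)) = 0`.
    · refine ⟨0, Polynomial.C (-a) * Polynomial.X ^ (e - n).toNat, ?_⟩
      rw [toLaurent_C_mul_X_pow, Int.toNat_of_nonneg (by lia), map_mul, invert_C, invert_T,
        mul_left_comm, ← T_add, map_zero, zero_sub, map_neg, neg_mul, neg_neg]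
      congr 2
      ring

/-- The pair is a section of `𝒪(1)`: comparing exponents leaves only degrees `0` and `1`, and the
change of chart swaps the two coefficients. The constant terms on the two charts thus determine it.
-/
theorem eq_of_toLaurent_eq {U W : k[X]} (h : toLaurent U = T 1 * invert (toLaurent W)) :
    U = Polynomial.C (U.coeff 0) + Polynomial.C (W.coeff 0) * Polynomial.X ∧
      W = Polynomial.C (W.coeff 0) + Polynomial.C (U.coeff 0) * Polynomial.X := by
  have key (n : ℤ) : (toLaurent U).coeff n = (toLaurent W).coeff (1 - n) := by
    rw [h, coeff_T_mul, invert_apply, neg_sub]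
  have k0 := key 0
  have k1 := key 1
  rw [← Nat.cast_zero, coeff_toLaurent_natCast, Nat.cast_zero, sub_zero, ← Nat.cast_one,
    coeff_toLaurent_natCast] at k0
  rw [sub_self, ← Nat.cast_zero, coeff_toLaurent_natCast, ← Nat.cast_one,
    coeff_toLaurent_natCast] at k1
  constructor
  · ext n
    match n with
    | 0 => simp
    | 1 => simp [k1]
    | n + 2 =>
      have := key ((n + 2 : ℕ) : ℤ)
      rw [coeff_toLaurent_natCast, coeff_toLaurent_of_neg _ (by push_cast; lia)] at this
      simp [this]
  · ext n
    match n with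
    | 0 => simp
    | 1 => simp [k0]
    | n + 2 =>
      have := key (1 - (n + 2 : ℕ) : ℤ)
      rw [sub_sub_cancel, coeff_toLaurent_natCast, coeff_toLaurent_of_neg _ (by push_cast; lia)]
        at this
      simp [← this]

/-- For the twist `-1` the two parts have exponents `≥ 0` and `≤ -1`. They do not overlap, so both
constant terms can be read off from `z`. -/
theorem coeff_zero_of_toLaurent_sub {u v : k[X]} {z : k[T;T⁻¹]}
    (h : toLaurent u - T (-1) * invert (toLaurent v) = z) :
    u.coeff 0 = z.coeff 0 ∧ v.coeff 0 = -z.coeff (-1) := by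
  have h1 (n : ℤ) : z.coeff n = (toLaurent u).coeff n - (toLaurent v).coeff (-1 - n) := by
    rw [← h, AddMonoidAlgebra.coeff_sub, Finsupp.sub_apply, coeff_T_mul, invert_apply]
    congr 2
    ring
  constructor
  · rw [h1, coeff_toLaurent_of_neg v (by simp), coeff_toLaurent_zero, sub_zero]
  · rw [h1, coeff_toLaurent_of_neg u (by simp), sub_self, coeff_toLaurent_zero,
      zero_sub, neg_neg]

theorem exists_coeff_eq (e : ℕ → k) : ∃ z : k[T;T⁻¹], ∀ m ∈ Finset.Icc 1 4, z.coeff (-(m : ℕ)) = e m := by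
  refine ⟨∑ m ∈ Finset.Icc 1 4, LaurentPolynomial.C (e m) * T (-(m : ℕ)), fun m hm => ?_⟩
  rw [AddMonoidAlgebra.coeff_sum, Finsupp.finsetSum_apply, Finset.sum_eq_single m]
  · rw [mul_comm, coeff_T_mul, sub_self, C_apply, if_pos rfl]
  · intro n _ hn
    rw [mul_comm, coeff_T_mul, C_apply, if_neg]
    lia
  · exact fun h => absurd hm h

end laurent

/-! ### Square-zero extensions and algebras generated by ratios -/

section thickening

/-- A square-zero extension `B` of `R` with kernel `R ^ 2`. -/
structure Thickening (k R B : Type*) [CommRing k] [CommRing R] [CommRing B] [Algebra k R]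
    [Algebra k B] where
  p : B →ₐ[k] R
  j : (Fin 2 → R) →+ B
  inj : Function.Injective j
  mul_j : ∀ x u, x * j u = j (p x • u)
  ker : ∀ x, p x = 0 ↔ ∃ u, j u = x

namespace Thickening

variable {k R B : Type*} [Field k] [CommRing R] [CommRing B] [Algebra k R] [Algebra k B]
  (t : Thickening k R B)

theorem p_j (u : Fin 2 → R) : t.p (t.j u) = 0 := (t.ker _).2 ⟨u, rfl⟩

theorem j_mul_j (u v : Fin 2 → R) : t.j u * t.j v = 0 := by
  rw [t.mul_j, t.p_j, zero_smul, map_zero]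

theorem isUnit_one_add (u : Fin 2 → R) : IsUnit (1 + t.j u) :=
  IsUnit.of_mul_eq_one (1 - t.j u) (by linear_combination -t.j_mul_j u u)

theorem one_add_pow (u : Fin 2 → R) (n : ℕ) : (1 + t.j u) ^ n = 1 + n * t.j u := by
  induction n with
  | zero => simp
  | succ n ih =>
    rw [pow_succ, ih]
    push_cast
    linear_combination n * t.j_mul_j u u

theorem exists_eq_add {x y : B} (h : t.p x = t.p y) : ∃ u, x = y + t.j u := by
  obtain ⟨u, hu⟩ := (t.ker (x - y)).1 (by rw [map_sub, h, sub_self])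
  exact ⟨u, by rw [hu]; ring⟩

theorem isUnit_of_p_eq_one {x : B} (h : t.p x = 1) : IsUnit x := by
  obtain ⟨u, rfl⟩ := t.exists_eq_add (h.trans (map_one t.p).symm)
  exact t.isUnit_one_add u

open Polynomial

section polynomial

variable {B : Type*} [CommRing B] [Algebra k B] (t : Thickening k k[X] B) (G : Set B) (w : B)

/-- The subalgebra generated by the ratios `x / w` for `x ∈ G`. -/
def ratios : Subalgebra k B := Algebra.adjoin k {y | y * w ∈ G}

/-- The part of the kernel of `B → k[X]` in the subalgebra generated by the ratios `x / w`. -/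
def kerRatios {f : B} (hw : t.p w = 1) (hf : f ∈ G) (hpf : t.p f = X) :
    Submodule k[X] (Fin 2 → k[X]) where
  carrier := {u | t.j u ∈ ratios (k := k) G w}
  zero_mem' := by
    change t.j 0 ∈ ratios (k := k) G w
    rw [map_zero]
    exact zero_mem _
  add_mem' {u v} hu hv := by
    change t.j (u + v) ∈ ratios (k := k) G w
    rw [map_add]
    exact add_mem hu hv
  smul_mem' q u hu := by
    obtain ⟨w', hw'⟩ := (t.isUnit_of_p_eq_one hw).exists_right_inv
    -- The ratio `f / w` maps to `X`. Multiplying a kernel element by a polynomial `q` is therefore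
    -- multiplying it by `q(f / w)`, which stays in the algebra.
    have h1 : f * w' ∈ ratios (k := k) G w :=
      Algebra.subset_adjoin (show f * w' * w ∈ G by rwa [mul_assoc, mul_comm w', hw', mul_one])
    have h2 : t.p w' = 1 := by
      have := congrArg t.p hw'
      rwa [map_mul, hw, map_one, one_mul] at this
    have h3 : aeval (f * w') q ∈ ratios (k := k) G w := by
      refine (Algebra.adjoin_le (S := ratios (k := k) G w) ?_) (aeval_mem_adjoin_singleton k (f * w'))
      rintro _ rfl
      exact h1
    have h4 : t.p (aeval (f * w') q) = q := by
      rw [← aeval_algHom_apply, map_mul, hpf, h2, mul_one, aeval_X_left_apply]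
    have h5 := mul_mem h3 hu
    rw [t.mul_j, h4] at h5
    exact h5

variable {G w} {f : B} (hw : t.p w = 1) (hf : f ∈ G) (hpf : t.p f = X)

theorem mem_kerRatios {u : Fin 2 → k[X]} (hu : t.j u ∈ G) : u ∈ t.kerRatios G w hw hf hpf := by
  refine Algebra.subset_adjoin (show t.j u * w ∈ G from ?_)
  rwa [mul_comm, t.mul_j, hw, one_smul]

/-- Write `f / w = τ + d` with `d` in the kernel. In the second difference of ratios with multiplier
`f / w`, the powers of `τ` contribute `τ ^ (n+2) - 2 (τ + d) τ ^ (n+1) + (τ + d) ^ 2 τ ^ n = d ^ 2 τ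
^ n = 0`. The unknown `d` drops out, which a first difference would not achieve, and only the `u`
terms remain. -/
theorem second_difference_mem_kerRatios {τ : B} (hτ : t.p τ = X) {n : ℕ} {u₀ u₁ u₂ : Fin 2 → k[X]}
    (h₀ : τ ^ n + t.j u₀ ∈ G) (h₁ : τ ^ (n + 1) + t.j u₁ ∈ G) (h₂ : τ ^ (n + 2) + t.j u₂ ∈ G) :
    u₂ - 2 • (X : k[X]) • u₁ + (X : k[X]) ^ 2 • u₀ ∈ t.kerRatios G w hw hf hpf := by
  obtain ⟨w', hw'⟩ := (t.isUnit_of_p_eq_one hw).exists_right_inv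
  have h2 : t.p w' = 1 := by
    have := congrArg t.p hw'
    rwa [map_mul, hw, map_one, one_mul] at this
  have hmem {g : B} (hg : g ∈ G) : g * w' ∈ ratios (k := k) G w :=
    Algebra.subset_adjoin (show g * w' * w ∈ G by rwa [mul_assoc, mul_comm w', hw', mul_one])
  obtain ⟨d, hd⟩ := t.exists_eq_add (x := f * w') (y := τ) (by rw [map_mul, hpf, h2, hτ, mul_one])
  have key : t.j (u₂ - 2 • (X : k[X]) • u₁ + (X : k[X]) ^ 2 • u₀) =
      (τ ^ (n + 2) + t.j u₂) * w' - 2 * (f * w') * ((τ ^ (n + 1) + t.j u₁) * w') +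
        (f * w') ^ 2 * ((τ ^ n + t.j u₀) * w') := by
    have e (u) : w' * t.j u = t.j u := by rw [t.mul_j, h2, one_smul]
    rw [map_add, map_sub, map_nsmul, ← hτ, ← map_pow, ← t.mul_j, ← t.mul_j, hd]
    have e1 := t.j_mul_j d u₁
    have e2 := t.j_mul_j d u₀
    have e3 := t.j_mul_j d d
    have e4 := e u₀
    have e5 := e u₁
    have e6 := e u₂
    simp only [nsmul_eq_mul, Nat.cast_ofNat]
    linear_combination (-1) * e6 + 2 * τ * e5 - τ ^ 2 * e4 + 2 * w' * e1
      - 2 * τ * w' * e2 - w' * (τ ^ n + t.j u₀) * e3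
  change t.j _ ∈ ratios (k := k) G w
  rw [key]
  refine add_mem (sub_mem (hmem h₂) ?_) ?_
  · rw [mul_assoc]
    exact (two_mul (f * w' * _)) ▸ add_mem (mul_mem (hmem hf) (hmem h₁)) (mul_mem (hmem hf) (hmem h₁))
  · exact mul_mem (pow_mem (hmem hf) 2) (hmem h₀)

end polynomial

end Thickening

end thickening

/-! ### Generating a free module of rank two by three vectors of linear forms -/

section gluing

open Polynomial LaurentPolynomial

variable {k : Type*} [Field k]

/-- These are the conditions under which the three second differences generate the kernel on both
charts; the last one is a determinant. -/
theorem exists_avoiding [Infinite k] (p₁ p₂ q₁ q₂ : k) :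
    ∃ x : k, x ≠ 0 ∧ x + p₁ ≠ 0 ∧ x + q₂ ≠ 0 ∧ (x + p₁) * (x + q₂) - p₂ * q₁ ≠ 0 := by
  by_contra! h
  let P : k[X] := Polynomial.X * (Polynomial.X + Polynomial.C p₁) *
    (Polynomial.X + Polynomial.C q₂) * ((Polynomial.X + Polynomial.C p₁) *
      (Polynomial.X + Polynomial.C q₂) - Polynomial.C (p₂ * q₁))
  have hP : P = 0 := by
    refine Polynomial.funext fun x => ?_
    simp only [P, eval_mul, eval_add, eval_sub, eval_X, Polynomial.eval_C, eval_zero]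
    by_contra! h0
    have h1 := left_ne_zero_of_mul h0
    have h2 := left_ne_zero_of_mul h1
    exact right_ne_zero_of_mul h0 (h x (left_ne_zero_of_mul h2) (right_ne_zero_of_mul h2)
      (right_ne_zero_of_mul h1))
  refine mul_ne_zero (mul_ne_zero (mul_ne_zero X_ne_zero (X_add_C_ne_zero _)) (X_add_C_ne_zero _))
    (fun h2 => ?_) hP
  have h3 : ((Polynomial.X + Polynomial.C p₁) * (Polynomial.X + Polynomial.C q₂) -
      Polynomial.C (p₂ * q₁)).natDegree = 2 := by compute_degree!
  rw [h2] at h3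
  simp at h3

theorem eq_top_of_single_mem {R : Type*} [CommRing R] {K : Submodule R (Fin 2 → R)}
    (h₀ : ![1, 0] ∈ K) (h₁ : ![0, 1] ∈ K) : K = ⊤ := by
  refine eq_top_iff.2 fun u _ => ?_
  have : u = u 0 • ![1, 0] + u 1 • ![0, 1] := by
    ext c
    fin_cases c <;> simp
  rw [this]
  exact add_mem (K.smul_mem _ h₀) (K.smul_mem _ h₁)

section generators

variable {K : Submodule k[X] (Fin 2 → k[X])} {bad : Fin 2 → Prop} (hbad : bad 1 → bad 0)
  (hK₀ : ¬ bad 0 → ![1, 0] ∈ K) (hK₁ : ¬ bad 1 → ![0, 1] ∈ K) {x p₁ p₂ q₁ q₂ : k}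
include hbad hK₀ hK₁

/-- The components marked `bad` are those where the twisted bundle is `𝒪(-1)`; the others have their
unit vector in `K` already. If both are bad, `U 0` gives the first unit vector, `U 2` then gives
`(0, X)`, and `U 1` modulo these is `(0, x)`. If only the first is bad, `U 0` suffices. -/
theorem eq_top_of_left {U : Fin 3 → Fin 2 → k[X]} (hU : ∀ n, U n ∈ K)
    (h0 : ∀ c, bad c → U 0 c = Polynomial.C (![x, 0] c))
    (h1 : ∀ c, bad c → U 1 c = Polynomial.C (![0, x] c) -
      Polynomial.C (![x + p₁, p₂] c) * Polynomial.X)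
    (h2 : ∀ c, bad c → U 2 c = -Polynomial.C (![q₁, x + q₂] c) * Polynomial.X)
    (hx : x ≠ 0) (hq : x + q₂ ≠ 0) : K = ⊤ := by
  by_cases b1 : bad 1
  · have b0 := hbad b1
    have e0 : U 0 = ![Polynomial.C x, 0] := by
      ext1 c; fin_cases c <;> simp [h0 _ b0, h0 _ b1]
    have e1 : U 1 = ![-Polynomial.C (x + p₁) * Polynomial.X,
        Polynomial.C x - Polynomial.C p₂ * Polynomial.X] := by
      ext1 c; fin_cases c <;> simp [h1 _ b0, h1 _ b1]; ring
    have e2 : U 2 = ![-Polynomial.C q₁ * Polynomial.X, -Polynomial.C (x + q₂) * Polynomial.X] := by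
      ext1 c; fin_cases c <;> simp [h2 _ b0, h2 _ b1]
    have hC {y : k} (hy : y ≠ 0) : Polynomial.C y⁻¹ * Polynomial.C y = 1 := by
      rw [← map_mul, inv_mul_cancel₀ hy, map_one]
    have m0 : ![1, 0] ∈ K := by
      have := K.smul_mem (Polynomial.C x⁻¹) (hU 0)
      rw [e0] at this
      simpa [hC hx] using this
    have m2 : ![0, Polynomial.X] ∈ K := by
      have := K.smul_mem (-Polynomial.C (x + q₂)⁻¹) (sub_mem (hU 2)
        (K.smul_mem (-Polynomial.C q₁ * Polynomial.X) m0))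
      rw [e2] at this
      convert this using 1
      ext1 c
      fin_cases c
      · simp
      · have := hC hq
        simp only [map_add] at this
        simp
        linear_combination (-Polynomial.X) * this
    refine eq_top_of_single_mem m0 ?_
    have := K.smul_mem (Polynomial.C x⁻¹) (add_mem (sub_mem (hU 1)
        (K.smul_mem (-Polynomial.C (x + p₁) * Polynomial.X) m0)) (K.smul_mem (Polynomial.C p₂) m2))
    rw [e1] at this
    convert this using 1
    ext1 c
    fin_cases c
    · simp
    · simp [hC hx]
  · by_cases b0 : bad 0
    · refine eq_top_of_single_mem ?_ (hK₁ b1)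
      obtain ⟨y, hy⟩ : ∃ y, U 0 = ![Polynomial.C x, y] :=
        ⟨U 0 1, by ext1 c; fin_cases c <;> simp [h0 _ b0]⟩
      have := K.smul_mem (Polynomial.C x⁻¹) (sub_mem (hU 0) (K.smul_mem y (hK₁ b1)))
      rw [hy] at this
      convert this using 1
      ext1 c
      fin_cases c
      · simp [← map_mul, hx]
      · simp
    · exact eq_top_of_single_mem (hK₀ b0) (hK₁ b1)

/-- The same linear forms seen from the other chart. If both components are bad, `W 0` and `X • W 2`
give `(X, 0)` and `(0, X)`. Modulo these, `W 1` and `W 2` are, up to sign, the constant vectors `(x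
+ p₁, p₂)` and `(q₁, x + q₂)`, whose determinant is nonzero. If only the first is bad, `W 1`
suffices. -/
theorem eq_top_of_right {W : Fin 3 → Fin 2 → k[X]} (hW : ∀ n, W n ∈ K)
    (h0 : ∀ c, bad c → W 0 c = Polynomial.C (![x, 0] c) * Polynomial.X)
    (h1 : ∀ c, bad c → W 1 c = -Polynomial.C (![x + p₁, p₂] c) +
      Polynomial.C (![0, x] c) * Polynomial.X)
    (h2 : ∀ c, bad c → W 2 c = -Polynomial.C (![q₁, x + q₂] c))
    (hx : x ≠ 0) (hp : x + p₁ ≠ 0) (hq : x + q₂ ≠ 0)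
    (hpq : (x + p₁) * (x + q₂) - p₂ * q₁ ≠ 0) : K = ⊤ := by
  by_cases b1 : bad 1
  · have b0 := hbad b1
    have e0 : W 0 = ![Polynomial.C x * Polynomial.X, 0] := by
      ext1 c; fin_cases c <;> simp [h0 _ b0, h0 _ b1]
    have e1 : W 1 = ![-Polynomial.C (x + p₁),
        -Polynomial.C p₂ + Polynomial.C x * Polynomial.X] := by
      ext1 c; fin_cases c <;> simp [h1 _ b0, h1 _ b1]
    have e2 : W 2 = ![-Polynomial.C q₁, -Polynomial.C (x + q₂)] := by
      ext1 c; fin_cases c <;> simp [h2 _ b0, h2 _ b1]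
    have hC {y : k} (hy : y ≠ 0) : Polynomial.C y⁻¹ * Polynomial.C y = 1 := by
      rw [← map_mul, inv_mul_cancel₀ hy, map_one]
    have m0 : ![Polynomial.X, 0] ∈ K := by
      have := K.smul_mem (Polynomial.C x⁻¹) (hW 0)
      rw [e0] at this
      simpa [← mul_assoc, hC hx] using this
    have m1 : ![0, Polynomial.X] ∈ K := by
      have := K.smul_mem (-Polynomial.C (x + q₂)⁻¹) (add_mem (K.smul_mem Polynomial.X (hW 2))
        (K.smul_mem (Polynomial.C q₁) m0))
      rw [e2] at this
      convert this using 1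
      ext1 c
      fin_cases c
      · simp
      · have := hC hq
        simp only [map_add] at this
        simp
        linear_combination (-Polynomial.X) * this
    have m2 : ![Polynomial.C (x + p₁), Polynomial.C p₂] ∈ K := by
      have := sub_mem (K.smul_mem (Polynomial.C x) m1) (hW 1)
      rw [e1] at this
      convert this using 1
      ext1 c
      fin_cases c <;> simp
    have m3 : ![Polynomial.C q₁, Polynomial.C (x + q₂)] ∈ K := by
      have := neg_mem (hW 2)
      rw [e2] at this
      convert this using 1
      ext1 c
      fin_cases c <;> simp
    have hdet := hC hpq
    simp only [map_sub, map_mul, map_add] at hdet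
    refine eq_top_of_single_mem ?_ ?_
    · have := K.smul_mem (Polynomial.C ((x + p₁) * (x + q₂) - p₂ * q₁)⁻¹) (sub_mem
        (K.smul_mem (Polynomial.C (x + q₂)) m2) (K.smul_mem (Polynomial.C p₂) m3))
      convert this using 1
      ext1 c
      fin_cases c
      · simp
        linear_combination -hdet
      · simp
        right
        ring
    · have := K.smul_mem (Polynomial.C ((x + p₁) * (x + q₂) - p₂ * q₁)⁻¹) (sub_mem
        (K.smul_mem (Polynomial.C (x + p₁)) m3) (K.smul_mem (Polynomial.C q₁) m2))
      convert this using 1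
      ext1 c
      fin_cases c
      · simp
        right
        ring
      · simp
        linear_combination -hdet
  · by_cases b0 : bad 0
    · refine eq_top_of_single_mem ?_ (hK₁ b1)
      obtain ⟨y, hy⟩ : ∃ y, W 1 = ![-Polynomial.C (x + p₁), y] :=
        ⟨W 1 1, by ext1 c; fin_cases c <;> simp [h1 _ b0]⟩
      have := K.smul_mem (-Polynomial.C (x + p₁)⁻¹) (sub_mem (hW 1) (K.smul_mem y (hK₁ b1)))
      rw [hy] at this
      convert this using 1
      ext1 c
      fin_cases c
      · have h3 : Polynomial.C (x + p₁)⁻¹ * Polynomial.C (x + p₁) = 1 := by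
          rw [← map_mul, inv_mul_cancel₀ hp, map_one]
        simp only [map_add] at h3
        simp
        linear_combination -h3
      · simp
    · exact eq_top_of_single_mem (hK₀ b0) (hK₁ b1)

end generators

end gluing

/-! ### Line bundles on a rope and lifts of monomials -/

section gluingData

open Polynomial LaurentPolynomial

/-- Regular functions on the charts of a rope on `ℙ¹` and on their intersection. -/
structure GluingData (k : Type*) [Field k] (w : Fin 2 → ℤ) (A₀ A₁ A : Type*) [CommRing A₀]
    [CommRing A₁] [CommRing A] [Algebra k A₀] [Algebra k A₁] [Algebra k A] where
  t₀ : Thickening k k[X] A₀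
  t₁ : Thickening k k[X] A₁
  t : Thickening k k[T;T⁻¹] A
  surj₀ : Function.Surjective t₀.p
  surj₁ : Function.Surjective t₁.p
  r₀ : A₀ →ₐ[k] A
  r₁ : A₁ →ₐ[k] A
  p_r₀ : ∀ x, t.p (r₀ x) = toLaurent (t₀.p x)
  p_r₁ : ∀ x, t.p (r₁ x) = invert (toLaurent (t₁.p x))
  r_j₀ : ∀ u, r₀ (t₀.j u) = t.j (fun c => toLaurent (u c))
  r_j₁ : ∀ u, r₁ (t₁.j u) = t.j (fun c => T (-w c) * invert (toLaurent (u c)))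

namespace GluingData

variable {k : Type*} [Field k] {w : Fin 2 → ℤ} {A₀ A₁ A : Type*} [CommRing A₀]
  [CommRing A₁] [CommRing A] [Algebra k A₀] [Algebra k A₁] [Algebra k A]
  (D : GluingData k w A₀ A₁ A)

/-- The global sections of the line bundle on the rope with transition function `g`. -/
def sections (g : A) : Submodule k (A₀ × A₁) where
  carrier := {f | D.r₀ f.1 = g * D.r₁ f.2}
  zero_mem' := by simp
  add_mem' {x y} hx hy := by
    change D.r₀ (x.1 + y.1) = g * D.r₁ (x.2 + y.2)
    change D.r₀ x.1 = g * D.r₁ x.2 at hx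
    change D.r₀ y.1 = g * D.r₁ y.2 at hy
    rw [map_add, map_add, hx, hy, mul_add]
  smul_mem' c x hx := by
    change D.r₀ (c • x.1) = g * D.r₁ (c • x.2)
    change D.r₀ x.1 = g * D.r₁ x.2 at hx
    rw [map_smul, map_smul, hx, mul_smul_comm]

theorem mem_sections {g : A} {f : A₀ × A₁} : f ∈ D.sections g ↔ D.r₀ f.1 = g * D.r₁ f.2 := Iff.rfl

theorem p_eq {g : A} {N : ℕ} (hg : D.t.p g = T N) {f : A₀ × A₁} (hf : f ∈ D.sections g) :
    toLaurent (D.t₀.p f.1) = T N * invert (toLaurent (D.t₁.p f.2)) := by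
  rw [← D.p_r₀, ← D.p_r₁, ← hg, ← map_mul, hf]

theorem j_mem_sections {g : A} {N : ℕ} (hg : D.t.p g = T N) {u v : Fin 2 → k[X]} :
    (D.t₀.j u, D.t₁.j v) ∈ D.sections g ↔
      ∀ c, toLaurent (u c) = T (N - w c) * invert (toLaurent (v c)) := by
  rw [mem_sections, D.r_j₀, D.r_j₁, D.t.mul_j, hg, D.t.inj.eq_iff, funext_iff]
  simp only [Pi.smul_apply, smul_eq_mul, ← mul_assoc, ← T_add, sub_eq_add_neg]

/-- The data from which a line bundle of degree `N` on a rope is constructed: lifts `τ` and `σ` of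
the coordinates, with `τ σ = 1 + η`, and an element `ε` of the kernel. -/
structure TwistData where
  τ : A₀
  σ : A₁
  hτ : D.t₀.p τ = X
  hσ : D.t₁.p σ = X
  η : Fin 2 → k[T;T⁻¹]
  hη : D.r₀ τ * D.r₁ σ = 1 + D.t.j η
  ε : Fin 2 → k[T;T⁻¹]

theorem exists_twistData (e : (Fin 2 → k[T;T⁻¹]) → (Fin 2 → k[T;T⁻¹])) :
    ∃ E : D.TwistData, E.ε = e E.η := by
  obtain ⟨τ, hτ⟩ := D.surj₀ X
  obtain ⟨σ, hσ⟩ := D.surj₁ X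
  obtain ⟨η, hη⟩ := D.t.exists_eq_add (x := D.r₀ τ * D.r₁ σ) (y := 1) (by
    rw [map_mul, D.p_r₀, D.p_r₁, hτ, hσ, toLaurent_X, invert_T, ← T_add]
    simp)
  exact ⟨⟨τ, σ, hτ, hσ, η, hη, e η⟩, rfl⟩

namespace TwistData

variable {D} (E : D.TwistData) (N : ℕ)

/-- The transition function. -/
def g : A := D.r₀ E.τ ^ N * (1 + D.t.j E.ε)

theorem isUnit_g : IsUnit (E.g N) := by
  have h := D.t.isUnit_one_add E.η
  rw [← E.hη] at h
  exact ((isUnit_of_mul_isUnit_left h).pow N).mul (D.t.isUnit_one_add E.ε)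

theorem p_τ : D.t.p (D.r₀ E.τ) = T 1 := by rw [D.p_r₀, E.hτ, toLaurent_X]

theorem p_g : D.t.p (E.g N) = T N := by
  rw [g, map_mul, map_add, map_one, D.t.p_j, add_zero, mul_one, map_pow, E.p_τ, T_pow, mul_one]

/-- The obstruction to gluing `τ ^ m` and `σ ^ (N - m)`. -/
def θ (m : ℕ) (c : Fin 2) : k[T;T⁻¹] := E.ε c + ((N : k) - m) • E.η c

variable {N}

/-- Put `q = N - m`. From `τ σ = 1 + η` one gets `τ ^ q σ ^ q = 1 + q η`, so `σ ^ q` times the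
transition function is `τ ^ m (1 + ε + q η)`. The kernel part of the gluing condition is therefore
`T ^ m θ`. -/
theorem mem_sections {m : ℕ} (hm : m ≤ N) {u v : Fin 2 → k[X]}
    (h : ∀ c, toLaurent (u c) - T (N - w c) * invert (toLaurent (v c)) = T m * E.θ N m c) :
    (E.τ ^ m + D.t₀.j u, E.σ ^ (N - m) + D.t₁.j v) ∈ D.sections (E.g N) := by
  obtain ⟨q, rfl⟩ := Nat.exists_eq_add_of_le hm
  rw [GluingData.mem_sections, g, add_tsub_cancel_left]
  simp only [map_add, map_pow, D.r_j₀, D.r_j₁]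
  have h1 : D.r₀ E.τ ^ q * D.r₁ E.σ ^ q = 1 + D.t.j (fun c => (q : k) • E.η c) := by
    rw [← mul_pow, E.hη, D.t.one_add_pow]
    congr 1
    rw [D.t.mul_j, map_natCast]
    congr 1
    ext1 c
    simp [Algebra.smul_def]
  set z : Fin 2 → k[T;T⁻¹] := fun c => T (-w c) * invert (toLaurent (v c)) with hz
  have h2 : D.t.j (fun c => toLaurent (u c)) =
      D.r₀ E.τ ^ m * D.t.j (fun c => (q : k) • E.η c) + D.r₀ E.τ ^ m * D.t.j E.ε +
        D.r₀ E.τ ^ (m + q) * D.t.j z := by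
    simp only [D.t.mul_j, ← map_add, map_pow, E.p_τ, T_pow, mul_one]
    congr 1
    ext1 c
    have := h c
    rw [sub_eq_iff_eq_add] at this
    rw [this]
    simp only [Pi.add_apply, Pi.smul_apply, hz, θ, smul_eq_mul, ← mul_assoc, ← T_add, sub_eq_add_neg]
    push_cast
    rw [add_neg_cancel_comm, mul_add]
    ring
  rw [h2, pow_add]
  have h3 := D.t.j_mul_j E.ε z
  have h4 := D.t.j_mul_j E.ε (fun c => (q : k) • E.η c)
  linear_combination (-D.r₀ E.τ ^ m * (1 + D.t.j E.ε)) * h1 - D.r₀ E.τ ^ m * h4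
    - D.r₀ E.τ ^ m * D.r₀ E.τ ^ q * h3

variable (N)

/-- The bound on the weights says `N - w c ≥ -1`, which is exactly the range where `H¹(𝒪(N - w c))`
vanishes. -/
theorem exists_lift (hw : ∀ c, w c ≤ N + 1) (m : ℕ) : ∃ u v : Fin 2 → k[X], ∀ c,
    toLaurent (u c) - T (N - w c) * invert (toLaurent (v c)) = T m * E.θ N m c := by
  choose u v h using fun c => exists_toLaurent_sub (N - w c) (by linarith [hw c])
    (T m * E.θ N m c)
  exact ⟨u, v, h⟩

variable {N}

/-- The obstruction `θ` is affine in `m`, so its second difference vanishes and the second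
differences of `u` and `v` satisfy the gluing relation of `𝒪(1)`. Such a pair is fixed by its
constant terms. Only `u (n + 2)` and `v n` contribute to these, and for the twist `-1` their
constant terms are coefficients of the obstructions. -/
theorem second_difference {u v : ℕ → Fin 2 → k[X]} (h : ∀ m c,
      toLaurent (u m c) - T (N - w c) * invert (toLaurent (v m c)) = T m * E.θ N m c)
    {c : Fin 2} (hc : w c = N + 1) (n : ℕ) :
    (u (n + 2) - 2 • (X : k[X]) • u (n + 1) + (X : k[X]) ^ 2 • u n) c =
        Polynomial.C ((E.θ N (n + 2) c).coeff (-(n + 2 : ℕ))) -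
          Polynomial.C ((E.θ N n c).coeff (-(n + 1 : ℕ))) * X ∧
      (v n - 2 • (X : k[X]) • v (n + 1) + (X : k[X]) ^ 2 • v (n + 2)) c =
        -Polynomial.C ((E.θ N n c).coeff (-(n + 1 : ℕ))) +
          Polynomial.C ((E.θ N (n + 2) c).coeff (-(n + 2 : ℕ))) * X := by
  have he : (N : ℤ) - w c = -1 := by rw [hc]; ring
  simp only [nsmul_eq_mul, Nat.cast_ofNat, Pi.add_apply, Pi.sub_apply, Pi.smul_apply,
    Pi.mul_apply, Pi.ofNat_apply, smul_eq_mul]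
  have h0 := h n c
  have h1 := h (n + 1) c
  have h2 := h (n + 2) c
  rw [he] at h0 h1 h2
  have hU : (u (n + 2) c - 2 * (X * u (n + 1) c) + X ^ 2 * u n c).coeff 0 =
      (E.θ N (n + 2) c).coeff (-(n + 2 : ℕ)) := by
    have := (coeff_zero_of_toLaurent_sub h2).1
    rw [coeff_T_mul, zero_sub] at this
    rw [← this]
    simp [Polynomial.mul_coeff_zero]
  have hV : (v n c - 2 * (X * v (n + 1) c) + X ^ 2 * v (n + 2) c).coeff 0 =
      -(E.θ N n c).coeff (-(n + 1 : ℕ)) := by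
    have := (coeff_zero_of_toLaurent_sub h0).2
    rw [coeff_T_mul, show (-1 : ℤ) - n = -(n + 1 : ℕ) by push_cast; ring] at this
    rw [← this]
    simp [Polynomial.mul_coeff_zero]
  have key : toLaurent (u (n + 2) c - 2 * (X * u (n + 1) c) + X ^ 2 * u n c) =
      T 1 * invert (toLaurent (v n c - 2 * (X * v (n + 1) c) + X ^ 2 * v (n + 2) c)) := by
    have e1 : (T 1 : k[T;T⁻¹]) * T (-1) = 1 := by rw [← T_add]; simp
    have e2 (n : ℕ) : (T (n : ℤ) : k[T;T⁻¹]) = T 1 ^ n := by rw [T_pow, mul_one]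
    have e3 : E.θ N (n + 2) c - 2 * E.θ N (n + 1) c + E.θ N n c = 0 := by
      simp only [θ, Algebra.smul_def, map_sub, map_natCast]
      push_cast
      ring
    rw [e2] at h0 h1 h2
    simp only [map_add, map_sub, map_mul, map_pow, toLaurent_X, invert_T, map_ofNat] at *
    generalize invert (toLaurent (v n c)) = v0 at *
    generalize invert (toLaurent (v (n + 1) c)) = v1 at *
    generalize invert (toLaurent (v (n + 2) c)) = v2 at *
    generalize (T 1 : k[T;T⁻¹]) = x at *
    generalize (T (-1) : k[T;T⁻¹]) = y at *
    linear_combination h2 - 2 * x * h1 + x ^ 2 * h0 + x ^ (n + 2) * e3 +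
      (x * v0 - y * v2) * e1
  have := eq_of_toLaurent_eq key
  rw [hU, hV] at this
  refine ⟨this.1.trans ?_, this.2.trans ?_⟩
  · rw [Polynomial.C_neg]
    ring
  · rw [Polynomial.C_neg]

end TwistData

end GluingData

end gluingData

/-! ### A line bundle whose ratios generate the conormal sheaf -/

section existsTwist

open Polynomial LaurentPolynomial

namespace GluingData

variable {k : Type*} [Field k] {w : Fin 2 → ℤ} {A₀ A₁ A : Type*} [CommRing A₀]
  [CommRing A₁] [CommRing A] [Algebra k A₀] [Algebra k A₁] [Algebra k A]
  (D : GluingData k w A₀ A₁ A)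

/-- The second differences for `n = 0, 1, 2` involve only the coefficients of `T ^ (-1), …, T ^
(-4)`. At `T ^ (-2)` and `T ^ (-3)` two successive obstructions occur, and they differ by the
coefficient of `η`; this produces `p₁, p₂` and `q₁, q₂`, which `ε` cannot influence. -/
theorem exists_general_twistData [Infinite k] (N : ℕ) :
    ∃ (E : D.TwistData) (x p₁ p₂ q₁ q₂ : k), x ≠ 0 ∧ x + p₁ ≠ 0 ∧ x + q₂ ≠ 0 ∧
      (x + p₁) * (x + q₂) - p₂ * q₁ ≠ 0 ∧ ∀ c,
      (E.θ N 0 c).coeff (-(1 : ℕ)) = 0 ∧ (E.θ N 2 c).coeff (-(2 : ℕ)) = ![x, 0] c ∧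
      (E.θ N 1 c).coeff (-(2 : ℕ)) = ![x + p₁, p₂] c ∧
      (E.θ N 3 c).coeff (-(3 : ℕ)) = ![0, x] c ∧
      (E.θ N 2 c).coeff (-(3 : ℕ)) = ![q₁, x + q₂] c ∧
      (E.θ N 4 c).coeff (-(4 : ℕ)) = 0 := by
  -- The vector `![0, 2, 3, 4]` lists the `m` for which the coefficient of `θ N m` at `T ^ (-1), …,
  -- T ^ (-4)` is prescribed, with values `0`, `(x, 0)`, `(0, x)` and `0`. Subtracting the
  -- contribution of `η` gives the coefficient of `ε`.
  have hex (η : Fin 2 → k[T;T⁻¹]) : ∃ (ε : Fin 2 → k[T;T⁻¹]) (x : k),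
      x ≠ 0 ∧ x + (η 0).coeff (-(2 : ℕ)) ≠ 0 ∧ x + (η 1).coeff (-(3 : ℕ)) ≠ 0 ∧
      (x + (η 0).coeff (-(2 : ℕ))) * (x + (η 1).coeff (-(3 : ℕ))) -
        (η 1).coeff (-(2 : ℕ)) * (η 0).coeff (-(3 : ℕ)) ≠ 0 ∧
      ∀ c, ∀ m ∈ Finset.Icc 1 4, (ε c).coeff (-(m : ℕ)) =
        (![0, ![x, 0] c, ![0, x] c, 0] : Fin 4 → k) (Fin.ofNat 4 (m - 1)) -
          ((N : k) - ![0, 2, 3, 4] (Fin.ofNat 4 (m - 1))) * (η c).coeff (-(m : ℕ)) := by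
    obtain ⟨x, h1, h2, h3, h4⟩ := exists_avoiding ((η 0).coeff (-(2 : ℕ)))
      ((η 1).coeff (-(2 : ℕ))) ((η 0).coeff (-(3 : ℕ))) ((η 1).coeff (-(3 : ℕ)))
    choose ε hε using fun c : Fin 2 => exists_coeff_eq (fun m =>
      (![0, ![x, 0] c, ![0, x] c, 0] : Fin 4 → k) (Fin.ofNat 4 (m - 1)) -
          ((N : k) - ![0, 2, 3, 4] (Fin.ofNat 4 (m - 1))) * (η c).coeff (-(m : ℕ)))
    exact ⟨ε, x, h1, h2, h3, h4, hε⟩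
  choose ε x h1 h2 h3 h4 hε using hex
  obtain ⟨E, hE⟩ := D.exists_twistData ε
  refine ⟨E, x E.η, _, _, _, _, h1 E.η, h2 E.η, h3 E.η, h4 E.η, fun c => ?_⟩
  have hθ (m n : ℕ) : (E.θ N m c).coeff (-(n : ℕ)) =
      (ε E.η c).coeff (-(n : ℕ)) + ((N : k) - m) * (E.η c).coeff (-(n : ℕ)) := by
    rw [TwistData.θ, hE, AddMonoidAlgebra.coeff_add, AddMonoidAlgebra.coeff_smul]
    rfl
  simp only [hθ]
  have e1 := hε E.η c 1 (by simp)
  have e2 := hε E.η c 2 (by simp)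
  have e3 := hε E.η c 3 (by simp)
  have e4 := hε E.η c 4 (by simp)
  rw [e1, e2, e3, e4]
  refine ⟨?_, ?_, ?_, ?_, ?_, ?_⟩ <;> fin_cases c <;> simp [Fin.ofNat] <;> ring

variable {D} in
-- The degree `N - w d` is nonnegative, so `𝒪(N - w d)` has a section equal to `1` on the first
-- chart and a section equal to `1` on the second.
theorem single_mem_sections {g : A} {N : ℕ} (hg : D.t.p g = T N) (d : Fin 2) (hd : ¬ w d = N + 1)
    (hw : w d ≤ N + 1) : ∃ v : k[X], (D.t₀.j (Pi.single d 1), D.t₁.j (Pi.single d v)) ∈ D.sections g ∧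
      (D.t₀.j (Pi.single d v), D.t₁.j (Pi.single d 1)) ∈ D.sections g := by
  have h : ((N - w d).toNat : ℤ) = N - w d := Int.toNat_of_nonneg (by lia)
  refine ⟨X ^ (N - w d).toNat, ?_, ?_⟩
  · rw [D.j_mem_sections hg]
    intro c
    rcases eq_or_ne c d with rfl | hc
    · simp only [Pi.single_eq_same, map_one, toLaurent_X_pow, invert_T, ← T_add, h, add_neg_cancel,
        T_zero]
    · simp [Pi.single_eq_of_ne hc]
  · rw [D.j_mem_sections hg]
    intro c
    rcases eq_or_ne c d with rfl | hc
    · simp only [Pi.single_eq_same, map_one, toLaurent_X_pow, h, mul_one]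
    · simp [Pi.single_eq_of_ne hc]

/-- A rope with weights at most `N + 1` carries a line bundle of degree `N` whose sections over
`ℙ¹` lift, and whose ratios of sections generate the conormal sheaf. -/
theorem exists_twist [Infinite k] (hw : w 1 ≤ w 0) {N : ℕ} (hN : 4 ≤ N) (hwN : ∀ c, w c ≤ N + 1) :
    ∃ g, IsUnit g ∧ D.t.p g = T N ∧
      (∀ m ≤ N, ∃ f ∈ D.sections g, D.t₀.p f.1 = X ^ m) ∧
      (∃ f ∈ D.sections g, D.t₀.p f.1 = 1 ∧
        ∀ u, D.t₀.j u ∈ Thickening.ratios (k := k) (Prod.fst '' (D.sections g : Set (A₀ × A₁))) f.1) ∧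
      (∃ f ∈ D.sections g, D.t₁.p f.2 = 1 ∧
        ∀ u, D.t₁.j u ∈ Thickening.ratios (k := k) (Prod.snd '' (D.sections g : Set (A₀ × A₁))) f.2) := by
  obtain ⟨E, x, p₁, p₂, q₁, q₂, hx, hp, hq, hpq, hθ⟩ := D.exists_general_twistData N
  choose u v huv using E.exists_lift N hwN
  have hmem {m : ℕ} (hm : m ≤ N) := E.mem_sections hm (huv m)
  have hg := E.p_g N
  have hpu (m : ℕ) : D.t₀.p (E.τ ^ m + D.t₀.j (u m)) = X ^ m := by
    rw [map_add, D.t₀.p_j, add_zero, map_pow, E.hτ]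
  have hpv (m : ℕ) : D.t₁.p (E.σ ^ (N - m) + D.t₁.j (v m)) = X ^ (N - m) := by
    rw [map_add, D.t₁.p_j, add_zero, map_pow, E.hσ]
  have h01 (y : k[X]) : ![y, 0] = Pi.single (0 : Fin 2) y := by
    ext c; fin_cases c <;> simp
  have h10 (y : k[X]) : ![0, y] = Pi.single (1 : Fin 2) y := by
    ext c; fin_cases c <;> simp
  -- The order of the weights excludes the case in which only the second summand becomes `𝒪(-1)`.
  have hbad : w 1 = N + 1 → w 0 = N + 1 := fun h => le_antisymm (hwN 0) (h ▸ hw)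
  have hG₀ {m : ℕ} (hm : m ≤ N) : E.τ ^ m + D.t₀.j (u m) ∈
    Prod.fst '' (D.sections (E.g N) : Set (A₀ × A₁)) := ⟨_, hmem hm, rfl⟩
  have hG₁ {m : ℕ} (hm : m ≤ N) : E.σ ^ (N - m) + D.t₁.j (v m) ∈
    Prod.snd '' (D.sections (E.g N) : Set (A₀ × A₁)) := ⟨_, hmem hm, rfl⟩
  refine ⟨E.g N, E.isUnit_g N, hg, fun m hm => ⟨_, hmem hm, hpu m⟩,
    ⟨_, hmem (Nat.zero_le N), (hpu 0).trans (pow_zero _), ?_⟩, ⟨_, hmem le_rfl, ?_, ?_⟩⟩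
  · have hw0 := (hpu 0).trans (pow_zero _)
    have hK : D.t₀.kerRatios _ _ hw0 (hG₀ (m := 1) (by lia)) ((hpu 1).trans (pow_one X)) = ⊤ := by
      refine eq_top_of_left (p₁ := p₁) (p₂ := p₂) (q₁ := q₁) (bad := fun c => w c = N + 1) hbad ?_ ?_
        (U := fun n => u (n + 2) - 2 • (X : k[X]) • u (n + 1) + (X : k[X]) ^ 2 • u n)
        (fun n => ?_) (fun c hc => ?_) (fun c hc => ?_) (fun c hc => ?_) hx hq
      · intro h
        obtain ⟨y, hy, -⟩ := single_mem_sections hg 0 h (hwN 0)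
        rw [h01]
        exact D.t₀.mem_kerRatios _ _ _ ⟨_, hy, rfl⟩
      · intro h
        obtain ⟨y, hy, -⟩ := single_mem_sections hg 1 h (hwN 1)
        rw [h10]
        exact D.t₀.mem_kerRatios _ _ _ ⟨_, hy, rfl⟩
      -- The sections used have indices `n, n + 1, n + 2 ≤ 4`, which exist because `N ≥ 4`.
      · exact D.t₀.second_difference_mem_kerRatios _ _ _ E.hτ (hG₀ (by lia)) (hG₀ (by lia))
          (hG₀ (by lia))
      · refine (E.second_difference huv hc 0).1.trans ?_
        simp only [zero_add, (hθ c).1, (hθ c).2.1, Polynomial.C_0, zero_mul, sub_zero]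
      · refine (E.second_difference huv hc 1).1.trans ?_
        simp only [one_add_one_eq_two, Nat.reduceAdd, (hθ c).2.2.1, (hθ c).2.2.2.1]
      · refine (E.second_difference huv hc 2).1.trans ?_
        simp only [Nat.reduceAdd, (hθ c).2.2.2.2.1, (hθ c).2.2.2.2.2, Polynomial.C_0, zero_sub,
          neg_mul]
    intro y
    have : y ∈ (⊤ : Submodule k[X] (Fin 2 → k[X])) := trivial
    rw [← hK] at this
    exact this
  · exact (hpv N).trans (by rw [Nat.sub_self, pow_zero])
  · have hw1 := (hpv N).trans (by rw [Nat.sub_self, pow_zero])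
    have hK : D.t₁.kerRatios _ _ hw1 (hG₁ (m := N - 1) (by lia)) ((hpv (N - 1)).trans (by
        rw [show N - (N - 1) = 1 by lia, pow_one])) = ⊤ := by
      refine eq_top_of_right (p₁ := p₁) (p₂ := p₂) (q₁ := q₁) (bad := fun c => w c = N + 1) hbad ?_ ?_
        (W := fun n => v n - 2 • (X : k[X]) • v (n + 1) + (X : k[X]) ^ 2 • v (n + 2))
        (fun n => ?_) (fun c hc => ?_) (fun c hc => ?_) (fun c hc => ?_) hx hp hq hpq
      · intro h
        obtain ⟨y, -, hy⟩ := single_mem_sections hg 0 h (hwN 0)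
        rw [h01]
        exact D.t₁.mem_kerRatios _ _ _ ⟨_, hy, rfl⟩
      · intro h
        obtain ⟨y, -, hy⟩ := single_mem_sections hg 1 h (hwN 1)
        rw [h10]
        exact D.t₁.mem_kerRatios _ _ _ ⟨_, hy, rfl⟩
      · have e0 := hG₁ (m := n) (by lia)
        have e1 := hG₁ (m := n + 1) (by lia)
        have e2 := hG₁ (m := n + 2) (by lia)
        -- On the second chart the exponents are `N - m`, so the three sections enter the second
        -- difference in reverse order, starting from exponent `N - (n + 2)`.
        rw [show N - (n : ℕ) = N - (n + 2) + 2 by lia] at e0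
        rw [show N - ((n : ℕ) + 1) = N - (n + 2) + 1 by lia] at e1
        exact D.t₁.second_difference_mem_kerRatios _ _ _ E.hσ e2 e1 e0
      · refine (E.second_difference huv hc 0).2.trans ?_
        simp only [zero_add, (hθ c).1, (hθ c).2.1, Polynomial.C_0, neg_zero]
      · refine (E.second_difference huv hc 1).2.trans ?_
        simp only [one_add_one_eq_two, Nat.reduceAdd, (hθ c).2.2.1, (hθ c).2.2.2.1]
      · refine (E.second_difference huv hc 2).2.trans ?_
        simp only [Nat.reduceAdd, (hθ c).2.2.2.2.1, (hθ c).2.2.2.2.2, Polynomial.C_0, zero_mul,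
          add_zero]
    intro y
    have : y ∈ (⊤ : Submodule k[X] (Fin 2 → k[X])) := trivial
    rw [← hK] at this
    exact this

end GluingData

end existsTwist

/-! ### Dimension count and lifting of a spanning family -/

section dimension

/-- An arbitrary lift need not span `V`. The relations among the `h l` form a space of the same
dimension as `ker ρ`, and the lift can be changed so that it maps the first isomorphically onto the
second. -/
theorem exists_spanning_lift {k V Q : Type*} [Field k] [AddCommGroup V] [Module k V]
    [AddCommGroup Q] [Module k Q] [Module.Finite k V] (ρ : V →ₗ[k] Q) {n : ℕ}
    (hn : Module.finrank k V = n) (h : Fin n → Q)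
    (hspan : Submodule.span k (Set.range h) = LinearMap.range ρ) :
    ∃ v : Fin n → V, (∀ l, ρ (v l) = h l) ∧ Submodule.span k (Set.range v) = ⊤ := by
  have hs (l) : ∃ x, ρ x = h l := by
    rw [← LinearMap.mem_range, ← hspan]
    exact Submodule.subset_span ⟨l, rfl⟩
  choose s hs using hs
  let σ := Fintype.linearCombination k s
  let H := Fintype.linearCombination k h
  have hσ : ρ ∘ₗ σ = H := by
    ext l
    simp [σ, H, hs]
  have hH : LinearMap.range H = LinearMap.range ρ := by
    rw [← hspan]
    exact Fintype.range_linearCombination k h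
  have hdim : Module.finrank k (LinearMap.ker H) = Module.finrank k (LinearMap.ker ρ) := by
    have h1 := H.finrank_range_add_finrank_ker
    have h2 := ρ.finrank_range_add_finrank_ker
    rw [hn] at h2
    rw [Module.finrank_fin_fun, hH] at h1
    lia
  let κ := LinearEquiv.ofFinrankEq _ _ hdim
  obtain ⟨p, hp⟩ := (LinearMap.ker H).subtype.exists_leftInverse_of_injective
    (Submodule.ker_subtype _)
  have hp' (x : LinearMap.ker H) : p x = x := congrArg (fun f => f x) hp
  -- With `p` a projection onto `ker H`, this is the naive lift `σ` on `ker p` and the isomorphism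
  -- `κ` onto `ker ρ` on `ker H`.
  let φ : (Fin n → k) →ₗ[k] V := σ - σ ∘ₗ (LinearMap.ker H).subtype ∘ₗ p +
    (LinearMap.ker ρ).subtype ∘ₗ κ.toLinearMap ∘ₗ p
  have hφ : ρ ∘ₗ φ = H := by
    refine LinearMap.ext fun x => ?_
    have h1 (y) : ρ (σ y) = H y := congrArg (fun f => f y) hσ
    simp [φ, h1]
  have hinj : Function.Injective φ := by
    rw [← LinearMap.ker_eq_bot, LinearMap.ker_eq_bot']
    intro x hx
    have h1 : H x = 0 := by rw [← hφ, LinearMap.comp_apply, hx, map_zero]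
    have h2 : p x = ⟨x, h1⟩ := hp' ⟨x, h1⟩
    simp [φ, h2] at hx
    exact congrArg Subtype.val hx
  have hsurj : Function.Surjective φ :=
    (LinearMap.injective_iff_surjective_of_finrank_eq_finrank (by simp [hn])).1 hinj
  refine ⟨fun l => φ (Pi.single l 1), fun l => ?_, ?_⟩
  · rw [← LinearMap.comp_apply, hφ]
    simp [H]
  · rw [eq_top_iff]
    intro y _
    obtain ⟨x, rfl⟩ := hsurj y
    rw [show x = ∑ l, x l • Pi.single l 1 by
      ext i; simp [Finset.sum_apply, Pi.single_apply], map_sum]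
    refine Submodule.sum_mem _ fun l _ => ?_
    rw [map_smul]
    exact Submodule.smul_mem _ _ (Submodule.subset_span ⟨l, rfl⟩)

open Polynomial LaurentPolynomial

variable {k : Type*} [Field k]

theorem mem_degreeLT_of_toLaurent_eq {p q : k[X]} {e : ℤ}
    (h : toLaurent p = T e * invert (toLaurent q)) : p ∈ degreeLT k (e + 1).toNat := by
  rw [mem_degreeLT, degree_lt_iff_coeff_zero]
  intro m hm
  rw [← coeff_toLaurent_natCast, h, coeff_T_mul, invert_apply, coeff_toLaurent_of_neg]
  lia

/-- The global sections of `𝒪(N - w₀) ⊕ 𝒪(N - w₁)` on `ℙ¹`. -/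
def splitSections (k : Type*) [Field k] (w : Fin 2 → ℤ) (N : ℕ) :
    Submodule k ((Fin 2 → k[X]) × (Fin 2 → k[X])) where
  carrier := {u | ∀ c, toLaurent (u.1 c) = T (N - w c) * invert (toLaurent (u.2 c))}
  zero_mem' c := by simp
  add_mem' {u v} hu hv c := by
    simp only [Prod.fst_add, Prod.snd_add, Pi.add_apply, map_add, hu c, hv c, mul_add]
  smul_mem' a u hu c := by
    simp only [Prod.smul_fst, Prod.smul_snd, Pi.smul_apply, map_mul,
      Polynomial.smul_eq_C_mul, toLaurent_C, invert_C, hu c]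
    ring

instance (w : Fin 2 → ℤ) (N : ℕ) : Module.Finite k (splitSections k w N) := by
  let f : splitSections k w N →ₗ[k] (∀ c, degreeLT k ((N - w c) + 1).toNat) :=
    LinearMap.pi fun c => ((LinearMap.proj c ∘ₗ LinearMap.fst k _ _) ∘ₗ
      (splitSections k w N).subtype).codRestrict _ fun u => mem_degreeLT_of_toLaurent_eq (u.2 c)
  refine Module.Finite.of_injective f ?_
  rw [← LinearMap.ker_eq_bot, LinearMap.ker_eq_bot']
  intro u hu
  have h1 (c) : u.1.1 c = 0 := congrArg Subtype.val (congrFun hu c)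
  have h2 (c) : u.1.2 c = 0 := by
    have h3 := u.2 c
    rw [h1 c, map_zero, eq_comm, (isUnit_T _).mul_right_eq_zero] at h3
    simpa using h3
  exact Subtype.ext (Prod.ext (funext h1) (funext h2))

namespace Thickening

variable {R B : Type*} [CommRing R] [CommRing B] [Algebra k R] [Algebra k B]
  (t : Thickening k R B)

/-- The inclusion of the kernel as a linear map. -/
def jLin : (Fin 2 → R) →ₗ[k] B where
  __ := t.j
  map_smul' c u := by
    change t.j (c • u) = c • t.j u
    rw [Algebra.smul_def c (t.j u), t.mul_j, AlgHom.commutes, algebraMap_smul]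

end Thickening

namespace GluingData

variable {w : Fin 2 → ℤ} {A₀ A₁ A : Type*} [CommRing A₀]
  [CommRing A₁] [CommRing A] [Algebra k A₀] [Algebra k A₁] [Algebra k A]
  (D : GluingData k w A₀ A₁ A) {g : A} {N : ℕ} (hg : D.t.p g = T N)

/-- Restriction of sections to `ℙ¹`. -/
def restrict (g : A) : D.sections g →ₗ[k] k[X] :=
  D.t₀.p.toLinearMap ∘ₗ LinearMap.fst k A₀ A₁ ∘ₗ (D.sections g).subtype

include hg in
theorem range_restrict (h : ∀ m ≤ N, ∃ f ∈ D.sections g, D.t₀.p f.1 = X ^ m) :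
    LinearMap.range (D.restrict g) = degreeLT k (N + 1) := by
  apply le_antisymm
  · rintro _ ⟨f, rfl⟩
    exact mem_degreeLT_of_toLaurent_eq (e := N) (D.p_eq hg f.2)
  · classical
    rw [degreeLT_eq_span_X_pow, Submodule.span_le]
    intro p hp
    simp only [Finset.coe_image, Finset.coe_range, Set.mem_image, Set.mem_Iio] at hp
    obtain ⟨m, hm, rfl⟩ := hp
    obtain ⟨f, hf, hfm⟩ := h m (by lia)
    exact ⟨⟨f, hf⟩, hfm⟩

include hg in
-- A section whose reduction vanishes on the first chart has zero reduction on the second as well,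
-- by the gluing relation. It then lies in the kernels on both charts, where gluing is that of
-- `E(N)`.
theorem exists_kerEquiv : Nonempty (splitSections k w N ≃ₗ[k] LinearMap.ker (D.restrict g)) := by
  let φ : splitSections k w N →ₗ[k] A₀ × A₁ :=
    (D.t₀.jLin.prodMap D.t₁.jLin) ∘ₗ (splitSections k w N).subtype
  have hφ (u) : φ u ∈ D.sections g := (D.j_mem_sections hg).2 u.2
  let φ' := φ.codRestrict _ hφ
  have hφ' (u) : φ' u ∈ LinearMap.ker (D.restrict g) := D.t₀.p_j u.1.1
  refine ⟨LinearEquiv.ofBijective (φ'.codRestrict _ hφ') ⟨?_, ?_⟩⟩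
  · intro u v huv
    have h1 : φ u = φ v := congrArg (fun x => x.1.1) huv
    exact Subtype.ext (Prod.ext (D.t₀.inj (congrArg Prod.fst h1)) (D.t₁.inj (congrArg Prod.snd h1)))
  · rintro ⟨⟨f, hf⟩, h0⟩
    change D.t₀.p f.1 = 0 at h0
    have h1 := D.p_eq hg hf
    rw [h0, map_zero, eq_comm, (isUnit_T _).mul_right_eq_zero] at h1
    have h2 : D.t₁.p f.2 = 0 := by simpa using h1
    obtain ⟨u, hu⟩ := (D.t₀.ker _).1 h0
    obtain ⟨v, hv⟩ := (D.t₁.ker _).1 h2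
    have hf' : f = (D.t₀.j u, D.t₁.j v) := Prod.ext hu.symm hv.symm
    refine ⟨⟨(u, v), (D.j_mem_sections hg).1 (hf' ▸ hf)⟩, ?_⟩
    exact Subtype.ext (Subtype.ext hf'.symm)

include hg in
/-- A spanning family of `H⁰(ℙ¹, 𝒪(N))` of the right cardinality lifts to a basis of the sections
on the rope. -/
theorem exists_spanning_sections (h : ∀ m ≤ N, ∃ f ∈ D.sections g, D.t₀.p f.1 = X ^ m)
    {n : ℕ} (hn : n = N + Module.finrank k (splitSections k w N)) (F : Fin (n + 1) → k[X])
    (hF : Submodule.span k (Set.range F) = degreeLT k (N + 1)) :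
    ∃ v : Fin (n + 1) → A₀ × A₁, (∀ l, D.t₀.p (v l).1 = F l) ∧
      Submodule.span k (Set.range v) = D.sections g := by
  obtain ⟨κ⟩ := D.exists_kerEquiv hg
  have hr := D.range_restrict hg h
  have hker : Module.Finite k (LinearMap.ker (D.restrict g)) := Module.Finite.equiv κ
  have hran : Module.Finite k (LinearMap.range (D.restrict g)) := by
    rw [hr]
    infer_instance
  have hfin : Module.Finite k (D.sections g) := by
    refine ⟨Submodule.fg_of_fg_map_of_fg_inf_ker (D.restrict g) ?_ ?_⟩
    · rw [Submodule.map_top]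
      exact (Submodule.fg_top _).1 hran.1
    · rw [top_inf_eq]
      exact (Submodule.fg_top _).1 hker.1
  -- The sum of `h⁰(𝒪(N)) = N + 1` and the dimension of `H⁰(E(N))`; this is where the dimension of
  -- the target space is forced.
  have hdim : Module.finrank k (D.sections g) = n + 1 := by
    rw [← (D.restrict g).finrank_range_add_finrank_ker, ← κ.finrank_eq, hr, hn]
    have : Module.finrank k (degreeLT k (N + 1)) = N + 1 := by
      rw [(degreeLTEquiv k (N + 1)).finrank_eq, Module.finrank_fin_fun]
    lia
  obtain ⟨v, hv, hspan⟩ := exists_spanning_lift (D.restrict g) hdim F (by rw [hF, hr])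
  refine ⟨fun l => (v l : A₀ × A₁), hv, ?_⟩
  have := congrArg (Submodule.map (D.sections g).subtype) hspan
  rw [Submodule.map_span, Submodule.map_top, Submodule.range_subtype, ← Set.range_comp] at this
  exact this

end GluingData

end dimension

/-! ### The gluing data of a rope on the projective line -/

section ropeData

/-- The `k`-algebra structure on the regular functions on an open subset of a `k`-scheme. -/
@[reducible]
def sectionsAlgebra (k : Type u) [Field k] (X : Scheme.{u}) [X.Over (Spec (.of k))] (U : X.Opens) :
    Algebra k Γ(X, U) := (scalarsOn k X U).toAlgebra

attribute [local instance] sectionsAlgebra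

variable {k : Type u} [Field k]

section

variable {X Y' : Scheme.{u}} [X.Over (Spec (.of k))] [Y'.Over (Spec (.of k))] {ι : X ⟶ Y'}
  {hι : IsHomeomorph ι}

theorem red_scalarsOn (hιk : ι.IsOver (Spec (.of k))) (V : X.Opens) (c : k) :
    red hι V (scalarsOn k Y' _ c) = scalarsOn k X V c :=
  pullFun_scalarsOn ι hιk _ c

/-- The square-zero extension given by the sections of a rope over an open set on which the
conormal sheaf is trivialized. -/
def RopeChart.thickening {D : X.Opens} (R : RopeChart hι D) (hιk : ι.IsOver (Spec (.of k)))
    {V : X.Opens} (hV : V ≤ D) {B : Type*} [CommRing B] [Algebra k B] (e : B ≃+* Γ(X, V))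
    (he : ∀ c, e (algebraMap k B c) = scalarsOn k X V c) :
    Thickening k B Γ(Y', img hι V) where
  p :=
    { (e.symm.toRingHom.comp (red hι V)) with
      commutes' := fun c => by
        change e.symm (red hι V (scalarsOn k Y' _ c)) = _
        rw [red_scalarsOn hιk, ← he, e.symm_apply_apply] }
  j :=
    { toFun := fun u => R.j hV (fun c => e (u c))
      map_zero' := by
        have h := R.add hV 0 0
        rw [add_zero, right_eq_add] at h
        rw [← h]
        congr 1
        ext c
        simp
      map_add' := fun u v => by
        rw [← R.add]
        congr 1
        ext c
        simp }
  inj u v h := by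
    have := R.inj hV h
    ext1 c
    exact e.injective (congrFun this c)
  mul_j x u := by
    change x * R.j hV _ = R.j hV _
    rw [R.smul]
    congr 1
    ext1 c
    change _ = e (e.symm (red hι V x) * u c)
    rw [map_mul, e.apply_symm_apply]
  ker x := by
    change e.symm (red hι V x) = 0 ↔ ∃ u : Fin 2 → B, R.j hV (fun c => e (u c)) = x
    rw [map_eq_zero_iff e.symm e.symm.injective, R.ker hV]
    constructor
    · rintro ⟨u, rfl⟩
      exact ⟨fun c => e.symm (u c), by simp⟩
    · rintro ⟨u, hu⟩
      exact ⟨_, hu⟩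

/-- Restriction of regular functions as a homomorphism of `k`-algebras. -/
def resAlg (k : Type u) [Field k] {X : Scheme.{u}} [X.Over (Spec (.of k))] {U V : X.Opens}
    (h : V ≤ U) : Γ(X, U) →ₐ[k] Γ(X, V) :=
  { resFun h with commutes' := fun c => resFun_scalarsOn h c }

end

open Polynomial LaurentPolynomial

/-- The regular functions on a chart of `ℙ¹` are polynomials. -/
def polyEquiv (k : Type u) [Field k] (i : Fin 2) : k[X] ≃+* Γ(PSpace k 1, chart k i) :=
  RingEquiv.ofBijective _ (polyChart_bijective i)

theorem polyEquiv_algebraMap (i : Fin 2) (c : k) :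
    polyEquiv k i (algebraMap k k[X] c) = scalarsOn k _ _ c := polyChart_C i c

theorem overlapEquiv_algebraMap (c : k) :
    overlapEquiv k (algebraMap k k[T;T⁻¹] c) = scalarsOn k _ _ c := by
  rw [← LaurentPolynomial.C_eq_algebraMap, overlapEquiv_C]

theorem overlapEquiv_T_natCast (n : ℕ) :
    overlapEquiv k (T n) = resFun inf_le_left (coord k 0) ^ n := by
  rw [← overlapEquiv_T_one, ← map_pow, T_pow, mul_one]

section

variable {a b : ℤ} {Y' : Scheme.{u}} [Y'.Over (Spec (.of k))] {ι : PSpace k 1 ⟶ Y'}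
  (hιk : ι.IsOver (Spec (.of k))) (hc : IsClosedImmersion ι) (hι : IsHomeomorph ι)
  (α : (Scheme.Modules.pushforward ι).obj (splitBundle k a b) ⟶ structureModule Y')
  (hα : ∀ V : Y'.Opens, Function.Injective (α.app V) ∧
      ∀ s : Γ(Y', V), (ι.app V).hom s = 0 ↔
        ∃ e : Γ((Scheme.Modules.pushforward ι).obj (splitBundle k a b), V), α.app V e = s)

/-- The gluing data of a rope on `ℙ¹`. -/
def ropeGluingData : GluingData k ![a, b] Γ(Y', img hι (chart k 0)) Γ(Y', img hι (chart k 1))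
    Γ(Y', img hι (chartOverlap k)) where
  t₀ := (ropeChart hι α hα 0).thickening hιk le_rfl (polyEquiv k 0) (polyEquiv_algebraMap 0)
  t₁ := (ropeChart hι α hα 1).thickening hιk le_rfl (polyEquiv k 1) (polyEquiv_algebraMap 1)
  t := (ropeChart hι α hα 0).thickening hιk inf_le_left (overlapEquiv k) overlapEquiv_algebraMap
  surj₀ := (polyEquiv k 0).symm.surjective.comp
    (red_surjective (ropeChart hι α hα 0) (isAffineOpen_chart 0))
  surj₁ := (polyEquiv k 1).symm.surjective.comp
    (red_surjective (ropeChart hι α hα 1) (isAffineOpen_chart 1))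
  r₀ := resAlg k (img_mono hι inf_le_left)
  r₁ := resAlg k (img_mono hι inf_le_right)
  p_r₀ x := by
    change (overlapEquiv k).symm (red hι _ (resFun (img_mono hι inf_le_left) x)) =
      toLaurent ((polyEquiv k 0).symm (red hι _ x))
    rw [RingEquiv.symm_apply_eq, overlapEquiv_toLaurent, red_res hι inf_le_left]
    exact congrArg (resFun inf_le_left) ((polyEquiv k 0).apply_symm_apply _).symm
  p_r₁ x := by
    change (overlapEquiv k).symm (red hι _ (resFun (img_mono hι inf_le_right) x)) =
      invert (toLaurent ((polyEquiv k 1).symm (red hι _ x)))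
    rw [RingEquiv.symm_apply_eq, overlapEquiv_invert, red_res hι inf_le_right]
    exact congrArg (resFun inf_le_right) ((polyEquiv k 1).apply_symm_apply _).symm
  r_j₀ u := by
    change resFun (img_mono hι inf_le_left) ((ropeChart hι α hα 0).j le_rfl _) =
      (ropeChart hι α hα 0).j _ _
    rw [(ropeChart hι α hα 0).res le_rfl inf_le_left]
    congr 1
    ext1 c
    exact (overlapEquiv_toLaurent (u c)).symm
  r_j₁ u := by
    change resFun (img_mono hι inf_le_right) ((ropeChart hι α hα 1).j le_rfl _) =
      (ropeChart hι α hα 0).j _ _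
    rw [(ropeChart hι α hα 1).res le_rfl inf_le_right]
    -- The kernel over the intersection is trivialized from chart `0`, so vectors from chart `1`
    -- acquire the transition factor `T ^ (-w c)`.
    refine (ropeChart_j_eq hι α hα inf_le_left inf_le_right _ _ fun c => ?_).symm
    change resFun inf_le_left (coord k 0) ^ _ * _ =
      resFun inf_le_left (coord k 0) ^ _ * resFun inf_le_right (polyChart k 1 (u c))
    rw [← overlapEquiv_T_natCast, ← overlapEquiv_T_natCast, ← overlapEquiv_invert, ← map_mul,
      ← map_mul, ← mul_assoc, ← T_add]
    congr 3
    have := Int.toNat_sub_toNat_neg (![a, b] c)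
    lia

end

end ropeData

/-! ### Global sections of the twisted conormal bundle -/

section globalSections

open Polynomial LaurentPolynomial

variable {k : Type u} [Field k]

theorem top_le_iSup_chart : (⊤ : (PSpace k 1).Opens) ≤ ⨆ i : Fin 2, chart k i := iSup_chart.ge

theorem res_glue_pair {X : Scheme.{u}} (E : X.Modules) (U : Fin 2 → X.Opens) {V : X.Opens}
    (hU : ∀ a, U a ≤ V) (hV : V ≤ iSup U) (s : ∀ a, Γ(E, U a))
    (h : res E (inf_le_left : U 0 ⊓ U 1 ≤ U 0) (s 0) = res E (inf_le_right : U 0 ⊓ U 1 ≤ U 1) (s 1)) :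
    ∃ t : Γ(E, V), ∀ a, res E (hU a) t = s a := by
  refine res_glue E U V hU hV s ?_
  refine Fin.forall_fin_two.2 ⟨Fin.forall_fin_two.2 ⟨rfl, h⟩, Fin.forall_fin_two.2 ⟨?_, rfl⟩⟩
  have := congrArg (res E (inf_comm (U 1) (U 0)).le) h
  rw [res_res, res_res] at this
  exact this.symm

variable (a b : ℤ) (N : ℕ)

/-- The trivialization of a twist of `𝒪(-a) ⊕ 𝒪(-b)` over an open subset of a chart. -/
def twistTriv (i : Fin 2) {Q : (PSpace k 1).Opens} (hQ : Q ≤ chart k i)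
    (s : Γ(serreTwist (splitBundle k a b) N, Q)) : Fin 2 → Γ(PSpace k 1, Q) :=
  splitTriv a b i hQ (triv (𝟙 _) (splitBundle k a b) N i hQ s)

variable {i : Fin 2} {Q : (PSpace k 1).Opens} (hQ : Q ≤ chart k i)

theorem twistTriv_bijective : Function.Bijective (twistTriv a b N i hQ) :=
  (splitTriv_bijective a b hQ).comp
    (triv_bijective (splitBundle k a b) N (f := 𝟙 (PSpace k 1)) (i := i) hQ)

theorem twistTriv_add (s t : Γ(serreTwist (splitBundle k a b) N, Q)) :
    twistTriv a b N i hQ (s + t) = twistTriv a b N i hQ s + twistTriv a b N i hQ t :=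
  (congrArg (splitTriv a b i hQ) (map_add (triv (𝟙 _) (splitBundle k a b) N i hQ) s t)).trans
    (splitTriv_add a b hQ _ _)

theorem twistTriv_smul (r : Γ(PSpace k 1, Q)) (s : Γ(serreTwist (splitBundle k a b) N, Q)) (c : Fin 2) :
    twistTriv a b N i hQ (r • s) c = r * twistTriv a b N i hQ s c :=
  (congrArg (fun x => splitTriv a b i hQ x c)
    (triv_smul (splitBundle k a b) N (f := 𝟙 (PSpace k 1)) (i := i) hQ r s)).trans
    (splitTriv_smul a b hQ r _ c)

theorem twistTriv_res {R : (PSpace k 1).Opens} (h : R ≤ Q)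
    (s : Γ(serreTwist (splitBundle k a b) N, Q)) (c : Fin 2) :
    twistTriv a b N i (h.trans hQ) (res _ h s) c = resFun h (twistTriv a b N i hQ s c) :=
  (congrArg (fun x => splitTriv a b i (h.trans hQ) x c)
    (triv_res (splitBundle k a b) N (f := 𝟙 (PSpace k 1)) (i := i) hQ h s)).trans
    (splitTriv_res a b hQ h _ c)

theorem twistTriv_rel {l : Fin 2} (hl : Q ≤ chart k l) (s : Γ(serreTwist (splitBundle k a b) N, Q))
    (c : Fin 2) :
    resFun hQ (coordRatio k i l) ^ (![a, b] c).toNat * twistTriv a b N i hQ s c =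
      resFun hQ (coordRatio k i l) ^ (N + (-![a, b] c).toNat) * twistTriv a b N l hl s c := by
  have h1 := triv_rel (splitBundle k a b) N (f := 𝟙 (PSpace k 1)) (i := i) (l := l) hQ hl s
  rw [Int.toNat_neg_natCast, pow_zero, one_smul, Int.toNat_natCast, ratio_id] at h1
  have h2 : twistTriv a b N i hQ s c = resFun hQ (coordRatio k i l) ^ N *
      splitTriv a b i hQ (triv (𝟙 _) (splitBundle k a b) N l hl s) c :=
    (congrArg (fun x => splitTriv a b i hQ x c) h1).trans (splitTriv_smul a b hQ _ _ c)
  rw [h2, mul_left_comm, splitTriv_rel a b hQ hl, ← mul_assoc, ← pow_add]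
  rfl

/-- The polynomials describing a global section on the two charts. -/
def polySection (i : Fin 2) (s : Γ(serreTwist (splitBundle k a b) N, ⊤)) (c : Fin 2) : k[X] :=
  (polyEquiv k i).symm (twistTriv a b N i le_rfl (res _ le_top s) c)

theorem polyEquiv_polySection (i : Fin 2) (s : Γ(serreTwist (splitBundle k a b) N, ⊤)) (c : Fin 2) :
    polyEquiv k i (polySection a b N i s c) = twistTriv a b N i le_rfl (res _ le_top s) c :=
  (polyEquiv k i).apply_symm_apply _

theorem polySection_add (i : Fin 2) (s t : Γ(serreTwist (splitBundle k a b) N, ⊤)) :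
    polySection a b N i (s + t) = polySection a b N i s + polySection a b N i t := by
  ext1 c
  apply (polyEquiv k i).injective
  rw [Pi.add_apply, map_add, polyEquiv_polySection, polyEquiv_polySection, polyEquiv_polySection,
    map_add, twistTriv_add, Pi.add_apply]

theorem polySection_smul (i : Fin 2) (r : k) (s : Γ(serreTwist (splitBundle k a b) N, ⊤)) :
    polySection a b N i (scalars k (PSpace k 1) r • s) = r • polySection a b N i s := by
  ext1 c
  apply (polyEquiv k i).injective
  rw [Pi.smul_apply, Algebra.smul_def, map_mul, polyEquiv_polySection, polyEquiv_polySection,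
    res_smul, twistTriv_smul, polyEquiv_algebraMap]
  rfl

theorem T_eq_T_mul_iff (w : ℤ) (x y : k[T;T⁻¹]) :
    T (w.toNat : ℤ) * x = T ((N + (-w).toNat : ℕ) : ℤ) * y ↔ x = T (N - w) * y := by
  have hw : (N : ℤ) - w = -(w.toNat : ℤ) + (N + (-w).toNat : ℕ) := by
    have := Int.toNat_sub_toNat_neg w
    push_cast
    lia
  rw [hw, T_add, mul_assoc]
  constructor
  · intro h
    rw [← h, ← mul_assoc, ← T_add, neg_add_cancel, T_zero, one_mul]
  · intro h
    rw [h, ← mul_assoc, ← T_add, add_neg_cancel, T_zero, one_mul]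

theorem overlap_rel_iff (c : Fin 2) (p q : k[X]) :
    resFun (inf_le_left : chartOverlap k ≤ _) (coord k 0) ^ (![a, b] c).toNat *
        resFun inf_le_left (polyEquiv k 0 p) =
      resFun (inf_le_left : chartOverlap k ≤ _) (coord k 0) ^ (N + (-![a, b] c).toNat) *
        resFun inf_le_right (polyEquiv k 1 q) ↔
    toLaurent p = T (N - ![a, b] c) * invert (toLaurent q) := by
  rw [← T_eq_T_mul_iff, ← (overlapEquiv k).injective.eq_iff, map_mul, map_mul,
    overlapEquiv_T_natCast, overlapEquiv_T_natCast, overlapEquiv_toLaurent, overlapEquiv_invert]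
  rfl

theorem polySection_mem (s : Γ(serreTwist (splitBundle k a b) N, ⊤)) :
    (polySection a b N 0 s, polySection a b N 1 s) ∈ splitSections k ![a, b] N := by
  intro c
  rw [← overlap_rel_iff, polyEquiv_polySection, polyEquiv_polySection]
  have h := twistTriv_rel a b N (Q := chartOverlap k) (i := 0) (l := 1) inf_le_left inf_le_right
    (res _ le_top s) c
  have e0 := twistTriv_res a b N (i := 0) le_rfl (inf_le_left : chartOverlap k ≤ chart k 0)
    (res _ le_top s) c
  have e1 := twistTriv_res a b N (i := 1) le_rfl (inf_le_right : chartOverlap k ≤ chart k 1)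
    (res _ le_top s) c
  rw [res_res] at e0 e1
  rw [← e0, ← e1]
  exact h

theorem polySection_injective (s : Γ(serreTwist (splitBundle k a b) N, ⊤))
    (h : ∀ i, polySection a b N i s = 0) : s = 0 := by
  refine res_eq_of_cover _ (chart k) ⊤ (fun _ => le_top) top_le_iSup_chart _ _ fun i => ?_
  apply (twistTriv_bijective a b N (le_refl (chart k i))).1
  ext1 c
  have h1 := congrArg (polyEquiv k i) (congrFun (h i) c)
  have h2 := twistTriv_add a b N (le_refl (chart k i)) 0 0
  rw [add_zero, right_eq_add] at h2
  rw [polyEquiv_polySection, Pi.zero_apply, map_zero] at h1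
  rw [h1, map_zero, h2, Pi.zero_apply]

theorem exists_polySection {u : (Fin 2 → k[X]) × (Fin 2 → k[X])}
    (hu : u ∈ splitSections k ![a, b] N) : ∃ s : Γ(serreTwist (splitBundle k a b) N, ⊤),
      (polySection a b N 0 s, polySection a b N 1 s) = u := by
  have hex (i : Fin 2) (q : Fin 2 → k[X]) := (twistTriv_bijective a b N (le_refl (chart k i))).2
    (fun c => polyEquiv k i (q c))
  obtain ⟨s₀, h₀⟩ := hex 0 u.1
  obtain ⟨s₁, h₁⟩ := hex 1 u.2
  let s : ∀ i : Fin 2, Γ(serreTwist (splitBundle k a b) N, chart k i) := Fin.cons s₀ (Fin.cons s₁ nofun)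
  obtain ⟨t, ht⟩ := res_glue_pair _ (chart k) (fun _ => le_top) top_le_iSup_chart s (by
    change res _ inf_le_left s₀ = res _ inf_le_right s₁
    apply (twistTriv_bijective a b N (i := 0) (inf_le_left : chartOverlap k ≤ _)).1
    ext1 c
    have e0 := twistTriv_res a b N (i := 0) le_rfl (inf_le_left : chartOverlap k ≤ chart k 0) s₀ c
    have e1 := twistTriv_res a b N (i := 1) le_rfl (inf_le_right : chartOverlap k ≤ chart k 1) s₁ c
    have h := twistTriv_rel a b N (Q := chartOverlap k) (i := 0) (l := 1) inf_le_left inf_le_right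
      (res _ inf_le_right s₁) c
    have hu' := (overlap_rel_iff a b N c _ _).2 (hu c)
    rw [h₀] at e0
    rw [h₁] at e1
    have hunit : IsUnit (resFun (inf_le_left : chartOverlap k ≤ _) (coord k 0)) :=
      IsUnit.of_mul_eq_one _ coord_mul_coord
    refine (hunit.pow _).mul_left_cancel (Eq.trans ?_ h.symm)
    refine (congrArg _ e0).trans (hu'.trans ?_)
    exact (congrArg _ e1).symm)
  have ht0 : res _ le_top t = s₀ := ht 0
  have ht1 : res _ le_top t = s₁ := ht 1
  refine ⟨t, Prod.ext ?_ ?_⟩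
  · ext1 c
    apply (polyEquiv k 0).injective
    rw [polyEquiv_polySection, ht0, h₀]
  · ext1 c
    apply (polyEquiv k 1).injective
    rw [polyEquiv_polySection, ht1, h₁]

/-- A global section is its two restrictions to the charts, which are vectors of polynomials, and
the gluing condition on the overlap is the relation defining `splitSections`. -/
theorem h0_serreTwist : h0 k (serreTwist (splitBundle k a b) N) =
    Module.finrank k (splitSections k ![a, b] N) := by
  let : Module k Γ(serreTwist (splitBundle k a b) N, ⊤) :=
    Module.compHom Γ(serreTwist (splitBundle k a b) N, ⊤) (scalars k (PSpace k 1))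
  let φ : Γ(serreTwist (splitBundle k a b) N, ⊤) →ₗ[k] splitSections k ![a, b] N :=
    { toFun := fun s => ⟨_, polySection_mem a b N s⟩
      map_add' := fun s t => Subtype.ext
        (Prod.ext (polySection_add a b N 0 s t) (polySection_add a b N 1 s t))
      map_smul' := fun r s => Subtype.ext
        (Prod.ext (polySection_smul a b N 0 r s) (polySection_smul a b N 1 r s)) }
  refine (LinearEquiv.ofBijective φ ⟨?_, ?_⟩).finrank_eq
  · rw [injective_iff_map_eq_zero]
    intro s hs
    refine polySection_injective a b N s (Fin.forall_fin_two.2 ⟨?_, ?_⟩)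
    · exact congrArg (fun x => x.1.1) hs
    · exact congrArg (fun x => x.1.2) hs
  · rintro ⟨u, hu⟩
    obtain ⟨s, hs⟩ := exists_polySection a b N hu
    exact ⟨s, Subtype.ext hs⟩

end globalSections

/-! ### Trivializations of the pullback of 𝒪(1) as homogeneous coordinates -/

section frames

variable {k : Type u} [Field k] {n : ℕ}

/-- A trivialization of a sheaf of modules over an open set. -/
structure Frame {X : Scheme.{u}} (L : X.Modules) (U : X.Opens) where
  app : ∀ {V : X.Opens}, V ≤ U → Γ(L, V) →+ Γ(X, V)
  bijective : ∀ {V : X.Opens} (hV : V ≤ U), Function.Bijective (app hV)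
  smul : ∀ {V : X.Opens} (hV : V ≤ U) (r : Γ(X, V)) (s : Γ(L, V)), app hV (r • s) = r * app hV s
  res : ∀ {V W : X.Opens} (hV : V ≤ U) (h : W ≤ V) (s : Γ(L, V)),
    app (h.trans hV) (ThreeRope.res L h s) = resFun h (app hV s)

/-- Transport of a trivialization along an isomorphism. -/
def Frame.ofIso {X : Scheme.{u}} {L L' : X.Modules} {U : X.Opens} (A : Frame L' U) (e : L ≅ L') :
    Frame L U where
  app hV := (A.app hV).comp ⟨⟨e.hom.app _, by simp⟩, fun s t => hom_app_add e.hom s t⟩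
  bijective hV := (A.bijective hV).comp (iso_app_bijective e _)
  smul hV r s := by
    change A.app hV (e.hom.app _ (r • s)) = _
    rw [Scheme.Modules.Hom.app_smul, A.smul]
    rfl
  res hV h s := by
    change A.app _ (e.hom.app _ _) = _
    rw [hom_app_res, A.res]
    rfl

theorem Frame.ofIso_app {X : Scheme.{u}} {L L' : X.Modules} {U : X.Opens} (A : Frame L' U)
    (e : L ≅ L') {V : X.Opens} (hV : V ≤ U) (s : Γ(L, V)) :
    (A.ofIso e).app hV s = A.app hV (e.hom.app V s) := rfl

/-- The trivialization of `f^*𝒪(d)` over `f⁻¹ D₊(xᵢ)`. -/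
def pullbackFrame {X : Scheme.{u}} (f : X ⟶ PSpace k n) (d : ℤ) (i : Fin (n + 1)) :
    Frame (pullbackBundle f d) (pchart f i) where
  app hV := triv f (structureModule X) d i hV
  bijective hV := triv_bijective (structureModule X) d (f := f) (i := i) hV
  smul hV r s := triv_smul (structureModule X) d (f := f) (i := i) hV r s
  res hV h s := triv_res (structureModule X) d (f := f) (i := i) hV h s

/-- The function `∑ cₘ xₘ / xᵢ` on an open subset of `f⁻¹ D₊(xᵢ)`. -/
def linearRatio {X : Scheme.{u}} [X.Over (Spec (.of k))] (f : X ⟶ PSpace k n) (i : Fin (n + 1))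
    {V : X.Opens} (hV : V ≤ pchart f i) (c : Fin (n + 1) → k) : Γ(X, V) :=
  ∑ m, scalarsOn k X V (c m) * resFun hV (ratio f i m)

section linearRatio

variable {X : Scheme.{u}} [X.Over (Spec (.of k))] (f : X ⟶ PSpace k n) {i l : Fin (n + 1)}
  {V W : X.Opens} (hV : V ≤ pchart f i) (c : Fin (n + 1) → k)

theorem resFun_linearRatio (h : W ≤ V) :
    resFun h (linearRatio f i hV c) = linearRatio f i (h.trans hV) c := by
  simp only [linearRatio, map_sum, map_mul, resFun_scalarsOn, resFun_resFun]

theorem linearRatio_congr {f g : X ⟶ PSpace k n} (h : f = g) (hf : V ≤ pchart f i)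
    (hg : V ≤ pchart g i) (c : Fin (n + 1) → k) : linearRatio f i hf c = linearRatio g i hg c := by
  subst h
  rfl

theorem ratio_mul_linearRatio (hl : V ≤ pchart f l) :
    resFun hV (ratio f i l) * linearRatio f l hl c = linearRatio f i hV c := by
  rw [linearRatio, Finset.mul_sum]
  refine Finset.sum_congr rfl fun m _ => ?_
  rw [mul_left_comm, ratio_mul]

theorem linearRatio_single (m : Fin (n + 1)) :
    linearRatio f i hV (Pi.single m 1) = resFun hV (ratio f i m) := by
  rw [linearRatio, Finset.sum_eq_single m]
  · rw [Pi.single_eq_same, map_one, one_mul]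
  · intro r _ hr
    rw [Pi.single_eq_of_ne hr, map_zero, zero_mul]
  · simp

theorem pullFun_linearRatio {Z : Scheme.{u}} [Z.Over (Spec (.of k))] (g : Z ⟶ X)
    (hg : g.IsOver (Spec (.of k))) {W : Z.Opens} (e : W ≤ g ⁻¹ᵁ V) (e' : W ≤ pchart (g ≫ f) i) :
    pullFun g e (linearRatio f i hV c) = linearRatio (g ≫ f) i e' c := by
  rw [linearRatio, linearRatio, map_sum]
  refine Finset.sum_congr rfl fun m _ => ?_
  rw [map_mul, pullFun_scalarsOn g hg, pullFun_ratio_comp g hV e e']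

theorem HasCoords.linearRatio_mul {U : X.Opens} {F : Fin (n + 1) → Γ(X, U)} (h : HasCoords f U F)
    (hU : V ≤ U) : linearRatio f i hV c * resFun hU (F i) =
      resFun hU (∑ m, scalarsOn k X U (c m) * F m) := by
  rw [linearRatio, Finset.sum_mul, map_sum]
  refine Finset.sum_congr rfl fun m _ => ?_
  rw [map_mul, resFun_scalarsOn, mul_assoc, (h i V hU hV).2 m]

end linearRatio

theorem linearRatio_rel {X : Scheme.{u}} [X.Over (Spec (.of k))] (f : X ⟶ PSpace k n)
    (i l : Fin (n + 1)) {V W W' : X.Opens} (hi : V ≤ pchart f i) (hV : V ≤ W) (hV' : V ≤ W')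
    (hW : W ≤ pchart f i) (hW' : W' ≤ pchart f l) (c : Fin (n + 1) → k) :
    resFun hi (ratio f i l) ^ 0 * resFun hV (linearRatio f i hW c) =
      resFun hi (ratio f i l) ^ 1 * resFun hV' (linearRatio f l hW' c) := by
  rw [resFun_linearRatio, resFun_linearRatio, pow_zero, one_mul, pow_one, ratio_mul_linearRatio]

/-- The section `∑ cₘ xₘ` of `𝒪(1)`. -/
def linearForm (c : Fin (n + 1) → k) : Γ(lineBundle k n 1, ⊤) :=
  show twistSections (𝟙 (PSpace k n)) (structureModule (PSpace k n)) 1 ⊤ from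
    ⟨fun i => linearRatio (𝟙 _) i (inf_le_right : ⊤ ⊓ _ ≤ pchart (𝟙 (PSpace k n)) i) c,
      fun i l => linearRatio_rel (𝟙 _) i l _ _ _ _ _ c⟩

theorem comp_linearForm (c : Fin (n + 1) → k) (i : Fin (n + 1)) :
    comp (𝟙 _) (structureModule (PSpace k n)) 1 (linearForm c) i = linearRatio (𝟙 _) i inf_le_right c :=
  rfl

/-- The pullback of sections of `𝒪(1)` along a morphism to projective space. -/
def pullForm {X : Scheme.{u}} (f : X ⟶ PSpace k n) :
    Γ(lineBundle k n 1, ⊤) →+ Γ(pullbackBundle f 1, ⊤) := pullSections f 1 ⊤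

section

variable {X : Scheme.{u}} [X.Over (Spec (.of k))] (f : X ⟶ PSpace k n)
  (hf : f.IsOver (Spec (.of k)))

include hf in
theorem pullbackFrame_pullForm (i : Fin (n + 1)) {V : X.Opens} (hV : V ≤ pchart f i)
    (c : Fin (n + 1) → k) : (pullbackFrame f 1 i).app hV
      (res _ le_top (pullForm f (linearForm c))) =
      linearRatio f i hV c := by
  have h := pullFun_linearRatio (𝟙 _) (inf_le_right : ⊤ ⊓ _ ≤ pchart (𝟙 (PSpace k n)) i) c f hf
    (inf_pchart_le f ⊤ i) (show _ ≤ pchart (f ≫ 𝟙 _) i from inf_le_right)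
  have h2 : linearRatio (f ≫ 𝟙 _) i (V := f ⁻¹ᵁ ⊤ ⊓ pchart f i) inf_le_right c =
      linearRatio f i inf_le_right c := linearRatio_congr (Category.comp_id f) _ _ c
  have h1 : V ≤ f ⁻¹ᵁ ⊤ ⊓ pchart f i := le_inf (fun _ _ => trivial) hV
  have h3 := congrArg (resFun h1) (h.trans h2)
  rw [resFun_linearRatio] at h3
  refine Eq.trans ?_ h3
  exact resFun_resFun _ _ _

/-- The coordinates given by a trivialization. -/
def Frame.coords {U : X.Opens} (A : Frame (pullbackBundle f 1) U) (c : Fin (n + 1) → k) : Γ(X, U) :=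
  A.app le_rfl (ThreeRope.res _ le_top (pullForm f (linearForm c)))

include hf in
-- Over a set inside `f⁻¹ D₊(xᵢ)` the frame `A` and the standard frame differ by a unit. The
-- standard frame sends `xᵢ` to `1`, so that unit is the value of `A` at `xᵢ`.
theorem Frame.resFun_coords {U : X.Opens} (A : Frame (pullbackBundle f 1) U) {V : X.Opens}
    (hV : V ≤ U) {i : Fin (n + 1)} (hi : V ≤ pchart f i) :
    IsUnit (resFun hV (A.coords f (Pi.single i 1))) ∧ ∀ c, resFun hV (A.coords f c) =
      linearRatio f i hi c * resFun hV (A.coords f (Pi.single i 1)) := by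
  have h0 (c) : resFun hV (A.coords f c) = A.app hV (ThreeRope.res _ le_top (pullForm f (linearForm c))) := by
    rw [Frame.coords, ← A.res le_rfl hV, res_res]
  have key (s : Γ(pullbackBundle f 1, V)) : A.app hV s =
      (pullbackFrame f 1 i).app hi s * resFun hV (A.coords f (Pi.single i 1)) := by
    rw [h0, ← A.smul]
    congr 1
    apply ((pullbackFrame f 1 i).bijective hi).1
    rw [(pullbackFrame f 1 i).smul, pullbackFrame_pullForm f hf, linearRatio_single, ratio_self,
      map_one, mul_one]
  constructor
  · obtain ⟨s, hs⟩ := (A.bijective hV).2 1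
    rw [key] at hs
    exact IsUnit.of_mul_eq_one_right _ hs
  · intro c
    rw [h0 c, key, pullbackFrame_pullForm f hf]

include hf in
theorem Frame.hasCoords {U : X.Opens} (A : Frame (pullbackBundle f 1) U) :
    HasCoords f U (fun l => A.coords f (Pi.single l 1)) := by
  intro l V hV hl
  obtain ⟨h1, h2⟩ := A.resFun_coords f hf hV hl
  refine ⟨h1, fun m => ?_⟩
  rw [h2 (Pi.single m 1), linearRatio_single]

include hf in
theorem Frame.coords_eq_sum {U : X.Opens} (A : Frame (pullbackBundle f 1) U) (c : Fin (n + 1) → k) :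
    A.coords f c = ∑ l, scalarsOn k X U (c l) * A.coords f (Pi.single l 1) := by
  refine resFun_eq_of_cover (fun i => U ⊓ pchart f i) U (fun _ => inf_le_left)
    (le_iSup_inf_pchart f U) _ _ fun i => ?_
  rw [(A.resFun_coords f hf inf_le_left inf_le_right).2 c]
  exact (A.hasCoords f hf).linearRatio_mul f _ c _

end

end frames

/-! ### Linear forms as sections of 𝒪(1) -/

section linearForms

variable {k : Type u} [Field k] {n : ℕ}

theorem chartLift_linearRatio {R : Type*} [CommRing R] (φ : k →+* R) (G : Fin (n + 1) → R)
    (i : Fin (n + 1)) (hG : IsUnit (G i)) (c : Fin (n + 1) → k) :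
    chartLift φ G i hG (linearRatio (𝟙 (PSpace k n)) i (le_refl (pchart (𝟙 (PSpace k n)) i)) c) * G i =
      ∑ m, φ (c m) * G m := by
  have h : linearRatio (𝟙 (PSpace k n)) i (le_refl (pchart (𝟙 (PSpace k n)) i)) c =
      ∑ m, scalarsOn k (PSpace k n) (chart k i) (c m) * coordRatio k i m := by
    refine Finset.sum_congr rfl fun m _ => ?_
    rw [resFun_self]
    rfl
  refine (congrArg (fun x => chartLift φ G i hG x * G i) h).trans ?_
  rw [map_sum, Finset.sum_mul]
  refine Finset.sum_congr rfl fun m _ => ?_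
  rw [map_mul, mul_assoc, chartLift_coordRatio, chartLift_scalarsOn]

/-- Evaluation at the coordinate point with only the `i`-th coordinate nonzero recovers the
coefficient with index `i`. -/
theorem linearForm_injective : Function.Injective (linearForm : (Fin (n + 1) → k) → _) := by
  intro c c' h
  ext i
  have h1 (c : Fin (n + 1) → k) := comp_linearForm c i
  have h2 : linearRatio (𝟙 (PSpace k n)) i (V := ⊤ ⊓ pchart (𝟙 (PSpace k n)) i) inf_le_right c =
      linearRatio (𝟙 (PSpace k n)) i inf_le_right c' :=
    (h1 c).symm.trans ((congrArg (fun s => comp (𝟙 _) (structureModule (PSpace k n)) 1 s i) h).trans (h1 c'))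
  have h3 := congrArg (resFun (le_inf le_top le_rfl)) h2
  rw [resFun_linearRatio, resFun_linearRatio] at h3
  have hG : IsUnit ((Pi.single i 1 : Fin (n + 1) → k) i) := by simp
  have h4 (c : Fin (n + 1) → k) := chartLift_linearRatio (RingHom.id k) (Pi.single i 1) i hG c
  simp only [Pi.single_eq_same, mul_one, RingHom.id_apply, Pi.single_apply, mul_ite, mul_zero,
    Finset.sum_ite_eq', Finset.mem_univ, if_true] at h4
  rw [← h4 c, ← h4 c']
  exact congrArg _ h3

/-- The standard trivialization of `𝒪(d)` over `D₊(xᵢ)`. -/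
def lineFrame (k : Type u) [Field k] (n : ℕ) (d : ℤ) (i : Fin (n + 1)) :
    Frame (lineBundle k n d) (chart k i) := pullbackFrame (𝟙 (PSpace k n)) d i

theorem lineFrame_linearForm (i : Fin (n + 1)) (c : Fin (n + 1) → k) :
    (lineFrame k n 1 i).app le_rfl (res _ le_top (linearForm c)) =
      linearRatio (𝟙 (PSpace k n)) i (le_refl (pchart (𝟙 (PSpace k n)) i)) c := by
  have h := comp_linearForm c i
  have h' := congrArg (resFun (le_inf le_top le_rfl : pchart (𝟙 (PSpace k n)) i ≤ ⊤ ⊓ pchart (𝟙 (PSpace k n)) i)) h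
  rw [resFun_linearRatio] at h'
  refine Eq.trans ?_ h'
  exact resFun_resFun (X := PSpace k n) (inf_le_inf le_top le_rfl) (le_inf le_rfl le_rfl)
    (comp (𝟙 (PSpace k n)) (structureModule (PSpace k n)) 1 (linearForm c) i)

end linearForms

/-! ### Rational normal curves in polynomial coordinates -/

section rationalNormalCurve

open Polynomial LaurentPolynomial

variable {k : Type u} [Field k]

/-- The polynomial describing a section of `𝒪(N)` on a chart of `ℙ¹`. -/
def linePoly (N : ℕ) (i : Fin 2) (s : Γ(lineBundle k 1 N, ⊤)) : k[X] :=
  (polyEquiv k i).symm ((lineFrame k 1 N i).app le_rfl (res _ le_top s))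

theorem polyEquiv_linePoly (N : ℕ) (i : Fin 2) (s : Γ(lineBundle k 1 N, ⊤)) :
    polyEquiv k i (linePoly N i s) = (lineFrame k 1 N i).app le_rfl (res _ le_top s) :=
  (polyEquiv k i).apply_symm_apply _

theorem toLaurent_linePoly (N : ℕ) (s : Γ(lineBundle k 1 N, ⊤)) :
    toLaurent (linePoly N 0 s) = T N * invert (toLaurent (linePoly N 1 s)) := by
  apply (overlapEquiv k).injective
  rw [map_mul, overlapEquiv_T_natCast, overlapEquiv_toLaurent, overlapEquiv_invert]
  have h := lineTriv_rel N (Q := chartOverlap k) (i := 0) (l := 1) inf_le_left inf_le_right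
    (res _ le_top s)
  rw [Int.toNat_neg_natCast, pow_zero, one_mul, Int.toNat_natCast] at h
  have e0 := (lineFrame k 1 N 0).res le_rfl (inf_le_left : chartOverlap k ≤ chart k 0) (res _ le_top s)
  have e1 := (lineFrame k 1 N 1).res le_rfl (inf_le_right : chartOverlap k ≤ chart k 1) (res _ le_top s)
  rw [res_res] at e0 e1
  refine (congrArg (resFun _) (polyEquiv_linePoly N 0 s)).trans (e0.symm.trans (h.trans ?_))
  exact congrArg (fun x => _ * x) (e1.trans (congrArg (resFun _) (polyEquiv_linePoly N 1 s)).symm)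

theorem linePoly_injective (N : ℕ) : Function.Injective (linePoly (k := k) N 0) := by
  intro s t h
  have h1 : linePoly N 1 s = linePoly N 1 t := by
    have hs := toLaurent_linePoly N s
    rw [h, toLaurent_linePoly N t] at hs
    exact (toLaurent_injective (invert.injective (isUnit_T _ |>.mul_left_cancel hs))).symm
  have key (i : Fin 2) (hi : linePoly N i s = linePoly N i t) :
      res (lineBundle k 1 N) (le_top : chart k i ≤ ⊤) s = res _ le_top t := by
    apply ((lineFrame k 1 N i).bijective le_rfl).1
    rw [← polyEquiv_linePoly, ← polyEquiv_linePoly, hi]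
  exact res_eq_of_cover _ (chart k) ⊤ (fun _ => le_top) top_le_iSup_chart _ _
    (Fin.forall_fin_two.2 ⟨key 0 h, key 1 h1⟩)

theorem linePoly_mem (N : ℕ) (s : Γ(lineBundle k 1 N, ⊤)) : linePoly N 0 s ∈ degreeLT k (N + 1) := by
  have h := mem_degreeLT_of_toLaurent_eq (toLaurent_linePoly N s)
  rwa [show ((N : ℤ) + 1).toNat = N + 1 by lia] at h

variable {N : ℕ} {i : PSpace k 1 ⟶ PSpace k N}

theorem linePoly_pullForm_linearForm (hi : i.IsOver (Spec (.of k)))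
    (θ : pullbackBundle i 1 ≅ lineBundle k 1 N) (a : Fin 2) (c : Fin (N + 1) → k) :
    linePoly N a (θ.hom.app ⊤ (pullForm i (linearForm c))) =
      ∑ m, c m • linePoly N a (θ.hom.app ⊤ (pullForm i (linearForm (Pi.single m 1)))) := by
  apply (polyEquiv k a).injective
  have h := ((lineFrame k 1 N a).ofIso θ).coords_eq_sum i hi c
  have h1 (c) : ((lineFrame k 1 N a).ofIso θ).coords i c = polyEquiv k a
      (linePoly N a (θ.hom.app ⊤ (pullForm i (linearForm c)))) := by
    rw [polyEquiv_linePoly, Frame.coords, Frame.ofIso_app, hom_app_res]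
  simp only [h1] at h
  rw [h, map_sum]
  refine Finset.sum_congr rfl fun m _ => ?_
  rw [Algebra.smul_def, map_mul, polyEquiv_algebraMap]

theorem hasCoords_linePoly (hi : i.IsOver (Spec (.of k)))
    (θ : pullbackBundle i 1 ≅ lineBundle k 1 N) (a : Fin 2) : HasCoords i (chart k a) fun m =>
      polyEquiv k a (linePoly N a (θ.hom.app ⊤ (pullForm i (linearForm (Pi.single m 1))))) := by
  have h := ((lineFrame k 1 N a).ofIso θ).hasCoords i hi
  have h1 (c) : ((lineFrame k 1 N a).ofIso θ).coords i c = polyEquiv k a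
      (linePoly N a (θ.hom.app ⊤ (pullForm i (linearForm c)))) := by
    rw [polyEquiv_linePoly, Frame.coords, Frame.ofIso_app, hom_app_res]
  simpa only [h1] using h

/-- A rational normal curve is given by a basis of the polynomials of degree at most `N`. -/
theorem IsRationalNormalCurve.exists_polynomials (hi : IsRationalNormalCurve i) :
    ∃ F G : Fin (N + 1) → k[X], HasCoords i (chart k 0) (fun m => polyEquiv k 0 (F m)) ∧
      HasCoords i (chart k 1) (fun m => polyEquiv k 1 (G m)) ∧
      (∀ m, toLaurent (F m) = T N * invert (toLaurent (G m))) ∧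
      Submodule.span k (Set.range F) = degreeLT k (N + 1) ∧
      Function.Surjective (linearForm : (Fin (N + 1) → k) → _) := by
  obtain ⟨⟨hi', -, ⟨θ⟩⟩, hn⟩ := hi
  let P (a : Fin 2) (s : Γ(lineBundle k N 1, ⊤)) := linePoly N a (θ.hom.app ⊤ (pullForm i s))
  have hinj : Function.Injective (P 0) :=
    (linePoly_injective N).comp ((iso_app_bijective θ ⊤).1.comp hn)
  have hlin (c) : P 0 (linearForm c) = ∑ m, c m • P 0 (linearForm (Pi.single m 1)) :=
    linePoly_pullForm_linearForm hi' θ 0 c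
  let F (m : Fin (N + 1)) := P 0 (linearForm (Pi.single m 1))
  have hspan : Submodule.span k (Set.range F) = degreeLT k (N + 1) := by
    have hle : Submodule.span k (Set.range F) ≤ degreeLT k (N + 1) := by
      rw [Submodule.span_le]
      rintro _ ⟨m, rfl⟩
      exact linePoly_mem N _
    have hF : LinearIndependent k F := by
      rw [Fintype.linearIndependent_iff]
      intro c hc
      have h0 : c = 0 := linearForm_injective (hinj (by
        rw [hlin, hlin]
        simpa using hc))
      exact congrFun h0
    have : Module.Finite k (degreeLT k (N + 1)) := .equiv (degreeLTEquiv k (N + 1)).symm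
    refine Submodule.eq_of_le_of_finrank_eq hle ?_
    rw [finrank_span_eq_card hF, (degreeLTEquiv k (N + 1)).finrank_eq]
    simp
  refine ⟨F, fun m => P 1 (linearForm (Pi.single m 1)), hasCoords_linePoly hi' θ 0,
    hasCoords_linePoly hi' θ 1, fun m => toLaurent_linePoly N _, hspan, fun s => ?_⟩
  -- By nondegeneracy `H⁰(ℙᴺ, 𝒪(1))` injects into the polynomials of degree at most `N`, and the
  -- images of the `N + 1` coordinates already span these. So every section of `𝒪(1)` is a linear
  -- form, with no separate computation of the sections on `ℙᴺ`.
  have hs : P 0 s ∈ Submodule.span k (Set.range F) := hspan ▸ linePoly_mem N _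
  obtain ⟨c, hc⟩ := (Submodule.mem_span_range_iff_exists_fun k).1 hs
  exact ⟨c, hinj ((hlin c).trans hc)⟩

end rationalNormalCurve

/-! ### Composition with the inclusion of a linear subspace -/

section linearEmbedding

open Polynomial LaurentPolynomial

variable {k : Type u} [Field k] {N M : ℕ}

theorem le_iSup_basicOpen_of_hasCoords {X : Scheme.{u}} {f : X ⟶ PSpace k M} {U : X.Opens}
    {F : Fin (M + 1) → Γ(X, U)} (h : HasCoords f U F) : U ≤ ⨆ l, X.basicOpen (F l) := by
  refine (le_iSup_inf_pchart f U).trans (iSup_mono fun l => ?_)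
  exact basicOpen_of_isUnit (h l _ inf_le_left inf_le_right).1

/-- The coordinates have no common zero on the affine set `U`, so they generate the unit ideal and
no homomorphism to a nontrivial ring kills all of them. -/
theorem exists_ne_zero_of_hasCoords {X : Scheme.{u}} {f : X ⟶ PSpace k M} {U : X.Opens}
    (hU : IsAffineOpen U) {F : Fin (M + 1) → Γ(X, U)} (h : HasCoords f U F) {R : Type*} [CommRing R]
    [Nontrivial R] (φ : Γ(X, U) →+* R) : ∃ l, φ (F l) ≠ 0 := by
  by_contra! hφ
  have h1 : Ideal.span (Set.range F) = ⊤ := by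
    rw [← hU.self_le_iSup_basicOpen_iff, iSup_range']
    exact le_iSup_basicOpen_of_hasCoords h
  have h2 : Ideal.span (Set.range F) ≤ RingHom.ker φ := by
    rw [Ideal.span_le]
    rintro _ ⟨l, rfl⟩
    exact hφ l
  exact RingHom.ker_ne_top φ (top_le_iff.1 (h1 ▸ h2))

variable {ℓ : PSpace k N ⟶ PSpace k M}

/-- The coordinates of `ℙᴹ` pull back to sections of `𝒪(1)` on `ℙᴺ`, which are linear forms by `hs`.
Their coefficients are the rows of the matrix. -/
theorem IsEmbeddingOfDegree.exists_coeff (hℓ : IsLinearEmbedding ℓ)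
    (hs : Function.Surjective (linearForm : (Fin (N + 1) → k) → _)) :
    ∃ A : Fin (M + 1) → Fin (N + 1) → k, ∀ i, HasCoords ℓ (chart k i)
      fun l => linearRatio (𝟙 _) i (le_refl (pchart (𝟙 (PSpace k N)) i)) (A l) := by
  obtain ⟨hk, -, ⟨θ⟩⟩ := hℓ
  choose A hA using fun l => hs (θ.hom.app ⊤ (pullForm ℓ (linearForm (Pi.single l 1))))
  refine ⟨A, fun i => ?_⟩
  have h := ((lineFrame k N 1 i).ofIso θ).hasCoords ℓ hk
  have h1 (l) : ((lineFrame k N 1 i).ofIso θ).coords ℓ (Pi.single l 1) =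
      linearRatio (𝟙 _) i (le_refl (pchart (𝟙 (PSpace k N)) i)) (A l) := by
    rw [← lineFrame_linearForm, hA, Frame.coords, Frame.ofIso_app, hom_app_res]
  exact (congrArg (HasCoords ℓ (chart k i)) (funext h1)).mp h

/-- A nonzero vector killed by the matrix would be a point of `ℙᴺ` at which all coordinates of its
image vanish. Hence the matrix is injective. -/
theorem exists_left_inverse_of_hasCoords {A : Fin (M + 1) → Fin (N + 1) → k}
    (hA : ∀ i, HasCoords ℓ (chart k i)
      fun l => linearRatio (𝟙 _) i (le_refl (pchart (𝟙 (PSpace k N)) i)) (A l)) :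
    ∃ B : Matrix (Fin (N + 1)) (Fin (M + 1)) k, B * Matrix.of A = 1 := by
  have hinj : LinearMap.ker (Matrix.toLin' (Matrix.of A)) = ⊥ := by
    rw [LinearMap.ker_eq_bot']
    intro v hv
    by_contra h0
    obtain ⟨i, hi⟩ := Function.ne_iff.1 h0
    have hu : IsUnit (v i) := isUnit_iff_ne_zero.2 hi
    obtain ⟨l, hl⟩ := exists_ne_zero_of_hasCoords (isAffineOpen_chart i) (hA i)
      (chartLift (RingHom.id k) v i hu)
    refine hl (hu.mul_left_eq_zero.1 ?_)
    rw [chartLift_linearRatio]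
    exact congrFun hv l
  obtain ⟨g, hg⟩ := LinearMap.exists_leftInverse_of_injective _ hinj
  refine ⟨LinearMap.toMatrix' g, ?_⟩
  rw [← LinearMap.toMatrix'_toLin' (Matrix.of A), ← LinearMap.toMatrix'_comp, hg,
    LinearMap.toMatrix'_id]

/-- The coordinates of the composition with the inclusion of a linear subspace. -/
theorem HasCoords.comp_linear {A : Fin (M + 1) → Fin (N + 1) → k}
    (hA : ∀ i, HasCoords ℓ (chart k i)
      fun l => linearRatio (𝟙 _) i (le_refl (pchart (𝟙 (PSpace k N)) i)) (A l))
    {X : Scheme.{u}} [X.Over (Spec (.of k))] {i : X ⟶ PSpace k N} (hi : i.IsOver (Spec (.of k)))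
    {U : X.Opens} {F : Fin (N + 1) → Γ(X, U)} (hF : HasCoords i U F) :
    HasCoords (i ≫ ℓ) U fun l => ∑ m, scalarsOn k X U (A l m) * F m := by
  refine HasCoords.of_cover (fun m => U ⊓ pchart i m) (fun _ => inf_le_left)
    (le_iSup_inf_pchart i U) fun m => ?_
  have h := ((hA m).comp i (W := U ⊓ pchart i m) inf_le_right).smul
    (hF m (U ⊓ pchart i m) inf_le_left inf_le_right).1
  convert! h using 2 with l
  have e := pullFun_linearRatio (𝟙 _) (le_refl (pchart (𝟙 (PSpace k N)) m)) (A l) i hi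
    (W := U ⊓ pchart i m) inf_le_right (show _ ≤ pchart (i ≫ 𝟙 _) m from inf_le_right)
  rw [← hF.linearRatio_mul i (hV := inf_le_right) (A l) inf_le_left, mul_comm]
  refine congrArg (fun x => _ * x) (Eq.trans ?_ e.symm)
  exact linearRatio_congr (Category.comp_id i).symm _ _ _

/-- The matrix of the linear inclusion is applied to the coordinates of the curve. Its left inverse
recovers the latter, so the span is unchanged. -/
theorem exists_polynomial_coords {i : PSpace k 1 ⟶ PSpace k N} (hi : IsRationalNormalCurve i)
    (hℓ : IsLinearEmbedding ℓ) : ∃ F G : Fin (M + 1) → k[X],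
      HasCoords (i ≫ ℓ) (chart k 0) (fun m => polyEquiv k 0 (F m)) ∧
      HasCoords (i ≫ ℓ) (chart k 1) (fun m => polyEquiv k 1 (G m)) ∧
      (∀ m, toLaurent (F m) = T N * invert (toLaurent (G m))) ∧
      Submodule.span k (Set.range F) = degreeLT k (N + 1) := by
  obtain ⟨F, G, hF, hG, hFG, hspan, hs⟩ := hi.exists_polynomials
  obtain ⟨A, hA⟩ := hℓ.exists_coeff hs
  obtain ⟨B, hB⟩ := exists_left_inverse_of_hasCoords hA
  have key (a : Fin 2) (H : Fin (N + 1) → k[X]) (hH : HasCoords i (chart k a) fun m => polyEquiv k a (H m)) :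
      HasCoords (i ≫ ℓ) (chart k a) fun l => polyEquiv k a (∑ m, A l m • H m) := by
    have := HasCoords.comp_linear hA hi.isEmbedding.isOver hH
    convert! this using 2 with l
    rw [map_sum]
    refine Finset.sum_congr rfl fun m _ => ?_
    rw [Algebra.smul_def, map_mul, polyEquiv_algebraMap]
  refine ⟨fun l => ∑ m, A l m • F m, fun l => ∑ m, A l m • G m, key 0 F hF, key 1 G hG,
    fun l => ?_, le_antisymm ?_ ?_⟩
  · rw [map_sum, map_sum, map_sum, Finset.mul_sum]
    refine Finset.sum_congr rfl fun m _ => ?_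
    rw [Polynomial.smul_eq_C_mul, Polynomial.smul_eq_C_mul, map_mul, map_mul, map_mul, hFG,
      toLaurent_C, invert_C, mul_left_comm]
  · rw [← hspan, Submodule.span_le]
    rintro _ ⟨l, rfl⟩
    exact Submodule.sum_mem _ fun m _ => Submodule.smul_mem _ _ (Submodule.subset_span ⟨m, rfl⟩)
  · rw [← hspan, Submodule.span_le]
    rintro _ ⟨m, rfl⟩
    have h : F m = ∑ l, B m l • ∑ m', A l m' • F m' := by
      simp only [Finset.smul_sum, smul_smul]
      rw [Finset.sum_comm]
      simp only [← Finset.sum_smul]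
      have h1 (m') : ∑ l, B m l * A l m' = (1 : Matrix _ _ k) m m' := by
        rw [← hB]
        rfl
      simp [h1, Matrix.one_apply]
    rw [h]
    exact Submodule.sum_mem _ fun l _ => Submodule.smul_mem _ _ (Submodule.subset_span ⟨l, rfl⟩)

end linearEmbedding

/-! ### Closed immersions from a rope, checked on stalks -/

section stalks

variable {X Y : Scheme.{u}}

theorem germ_resFun {U V : X.Opens} (h : V ≤ U) {x : X} (hx : x ∈ V) (s : Γ(X, U)) :
    X.presheaf.germ V x hx (resFun h s) = X.presheaf.germ U x (h hx) s :=
  X.presheaf.germ_res_apply (homOfLE h) x hx s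

theorem stalkMap_germ_pullFun (f : X ⟶ Y) {U : Y.Opens} {V : X.Opens} (e : V ≤ f ⁻¹ᵁ U) {x : X}
    (hx : x ∈ V) (s : Γ(Y, U)) : (f.stalkMap x).hom (Y.presheaf.germ U (f x) (e hx) s) =
      X.presheaf.germ V x hx (pullFun f e s) := by
  have h : pullFun f e s = resFun e (f.app U s) := by
    rw [← pullFun_id_res f le_rfl e]
    unfold pullFun
    rw [Scheme.Hom.app_eq_appLE]
  rw [h, germ_resFun]
  exact Scheme.Hom.germ_stalkMap_apply f U x (e hx) s

theorem exists_germ_eq {x : X} {D : X.Opens} (hx : x ∈ D) (z : X.presheaf.stalk x) :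
    ∃ (V : X.Opens) (hV : x ∈ V) (s : Γ(X, V)), IsAffineOpen V ∧ V ≤ D ∧
      X.presheaf.germ V x hV s = z := by
  obtain ⟨W, hxW, s, rfl⟩ := X.presheaf.exists_germ_eq z
  obtain ⟨V, hV, hxV, hVW⟩ := exists_isAffineOpen_mem_and_subset (x := x) (U := W ⊓ D) ⟨hxW, hx⟩
  have h1 : V ≤ W := fun y hy => (hVW hy).1
  exact ⟨V, hxV, resFun h1 s, hV, fun y hy => (hVW hy).2, germ_resFun h1 hxV s⟩

/-- A subring that maps onto the quotient by an ideal of square zero and contains generators of the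
ideal is everything. -/
theorem subring_eq_top_of_sq_zero {S : Type*} [CommRing S] (B : Subring S) (I : Ideal S)
    (hI : ∀ x ∈ I, ∀ y ∈ I, x * y = 0) (hB : ∀ s, ∃ b ∈ B, s - b ∈ I) (E : Set S) (hE : E ⊆ B)
    (hEI : E ⊆ I) (hIE : I ≤ Ideal.span E) : B = ⊤ := by
  have h : ∀ z ∈ Ideal.span E, z ∈ B ∧ z ∈ I := by
    intro z hz
    induction hz using Submodule.span_induction with
    | mem x hx => exact ⟨hE hx, hEI hx⟩
    | zero => exact ⟨B.zero_mem, I.zero_mem⟩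
    | add x y _ _ hx hy => exact ⟨B.add_mem hx.1 hy.1, I.add_mem hx.2 hy.2⟩
    | smul s x _ hx =>
      obtain ⟨b, hb, hsb⟩ := hB s
      have e : s * x = b * x := by
        rw [← sub_eq_zero, ← sub_mul]
        exact hI _ hsb _ hx.2
      exact ⟨by rw [smul_eq_mul, e]; exact B.mul_mem hb hx.1, I.mul_mem_left s hx.2⟩
  rw [eq_top_iff]
  intro s _
  obtain ⟨b, hb, hsb⟩ := hB s
  rw [← sub_add_cancel s b]
  exact B.add_mem (h _ (hIE hsb)).1 hb

variable {X Y' Z : Scheme.{u}} {ι : X ⟶ Y'} {hι : IsHomeomorph ι}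

theorem mem_img (hι : IsHomeomorph ι) {V : X.Opens} {x : X} (hx : x ∈ V) : ι x ∈ img hι V :=
  ⟨x, hx, rfl⟩

theorem exists_germ_eq_of_stalkMap_eq_zero {x : X} {D : X.Opens} (hx : x ∈ D)
    (z : Y'.presheaf.stalk (ι x)) (hz : (ι.stalkMap x).hom z = 0) :
    ∃ (V : X.Opens) (hV : x ∈ V) (s : Γ(Y', img hι V)), IsAffineOpen V ∧ V ≤ D ∧ red hι V s = 0 ∧
      Y'.presheaf.germ (img hι V) (ι x) (mem_img hι hV) s = z := by
  obtain ⟨W, hxW, s, -, -, rfl⟩ := exists_germ_eq (D := ⊤) (show ι x ∈ ⊤ from trivial) z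
  have h := stalkMap_germ_pullFun ι (le_refl (ι ⁻¹ᵁ W)) hxW s
  rw [hz, ← map_zero (X.presheaf.germ (ι ⁻¹ᵁ W) x hxW).hom] at h
  obtain ⟨V', hxV', i₁, i₂, h'⟩ := X.presheaf.germ_eq x hxW hxW _ _ h
  obtain ⟨V, hV, hxV, hVW⟩ := exists_isAffineOpen_mem_and_subset (x := x) (U := V' ⊓ D) ⟨hxV', hx⟩
  have h1 : V ≤ V' := fun y hy => (hVW hy).1
  have h2 : img hι V ≤ W := by
    rintro _ ⟨y, hy, rfl⟩
    exact i₁.le (h1 hy)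
  refine ⟨V, hxV, resFun h2 s, hV, fun y hy => (hVW hy).2, ?_, germ_resFun h2 _ s⟩
  have h3 : resFun i₁.le 0 = resFun i₁.le (pullFun ι (le_refl (ι ⁻¹ᵁ W)) s) := h'
  rw [map_zero] at h3
  rw [red, pullFun_resFun ι h2 _ (le_refl (ι ⁻¹ᵁ W)) (h1.trans i₁.le), ← resFun_resFun i₁.le h1,
    ← h3, map_zero]

theorem RopeChart.mul_eq_zero {D V : X.Opens} (R : RopeChart hι D) (hV : V ≤ D)
    {s t : Γ(Y', img hι V)} (hs : red hι V s = 0) (ht : red hι V t = 0) : s * t = 0 := by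
  obtain ⟨u, rfl⟩ := (R.ker hV t).1 ht
  have h := R.add hV 0 0
  rw [add_zero, right_eq_add] at h
  rw [R.smul, hs, ← h]
  congr 1
  ext c
  simp

theorem RopeChart.stalk_mul_eq_zero {D : X.Opens} (R : RopeChart hι D) {x : X} (hx : x ∈ D)
    {z w : Y'.presheaf.stalk (ι x)} (hz : (ι.stalkMap x).hom z = 0)
    (hw : (ι.stalkMap x).hom w = 0) : z * w = 0 := by
  obtain ⟨V, hV, s, -, hVD, hs, rfl⟩ := exists_germ_eq_of_stalkMap_eq_zero (hι := hι) hx z hz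
  obtain ⟨W, hW, t, -, hWV, ht, rfl⟩ := exists_germ_eq_of_stalkMap_eq_zero (hι := hι) hV w hw
  rw [← germ_resFun (img_mono hι hWV) (mem_img hι hW) s, ← map_mul,
    R.mul_eq_zero (hWV.trans hVD) _ ht, map_zero]
  rw [red_res hι hWV, hs, map_zero]

/-- A kernel germ lives over a small affine `V`, where it is a vector of functions on the reduced
scheme. Lifting these functions to the rope expresses it through the two basis vectors, which are
defined over all of `D`. -/
theorem RopeChart.mem_span_of_stalkMap_eq_zero [IsClosedImmersion ι] {D : X.Opens}
    (R : RopeChart hι D) {x : X} (hx : x ∈ D) {z : Y'.presheaf.stalk (ι x)}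
    (hz : (ι.stalkMap x).hom z = 0) : z ∈ Ideal.span (Set.range fun u =>
      Y'.presheaf.germ (img hι D) (ι x) (mem_img hι hx) (R.j le_rfl u)) := by
  obtain ⟨V, hV, s, hVa, hVD, hs, rfl⟩ := exists_germ_eq_of_stalkMap_eq_zero (hι := hι) hx z hz
  obtain ⟨u, rfl⟩ := (R.ker hVD _).1 hs
  -- The trivialization restricted to the affine set `V`, so that functions on `V` lift.
  let R' : RopeChart hι V :=
    { j := fun h => R.j (h.trans hVD)
      add := fun h => R.add (h.trans hVD)
      inj := fun h => R.inj (h.trans hVD)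
      res := fun h => R.res (h.trans hVD)
      smul := fun h => R.smul (h.trans hVD)
      ker := fun h => R.ker (h.trans hVD) }
  choose t ht using fun c => red_surjective R' hVa (u c)
  have h1 : R.j hVD u = ∑ c, t c * resFun (img_mono hι hVD) (R.j le_rfl (Pi.single c 1)) := by
    have h2 (c) : t c * resFun (img_mono hι hVD) (R.j le_rfl (Pi.single c 1)) =
        R.j hVD (Pi.single c (u c)) := by
      rw [R.res le_rfl hVD, R.smul]
      congr 1
      ext1 d
      rw [ht]
      obtain rfl | hd := eq_or_ne d c
      · simp
      · simp [Pi.single_eq_of_ne hd]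
    rw [Fin.sum_univ_two, h2, h2, ← R.add]
    congr 1
    ext1 c
    fin_cases c <;> simp
  rw [h1, map_sum]
  refine Submodule.sum_mem _ fun c _ => ?_
  rw [map_mul, germ_resFun]
  exact Ideal.mul_mem_left _ _ (Ideal.subset_span ⟨_, rfl⟩)

/-- A morphism from a rope is a closed immersion if it is one on the reduced subscheme and if
generators of the conormal sheaf are in the image of the stalk maps. -/
theorem isClosedImmersion_of_ropeChart [IsClosedImmersion ι] (j : Y' ⟶ Z)
    (hj : IsClosedImmersion (ι ≫ j)) (h : ∀ x : X, ∃ (D : X.Opens) (hx : x ∈ D) (R : RopeChart hι D),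
      ∀ u, Y'.presheaf.germ (img hι D) (ι x) (mem_img hι hx) (R.j le_rfl u) ∈
        (j.stalkMap (ι x)).hom.range) : IsClosedImmersion j where
  isClosedEmbedding := by
    have h1 := (ι ≫ j).isClosedEmbedding.comp (hι.homeomorph ι).symm.isClosedEmbedding
    convert h1 using 1
    ext y
    obtain ⟨x, rfl⟩ := hι.surjective y
    change _ = (ι ≫ j) ((hι.homeomorph ι).symm (hι.homeomorph ι x))
    rw [Homeomorph.symm_apply_apply]
    rfl
  stalkMap_surjective y := by
    obtain ⟨x, rfl⟩ := hι.surjective y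
    obtain ⟨D, hx, R, hR⟩ := h x
    change Function.Surjective (j.stalkMap (ι x)).hom
    rw [← RingHom.range_eq_top]
    refine subring_eq_top_of_sq_zero _ (RingHom.ker (ι.stalkMap x).hom) ?_ ?_
      (Set.range fun u => Y'.presheaf.germ (img hι D) (ι x) (mem_img hι hx) (R.j le_rfl u)) ?_ ?_ ?_
    · intro z hz w hw
      exact R.stalk_mul_eq_zero hx hz hw
    · intro s
      -- Modulo the kernel of the map to the reduced stalk, surjectivity is that of the composite
      -- closed immersion.
      obtain ⟨t, ht⟩ := (ι ≫ j).stalkMap_surjective x ((ι.stalkMap x).hom s)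
      refine ⟨(j.stalkMap (ι x)).hom t, ⟨t, rfl⟩, ?_⟩
      rw [RingHom.mem_ker, map_sub, ← ht, sub_eq_zero]
      exact congrArg (fun g => g.hom t) (Scheme.Hom.stalkMap_comp ι j x)
    · rintro _ ⟨u, rfl⟩
      exact hR u
    · rintro _ ⟨u, rfl⟩
      change (ι.stalkMap x).hom _ = 0
      refine (stalkMap_germ_pullFun ι (le_preimage_img hι D) hx (R.j le_rfl u)).trans ?_
      have : red hι D (R.j le_rfl u) = 0 := (R.ker le_rfl _).2 ⟨u, rfl⟩
      exact (congrArg _ this).trans (map_zero _)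
    · intro z hz
      exact R.mem_span_of_stalkMap_eq_zero hx hz

end stalks

/-! ### Ratios of sections lie in the image of the stalk maps -/

section generation

variable {k : Type u} [Field k] {n : ℕ} {Y : Scheme.{u}} [Y.Over (Spec (.of k))]
  {f : Y ⟶ PSpace k n} (hf : f.IsOver (Spec (.of k))) {U : Y.Opens} {F : Fin (n + 1) → Γ(Y, U)}

attribute [local instance] sectionsAlgebra

include hf in
theorem germ_scalarsOn_mem_range {x : Y} (hx : x ∈ U) (c : k) :
    Y.presheaf.germ U x hx (scalarsOn k Y U c) ∈ (f.stalkMap x).hom.range := by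
  have e : U ≤ f ⁻¹ᵁ ⊤ := fun _ _ => trivial
  refine ⟨(PSpace k n).presheaf.germ ⊤ (f x) trivial (scalarsOn k _ ⊤ c), ?_⟩
  rw [← pullFun_scalarsOn f hf e]
  exact stalkMap_germ_pullFun f e hx _

include hf in
theorem germ_linearRatio_mem_range {l : Fin (n + 1)} {V : Y.Opens} (hV : V ≤ pchart f l) {x : Y}
    (hx : x ∈ V) (c : Fin (n + 1) → k) :
    Y.presheaf.germ V x hx (linearRatio f l hV c) ∈ (f.stalkMap x).hom.range := by
  rw [linearRatio, map_sum]
  refine Subring.sum_mem _ fun m _ => ?_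
  rw [map_mul]
  refine Subring.mul_mem _ (germ_scalarsOn_mem_range hf hx _) ?_
  refine ⟨(PSpace k n).presheaf.germ (chart k l) (f x) (hV hx) (coordRatio k l m), ?_⟩
  rw [ratio_eq_pullFun]
  exact stalkMap_germ_pullFun f hV hx _

/-- A preimage of a unit under a local homomorphism is a unit, so the quotient `b / a` can be formed
already in the source. -/
theorem inv_mem_range_of_isLocalHom {R S : Type*} [CommRing R] [CommRing S] (φ : R →+* S)
    [IsLocalHom φ] {a b y : S} (ha : a ∈ φ.range) (hb : b ∈ φ.range) (hu : IsUnit a)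
    (h : y * a = b) : y ∈ φ.range := by
  obtain ⟨a, rfl⟩ := ha
  obtain ⟨b, rfl⟩ := hb
  obtain ⟨a', ha'⟩ := (isUnit_of_map_unit φ a hu).exists_right_inv
  refine ⟨b * a', ?_⟩
  rw [map_mul, ← h, mul_assoc, ← map_mul, ha', map_one, mul_one]

include hf in
/-- Ratios of linear combinations of the coordinates come from projective space. -/
theorem HasCoords.germ_ratio_mem_range (h : HasCoords f U F) {x : Y} (hx : x ∈ U)
    {c d : Fin (n + 1) → k} (hc : IsUnit (∑ l, scalarsOn k Y U (c l) * F l)) {y : Γ(Y, U)}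
    (hy : y * ∑ l, scalarsOn k Y U (c l) * F l = ∑ l, scalarsOn k Y U (d l) * F l) :
    Y.presheaf.germ U x hx y ∈ (f.stalkMap x).hom.range := by
  obtain ⟨l, hl⟩ := Opens.mem_iSup.1 (le_iSup_inf_pchart f U hx)
  have h1 (c) := h.linearRatio_mul f (V := U ⊓ pchart f l) inf_le_right c inf_le_left
  have hu := (h l (U ⊓ pchart f l) inf_le_left inf_le_right).1
  have hc' := hc.map (resFun (inf_le_left : U ⊓ pchart f l ≤ U))
  have hy' := congrArg (resFun (inf_le_left : U ⊓ pchart f l ≤ U)) hy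
  rw [← h1] at hc'
  rw [map_mul, ← h1, ← h1, ← mul_assoc] at hy'
  have hy2 := congrArg (Y.presheaf.germ _ x hl) (hu.mul_right_cancel hy')
  rw [map_mul, germ_resFun] at hy2
  exact inv_mem_range_of_isLocalHom (f.stalkMap x).hom (germ_linearRatio_mem_range hf _ hl c)
    (germ_linearRatio_mem_range hf _ hl d) ((isUnit_of_mul_isUnit_left hc').map _) hy2

include hf in
theorem HasCoords.germ_mem_range_of_mem_ratios (h : HasCoords f U F) {x : Y} (hx : x ∈ U)
    {w : Γ(Y, U)} (hu : IsUnit w) (hw : w ∈ Submodule.span k (Set.range F)) {y : Γ(Y, U)}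
    (hy : y ∈ Thickening.ratios (k := k) (Submodule.span k (Set.range F) : Set Γ(Y, U)) w) :
    Y.presheaf.germ U x hx y ∈ (f.stalkMap x).hom.range := by
  obtain ⟨c, rfl⟩ := (Submodule.mem_span_range_iff_exists_fun k).1 hw
  have hsum (c : Fin (n + 1) → k) : ∑ l, c l • F l = ∑ l, scalarsOn k Y U (c l) * F l := rfl
  induction hy using Algebra.adjoin_induction with
  | mem y hy =>
    obtain ⟨d, hd⟩ := (Submodule.mem_span_range_iff_exists_fun k).1 hy
    rw [hsum] at hu hd
    rw [hsum] at hd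
    exact h.germ_ratio_mem_range hf hx hu hd.symm
  | algebraMap c => exact germ_scalarsOn_mem_range hf hx c
  | add y z _ _ hy hz => rw [map_add]; exact Subring.add_mem _ hy hz
  | mul y z _ _ hy hz => rw [map_mul]; exact Subring.mul_mem _ hy hz

end generation

/-! ### Lifting coordinates to the rope and extending the morphism -/

section ropeMorphism

open Polynomial LaurentPolynomial

namespace GluingData

variable {k A₀ A₁ A : Type*} [Field k] [CommRing A₀] [CommRing A₁] [CommRing A] [Algebra k A₀]
  [Algebra k A₁] [Algebra k A] {w : Fin 2 → ℤ} (D : GluingData k w A₀ A₁ A)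

/-- Sections that lift given polynomials and span a space of sections whose ratios generate the
square-zero ideals. -/
theorem exists_generating_sections [Infinite k] (hw : w 1 ≤ w 0) {N : ℕ} (hN : 4 ≤ N)
    (hwN : ∀ c, w c ≤ N + 1) {n : ℕ} (hn : n = N + Module.finrank k (splitSections k w N))
    (F : Fin (n + 1) → k[X]) (hF : Submodule.span k (Set.range F) = degreeLT k (N + 1)) :
    ∃ (g : A) (v₀ : Fin (n + 1) → A₀) (v₁ : Fin (n + 1) → A₁), IsUnit g ∧ D.t.p g = T N ∧
      (∀ l, D.t₀.p (v₀ l) = F l) ∧ (∀ l, D.r₀ (v₀ l) = g * D.r₁ (v₁ l)) ∧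
      (∀ x₀ x₁, D.r₀ x₀ = g * D.r₁ x₁ → ∃ c : Fin (n + 1) → k,
        ∑ l, c l • v₀ l = x₀ ∧ ∑ l, c l • v₁ l = x₁) ∧
      (∃ w ∈ Submodule.span k (Set.range v₀), IsUnit w ∧
        ∀ u, D.t₀.j u ∈ Thickening.ratios (k := k) (Submodule.span k (Set.range v₀) : Set A₀) w) ∧
      (∃ w ∈ Submodule.span k (Set.range v₁), IsUnit w ∧
        ∀ u, D.t₁.j u ∈ Thickening.ratios (k := k) (Submodule.span k (Set.range v₁) : Set A₁) w) := by
  obtain ⟨g, hg, hgN, hm, ⟨f₀, hf₀, hp₀, hj₀⟩, ⟨f₁, hf₁, hp₁, hj₁⟩⟩ := D.exists_twist hw hN hwN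
  obtain ⟨v, hv, hspan⟩ := D.exists_spanning_sections hgN hm hn F hF
  have h₀ : Prod.fst '' (D.sections g : Set (A₀ × A₁)) =
      Submodule.span k (Set.range fun l => (v l).1) := by
    have := Submodule.map_span (LinearMap.fst k A₀ A₁) (Set.range v)
    rw [hspan, ← Set.range_comp] at this
    exact congrArg (fun S : Submodule k A₀ => (S : Set A₀)) this
  have h₁ : Prod.snd '' (D.sections g : Set (A₀ × A₁)) =
      Submodule.span k (Set.range fun l => (v l).2) := by
    have := Submodule.map_span (LinearMap.snd k A₀ A₁) (Set.range v)
    rw [hspan, ← Set.range_comp] at this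
    exact congrArg (fun S : Submodule k A₁ => (S : Set A₁)) this
  rw [h₀] at hj₀
  rw [h₁] at hj₁
  refine ⟨g, fun l => (v l).1, fun l => (v l).2, hg, hgN, hv, fun l => ?_, fun x₀ x₁ hx => ?_,
    ⟨f₀.1, ?_, D.t₀.isUnit_of_p_eq_one hp₀, hj₀⟩, ⟨f₁.2, ?_, D.t₁.isUnit_of_p_eq_one hp₁, hj₁⟩⟩
  · have : v l ∈ D.sections g := hspan ▸ Submodule.subset_span ⟨l, rfl⟩
    exact this
  · have : (x₀, x₁) ∈ Submodule.span k (Set.range v) := by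
      rw [hspan]
      exact hx
    obtain ⟨c, hc⟩ := (Submodule.mem_span_range_iff_exists_fun k).1 this
    refine ⟨c, ?_, ?_⟩
    · simpa [Prod.fst_sum] using congrArg Prod.fst hc
    · simpa [Prod.snd_sum] using congrArg Prod.snd hc
  · exact h₀.le ⟨f₀, hf₀, rfl⟩
  · exact h₁.le ⟨f₁, hf₁, rfl⟩

end GluingData

variable {k : Type u} [Field k] {n : ℕ} {X Y' : Scheme.{u}} [X.Over (Spec (.of k))]
  [Y'.Over (Spec (.of k))] {ι : X ⟶ Y'} (hιk : ι.IsOver (Spec (.of k))) (hι : IsHomeomorph ι)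

include hιk in
/-- Extension of a morphism to projective space along a homeomorphic closed immersion by extending
its coordinates. -/
theorem exists_extension {f : X ⟶ PSpace k n} (hf : f.IsOver (Spec (.of k))) (U : Fin 2 → X.Opens)
    (hU : ⊤ ≤ iSup U) (F : ∀ a, Fin (n + 1) → Γ(Y', img hι (U a)))
    (hF : ∀ a, HasCoords f (U a) fun l => red hι (U a) (F a l))
    (g : Γ(Y', img hι (U 0) ⊓ img hι (U 1))) (hg : IsUnit g)
    (hgF : ∀ l, resFun inf_le_left (F 0 l) = g * resFun inf_le_right (F 1 l)) :
    ∃ j : Y' ⟶ PSpace k n, j.IsOver (Spec (.of k)) ∧ (∀ a, HasCoords j (img hι (U a)) (F a)) ∧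
      ι ≫ j = f := by
  -- The loci where a lifted coordinate is invertible. They cover the rope, because the coordinates
  -- of `f` have no common zero and `ι` is a homeomorphism.
  let W (x : ULift.{u} (Fin 2 × Fin (n + 1))) : Y'.Opens := Y'.basicOpen (F x.down.1 x.down.2)
  have hWle (x) : W x ≤ img hι (U x.down.1) := Y'.basicOpen_le _
  have hcov (a : Fin 2) : img hι (U a) ≤ ⨆ l, W ⟨a, l⟩ := by
    rintro _ ⟨x, hx, rfl⟩
    obtain ⟨l, hl⟩ := Opens.mem_iSup.1 (le_iSup_basicOpen_of_hasCoords (hF a) hx)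
    refine Opens.mem_iSup.2 ⟨l, ?_⟩
    have h := Scheme.basicOpen_appLE ι (U a) (img hι (U a)) (le_preimage_img hι (U a)) (F a l)
    exact (h.le hl).2
  have hW : ⊤ ≤ iSup W := by
    intro y _
    obtain ⟨x, rfl⟩ := hι.surjective y
    obtain ⟨a, ha⟩ := Opens.mem_iSup.1 (hU (show x ∈ ⊤ from trivial))
    obtain ⟨l, hl⟩ := Opens.mem_iSup.1 (hcov a (mem_img hι ha))
    exact Opens.mem_iSup.2 ⟨⟨a, l⟩, hl⟩
  have hglue (a b : Fin 2) : ∃ g : Γ(Y', img hι (U a) ⊓ img hι (U b)), IsUnit g ∧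
      ∀ l, resFun inf_le_left (F a l) = g * resFun inf_le_right (F b l) := by
    have hself (a : Fin 2) : ∃ g : Γ(Y', img hι (U a) ⊓ img hι (U a)), IsUnit g ∧
      ∀ l, resFun inf_le_left (F a l) = g * resFun inf_le_right (F a l) :=
        ⟨1, isUnit_one, fun l => (one_mul _).symm⟩
    revert a b
    refine Fin.forall_fin_two.2 ⟨Fin.forall_fin_two.2 ⟨hself 0, g, hg, hgF⟩,
      Fin.forall_fin_two.2 ⟨?_, hself 1⟩⟩
    obtain ⟨g', hg'⟩ := hg.exists_left_inv
    have e : img hι (U 1) ⊓ img hι (U 0) ≤ img hι (U 0) ⊓ img hι (U 1) := (inf_comm _ _).le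
    refine ⟨resFun e g', (IsUnit.of_mul_eq_one _ hg').map _, fun l => ?_⟩
    have h := congrArg (fun x => resFun e (g' * x)) (hgF l)
    simp only [← mul_assoc, hg', one_mul] at h
    rw [map_mul, resFun_resFun, resFun_resFun] at h
    exact h.symm
  obtain ⟨j, hj, hjF⟩ := exists_hom_of_cover (k := k) W hW (fun x l => resFun (hWle x) (F x.down.1 l))
    (fun x => x.down.2) (fun x => isUnit_resFun_basicOpen _ _ le_rfl) (fun x y => by
      obtain ⟨g, hg, h⟩ := hglue x.down.1 y.down.1
      have e : W x ⊓ W y ≤ img hι (U x.down.1) ⊓ img hι (U y.down.1) :=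
        inf_le_inf (hWle x) (hWle y)
      refine ⟨resFun e g, hg.map _, fun m => ?_⟩
      have := congrArg (resFun e) (h m)
      rw [map_mul, resFun_resFun, resFun_resFun] at this
      rw [resFun_resFun, resFun_resFun]
      exact this)
  have hjU (a : Fin 2) : HasCoords j (img hι (U a)) (F a) :=
    HasCoords.of_cover (fun l => W ⟨a, l⟩) (fun l => hWle ⟨a, l⟩) (hcov a) fun l => hjF ⟨a, l⟩
  refine ⟨j, (Scheme.Hom.isOver_iff _).2 hj, hjU, ?_⟩
  refine HasCoords.hom_eq U hU (fun a l => red hι (U a) (F a l))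
    (fun a => (hjU a).comp ι (le_preimage_img hι (U a))) hF ?_
  rw [Category.assoc, hj, (Scheme.Hom.isOver_iff _).1 hιk, (Scheme.Hom.isOver_iff _).1 hf]

end ropeMorphism

/-! ### Linear normality in coordinates -/

section linearNormality

variable {k : Type u} [Field k] {n : ℕ} {Y : Scheme.{u}} {j : Y ⟶ PSpace k n}

/-- A section of `j^*𝒪(1)` as a function, with respect to given coordinates. -/
theorem exists_function_of_hasCoords {U : Y.Opens} {F : Fin (n + 1) → Γ(Y, U)} (h : HasCoords j U F)
    (s : Γ(pullbackBundle j 1, ⊤)) : ∃ S : Γ(Y, U), ∀ l (V : Y.Opens) (hV : V ≤ U)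
      (hl : V ≤ pchart j l), resFun hV S =
        (pullbackFrame j 1 l).app hl (res _ le_top s) * resFun hV (F l) := by
  have hrel {l m : Fin (n + 1)} {V : Y.Opens} (hV : V ≤ U) (hl : V ≤ pchart j l)
      (hm : V ≤ pchart j m) : (pullbackFrame j 1 l).app hl (res _ le_top s) * resFun hV (F l) =
        (pullbackFrame j 1 m).app hm (res _ le_top s) * resFun hV (F m) := by
    have h1 : resFun hl (ratio j l m) ^ 0 * (pullbackFrame j 1 l).app hl (res _ le_top s) =
        resFun hl (ratio j l m) ^ 1 * (pullbackFrame j 1 m).app hm (res _ le_top s) :=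
      triv_rel (structureModule Y) 1 (f := j) (i := l) hl hm (res _ le_top s)
    rw [pow_zero, one_mul, pow_one] at h1
    rw [h1, ← (h l V hV hl).2 m]
    ring
  -- The local functions are the component of `s` in the frame `xₗ` multiplied by `Fₗ`. The change
  -- of frame cancels against the ratio of the coordinates.
  obtain ⟨S, hS⟩ := resFun_glue (fun l => U ⊓ pchart j l) U (fun _ => inf_le_left)
    (le_iSup_inf_pchart j U)
    (fun l => (pullbackFrame j 1 l).app inf_le_right (res _ le_top s) * resFun inf_le_left (F l))
    (fun l m => by
      rw [map_mul, map_mul, ← Frame.res, ← Frame.res, res_res, res_res, resFun_resFun,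
        resFun_resFun]
      exact hrel _ _ _)
  refine ⟨S, fun l V hV hl => ?_⟩
  have h2 := congrArg (resFun (le_inf hV hl)) (hS l)
  rwa [resFun_resFun, map_mul, ← Frame.res, res_res, resFun_resFun] at h2

/-- Linear normality in terms of coordinates. -/
theorem isLinearlyNormal_of_coords [Y.Over (Spec (.of k))] (hj : j.IsOver (Spec (.of k)))
    {U₀ U₁ O : Y.Opens} (hU : ⊤ ≤ U₀ ⊔ U₁) (h₀ : O ≤ U₀) (h₁ : O ≤ U₁)
    {F₀ : Fin (n + 1) → Γ(Y, U₀)} {F₁ : Fin (n + 1) → Γ(Y, U₁)} (hF₀ : HasCoords j U₀ F₀)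
    (hF₁ : HasCoords j U₁ F₁) (g : Γ(Y, O)) (hg : ∀ l, resFun h₀ (F₀ l) = g * resFun h₁ (F₁ l))
    (H : ∀ x₀ x₁, resFun h₀ x₀ = g * resFun h₁ x₁ → ∃ c : Fin (n + 1) → k,
      ∑ l, scalarsOn k Y U₀ (c l) * F₀ l = x₀ ∧ ∑ l, scalarsOn k Y U₁ (c l) * F₁ l = x₁) :
    IsLinearlyNormal j := by
  intro s
  change Γ(pullbackBundle j 1, ⊤) at s
  obtain ⟨S₀, hS₀⟩ := exists_function_of_hasCoords hF₀ s
  obtain ⟨S₁, hS₁⟩ := exists_function_of_hasCoords hF₁ s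
  -- The two functions of `s` are related by the same `g` as the coordinates, so `H` writes both
  -- with one set of coefficients `c`.
  obtain ⟨c, hc₀, hc₁⟩ := H S₀ S₁ (by
    refine resFun_eq_of_cover (fun l => O ⊓ pchart j l) O (fun _ => inf_le_left)
      (le_iSup_inf_pchart j O) _ _ fun l => ?_
    have h2 := congrArg (resFun (inf_le_left : O ⊓ pchart j l ≤ O)) (hg l)
    rw [map_mul, resFun_resFun, resFun_resFun] at h2
    rw [map_mul, resFun_resFun, resFun_resFun, hS₀ l _ _ inf_le_right, hS₁ l _ _ inf_le_right, h2]
    ring)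
  refine ⟨linearForm c, ?_⟩
  change pullForm j (linearForm c) = s
  have key {U : Y.Opens} {F : Fin (n + 1) → Γ(Y, U)} (hF : HasCoords j U F) {S : Γ(Y, U)}
      (hS : ∀ l (V : Y.Opens) (hV : V ≤ U) (hl : V ≤ pchart j l), resFun hV S =
        (pullbackFrame j 1 l).app hl (res _ le_top s) * resFun hV (F l))
      (hc : ∑ l, scalarsOn k Y U (c l) * F l = S) :
      res (pullbackBundle j 1) (le_top : U ≤ ⊤) (pullForm j (linearForm c)) = res _ le_top s := by
    refine res_eq_of_cover _ (fun l => U ⊓ pchart j l) U (fun _ => inf_le_left)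
      (le_iSup_inf_pchart j U) _ _ fun l => ?_
    rw [res_res, res_res]
    apply ((pullbackFrame j 1 l).bijective inf_le_right).1
    refine (hF l _ inf_le_left inf_le_right).1.mul_right_cancel ?_
    rw [← hS l _ inf_le_left inf_le_right, pullbackFrame_pullForm j hj, ← hc]
    exact hF.linearRatio_mul j _ c _
  refine res_eq_of_cover _ ![U₀, U₁] ⊤ (fun _ => le_top) ?_ _ _
    (Fin.forall_fin_two.2 ⟨key hF₀ hS₀ hc₀, key hF₁ hS₁ hc₁⟩)
  refine hU.trans (sup_le ?_ ?_)
  · exact le_iSup ![U₀, U₁] 0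
  · exact le_iSup ![U₀, U₁] 1

end linearNormality

/-! ### The embedding of the rope -/

section embedding

open Polynomial LaurentPolynomial

attribute [local instance] sectionsAlgebra

variable {k : Type u} [Field k]

/-- The lifted coordinates form a basis of the sections of a bundle whose ratios generate the
conormal sheaf. Lifting gives the extension, generation gives the closed immersion, and completeness
of the linear system gives linear normality. -/
theorem exists_embedding [Infinite k] {a b : ℤ} (hab : b ≤ a) {Y' : Scheme.{u}}
    [Y'.Over (Spec (.of k))] {ι : PSpace k 1 ⟶ Y'} (hιk : ι.IsOver (Spec (.of k)))
    (hrope : IsRope ι (splitBundle k a b)) {N M : ℕ} (hN : 4 ≤ N) (haN : a ≤ N + 1)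
    (hM : M = N + h0 k (serreTwist (splitBundle k a b) N))
    {f : PSpace k 1 ⟶ PSpace k M} (hf : f.IsOver (Spec (.of k))) (hfc : IsClosedImmersion f)
    {F G : Fin (M + 1) → k[X]} (hF : HasCoords f (chart k 0) fun l => polyEquiv k 0 (F l))
    (hG : HasCoords f (chart k 1) fun l => polyEquiv k 1 (G l))
    (hFG : ∀ l, toLaurent (F l) = T N * invert (toLaurent (G l)))
    (hspan : Submodule.span k (Set.range F) = degreeLT k (N + 1)) :
    ∃ j : Y' ⟶ PSpace k M, j.IsOver (Spec (.of k)) ∧ IsClosedImmersion j ∧ ι ≫ j = f ∧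
      IsLinearlyNormal j := by
  have hι := hrope.isHomeomorph
  have hc := hrope.isClosedImmersion
  obtain ⟨α, hα⟩ := hrope.conormal
  obtain ⟨D, hD⟩ : ∃ D, D = ropeGluingData hιk hc hι α hα := ⟨_, rfl⟩
  rw [h0_serreTwist] at hM
  obtain ⟨g, v₀, v₁, hg, hgN, hv₀, hv, hsec, ⟨w₀, hw₀, hu₀, hj₀⟩, ⟨w₁, hw₁, hu₁, hj₁⟩⟩ :=
    D.exists_generating_sections hab hN (Fin.forall_fin_two.2 ⟨haN, hab.trans haN⟩) hM F hspan
  -- Only the coordinates on the first chart were lifted by construction. Those on the second are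
  -- forced, because the reduction of the transition function is `T ^ N`, the one relating `F` and
  -- `G`.
  have hv₁ (l) : D.t₁.p (v₁ l) = G l := by
    have h := D.p_eq hgN (f := (v₀ l, v₁ l)) (hv l)
    rw [hv₀, hFG] at h
    exact (toLaurent_injective (invert.injective ((isUnit_T _).mul_left_cancel h))).symm
  have hr₀ (l) : red hι (chart k 0) (v₀ l) = polyEquiv k 0 (F l) := by
    rw [← hv₀, hD]
    exact ((polyEquiv k 0).apply_symm_apply _).symm
  have hr₁ (l) : red hι (chart k 1) (v₁ l) = polyEquiv k 1 (G l) := by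
    rw [← hv₁, hD]
    exact ((polyEquiv k 1).apply_symm_apply _).symm
  have hO : img hι (chart k 0) ⊓ img hι (chart k 1) ≤ img hι (chartOverlap k) :=
    (img_inf hι (chart k 0) (chart k 1)).ge
  have hO₀ := img_mono hι (inf_le_left : chartOverlap k ≤ chart k 0)
  have hO₁ := img_mono hι (inf_le_right : chartOverlap k ≤ chart k 1)
  have hv' (l) : resFun hO₀ (v₀ l) = g * resFun hO₁ (v₁ l) := by
    have := hv l
    rw [hD] at this
    exact this
  have hsec' (x₀ x₁) (h : resFun hO₀ x₀ = g * resFun hO₁ x₁) : ∃ c : Fin (M + 1) → k,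
      ∑ l, c l • v₀ l = x₀ ∧ ∑ l, c l • v₁ l = x₁ := by
    refine hsec x₀ x₁ ?_
    rw [hD]
    exact h
  have hgen₀ (u) : (ropeChart hι α hα 0).j le_rfl u ∈
      Thickening.ratios (k := k) (Submodule.span k (Set.range v₀) : Set _) w₀ := by
    have h := hj₀ fun c => (polyEquiv k 0).symm (u c)
    rw [hD] at h
    convert! h using 1
    change _ = (ropeChart hι α hα 0).j le_rfl _
    congr 1
    ext1 c
    exact ((polyEquiv k 0).apply_symm_apply _).symm
  have hgen₁ (u) : (ropeChart hι α hα 1).j le_rfl u ∈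
      Thickening.ratios (k := k) (Submodule.span k (Set.range v₁) : Set _) w₁ := by
    have h := hj₁ fun c => (polyEquiv k 1).symm (u c)
    rw [hD] at h
    convert! h using 1
    change _ = (ropeChart hι α hα 1).j le_rfl _
    congr 1
    ext1 c
    exact ((polyEquiv k 1).apply_symm_apply _).symm
  clear hj₀ hj₁ hsec hv hv₀ hv₁ hgN hD
  let V : ∀ a : Fin 2, Fin (M + 1) → Γ(Y', img hι (chart k a)) :=
    Fin.cons v₀ (Fin.cons v₁ nofun)
  obtain ⟨j, hjk, hjV, hιj⟩ := exists_extension hιk hι hf (chart k) top_le_iSup_chart V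
    (Fin.forall_fin_two.2 ⟨(congrArg (HasCoords f (chart k 0)) (funext hr₀)).mpr hF,
      (congrArg (HasCoords f (chart k 1)) (funext hr₁)).mpr hG⟩)
    (resFun hO g) (hg.map _) (fun l => by
      have h := congrArg (resFun hO) (hv' l)
      rw [map_mul, resFun_resFun, resFun_resFun] at h
      exact h)
  have hV₀ : HasCoords j (img hι (chart k 0)) v₀ := hjV 0
  have hV₁ : HasCoords j (img hι (chart k 1)) v₁ := hjV 1
  have hcov (x : PSpace k 1) : x ∈ chart k 0 ∨ x ∈ chart k 1 := by
    obtain ⟨a, ha⟩ := Opens.mem_iSup.1 (top_le_iSup_chart (show x ∈ ⊤ from trivial))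
    obtain rfl | rfl := (Fin.forall_fin_two.2 ⟨.inl rfl, .inr rfl⟩ : ∀ a : Fin 2, a = 0 ∨ a = 1) a
    · exact .inl ha
    · exact .inr ha
  refine ⟨j, hjk, ?_, hιj, ?_⟩
  · refine isClosedImmersion_of_ropeChart (hι := hι) j (hιj ▸ hfc) fun x => ?_
    obtain hx | hx := hcov x
    · exact ⟨_, hx, ropeChart hι α hα 0, fun u =>
        hV₀.germ_mem_range_of_mem_ratios hjk (mem_img hι hx) hu₀ hw₀ (hgen₀ u)⟩
    · exact ⟨_, hx, ropeChart hι α hα 1, fun u =>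
        hV₁.germ_mem_range_of_mem_ratios hjk (mem_img hι hx) hu₁ hw₁ (hgen₁ u)⟩
  · refine isLinearlyNormal_of_coords hjk ?_ hO₀ hO₁ hV₀ hV₁ g hv' hsec'
    intro y _
    obtain ⟨x, rfl⟩ := hι.surjective y
    obtain hx | hx := hcov x
    · exact .inl (mem_img hι hx)
    · exact .inr (mem_img hι hx)

end embedding

end ThreeRope

end

open ThreeRope in
theorem corollary4p5 {k : Type u} [Field k] [IsAlgClosed k] [CharZero k]
    (a b : ℤ) (hab : b ≤ a)
    (Y' : Scheme.{u}) [Y'.Over (Spec (.of k))]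
    (ι : PSpace k 1 ⟶ Y') (hιk : ι.IsOver (Spec (.of k)))
    (hι : IsRope ι (splitBundle k a b))
    (N M : ℕ) (hN : max 4 (a - 1) ≤ (N : ℤ))
    (hM : M = N + h0 k (serreTwist (splitBundle k a b) N))
    (i : PSpace k 1 ⟶ PSpace k N) (hi : IsRationalNormalCurve i)
    (ℓ : PSpace k N ⟶ PSpace k M) (hℓ : IsLinearEmbedding ℓ) :
    ∃ j : Y' ⟶ PSpace k M, j.IsOver (Spec (.of k)) ∧ IsClosedImmersion j ∧
      ι ≫ j = i ≫ ℓ ∧ IsLinearlyNormal j := by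
  obtain ⟨hN₁, hN₂⟩ := max_le_iff.1 hN
  obtain ⟨F, G, hF, hG, hFG, hspan⟩ := exists_polynomial_coords hi hℓ
  have hic := hi.isEmbedding.isClosedImmersion
  have hℓc := hℓ.isClosedImmersion
  have h₁ := hi.isEmbedding.isOver
  have h₂ := hℓ.isOver
  refine exists_embedding hab hιk hι (by lia) (by lia) hM ?_ inferInstance hF hG hFG hspan
  rw [Scheme.Hom.isOver_iff, Category.assoc, (Scheme.Hom.isOver_iff _).1 h₂,
    (Scheme.Hom.isOver_iff _).1 h₁]
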